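/- **Channel.** Let $n_d\ge 1$, $n_c\ge 0$ and $T\ge 1$ be integers, $q=\max\{n_d,n_c\}$, $\alpha=n_c/n_d$ and $p\in[0,1]$. In coherence block $k=1,\dots,K$ the two-user bursty interference channel is $$Y_{1,k}=S_{n_d}X_{1,k}\oplus B_{1,k}S_{n_c}X_{2,k},\qquad Y_{2,k}=S_{n_d}X_{2,k}\oplus B_{2,k}S_{n_c}X_{1,k},$$ with $X_{i,k},Y_{i,k}\in\mathbb F_2^{q\times T}$; here $S_u\in\mathbb F_2^{q\times q}$ moves the top $u$ components of a vector to the bottom $u$ positions and puts zeros above. The states $B_{i,k}$ ($i=1,2$, $k\ge1$) are i.i.d. Bernoulli with $\Pr(B_{i,k}=1)=p$; in particular $B_1^K$ and $B_2^K$ are independent. With local CSIRT, a code consists of encoders $f_i:(W_i,B_i^K)\mapsto X_i^K$ and decoders $g_i:(Y_i^K,B_i^K)\mapsto\hat W_i$, where $W_1,W_2$ are independent of each other and of the states and $W_i$ is uniform on a set of $\lceil 2^{KTR_i}\rceil$ messages. A pair $(R_1,R_2)$ with $R_1,R_2\ge0$ is achievable (for this $T$) if for some sequence of codes $\Pr(\hat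 W_1\ne W_1\text{ or }\hat W_2\neq W_2)\to0$ as $K\to\infty$. The capacity region $\mathcal C$ is the closure of the set of achievable pairs. **Notation.** $H_b(x)=-x\log_2x-(1-x)\log_2(1-x)$ and $H_{\rm sum}(x,y)=H_b(x(1-y)+(1-x)y)$. Put $p_3=(1-p)p_1+pp_2$, $\tilde p_3=(1-p)\tilde p_1+p\tilde p_2$, $\hat p_3=(1-p)\hat p_1$, $\tilde\eta=p+\eta_1(1-p)$, and likewise $q_3,\tilde q_3,\hat q_3$ and $\tilde\gamma=p+\gamma_1(1-p)$. Write $a\star b=a(1-b)+(1-a)b$. Below only $R_1$ is displayed; $R_2$ is always obtained from $R_1$ by exchanging $p_i,\tilde p_i,\hat p_1,\eta_1,\eta'$ with $q_i,\tilde q_i,\hat q_1,\gamma_1,\gamma'$ respectively (and so $p_3\leftrightarrow q_3$, $\tilde\eta\leftrightarrow\tilde\gamma$, etc.). **Statement.** The following holds for all parameters with $p_i,\tilde p_i,\hat p_1,q_i,\tilde q_i,\hat q_1\in[0,\tfrac12]$ and $\eta_1,\eta',\gamma_1,\gamma'\in[\tfrac12,1]$. 1. If $\alpha\le\frac12$,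 some $(R_1,R_2)\in\mathcal C$ has $R_1+R_2=2(n_d-pn_c)$. In each of the following cases $(R_1,R_2)\in\mathcal C$: 2. $\frac12<\alpha\le\frac23$: $$R_1=(n_d-n_c)+(1-p)\big[(n_d-n_c)+(2n_c-n_d)H_b(p_1)\big]+p(2n_c-n_d)(1-H_b(q_3)).$$ 3. $\frac23\le\alpha\le\frac34$: $$\begin{aligned}R_1={}&(n_d-n_c)+(1-p)\Big[\tfrac{3n_c-2n_d}2\big(H_b(\eta_1)+H_b(\hat p_1)+H_b(p_1)\big)+\tfrac{4n_d-5n_c}2H_b(\tilde p_1)+(n_d-n_c)\Big]\\&+p\Big[\tfrac{3n_c-2n_d}2\big(1+H_{\rm sum}(p_2,\tilde\gamma)-H_b(\tilde\gamma)+H_{\rm sum}(\tilde p_2,q_3)-H_b(q_3)-H_b(\hat q_3)\big)+\tfrac{4n_d-5n_c}2\big(1-H_b(\tilde q_3)\big)\Big].\end{aligned}$$ 4. $\frac34\le\alpha\le\frac45$: $$\begin{aligned}R_1={}&(n_d-n_c)+(1-p)\Big[\tfrac{3n_c-2n_d}2\big(H_b(p_1)+H_b(\eta_1)+H_b(\hat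 p_1)\big)+\tfrac{4n_d-5n_c}2H_b(\tilde p_1)+(n_d-n_c)\Big]\\&+p\Big[\tfrac{3n_c-2n_d}2\big(H_{\rm sum}(p_2,\tilde\gamma)-H_b(\tilde\gamma)+1-H_b(\hat q_3)\big)+\tfrac{4n_d-5n_c}2\big(H_{\rm sum}(\tilde p_2,q_3)-H_b(q_3)+1-H_b(\tilde q_3)\big)\Big].\end{aligned}$$ 5. $\frac45\le\alpha\le\frac67$: $$\begin{aligned}R_1={}&(n_d-n_c)+(1-p)\Big[\tfrac{5n_c-4n_d}2(1+H_b(\eta'))+(n_d-n_c)\big(1+H_b(p_1)+H_b(\eta_1)+H_b(\hat p_1)\big)\Big]\\&+p\Big[\tfrac{5n_c-4n_d}2\big(1-H_b(\tilde\gamma)+H_{\rm sum}(p_2,\gamma')-H_b(\gamma')+H_{\rm sum}(\eta'\star\tilde\gamma,q_3)-H_b(q_3)\big)\\&\qquad+\tfrac{6n_d-7n_c}2\big(H_{\rm sum}(p_2,\tilde\gamma)-H_b(\tilde\gamma)\big)+(n_d-n_c)(1-H_b(\hat q_3))\Big].\end{aligned}$$ 6. $\frac67\le\alpha\le1$: $$\begin{aligned}R_1={}&(n_d-n_c)+(1-p)\Big[(6n_c-5n_d)H_b(p_1)+(n_d-n_c)\big(2+H_b(\eta_1)+H_b(\eta')+H_b(\hat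 p_1)\big)\Big]\\&+p\Big[(n_d-n_c)\big(2-H_b(\tilde\gamma)-H_b(\hat q_3)+H_{\rm sum}(\eta'\star\tilde\gamma,q_3)-H_b(q_3)\big)\\&\qquad+(n_d-n_c)\big(H_{\rm sum}(p_2,\gamma')-H_b(\gamma')\big)+(7n_c-6n_d)\big(H_{\rm sum}(p_2,q_3)-H_b(q_3)\big)\Big].\end{aligned}$$ 7. $1\le\alpha\le\frac65$: $$\begin{aligned}R_1={}&(n_c-n_d)+(1-p)\Big[(5n_d-4n_c)H_b(p_1)+(n_c-n_d)\big(1+H_b(\eta_1)+H_b(\eta')\big)\Big]\\&+p\Big[(n_c-n_d)\big(1-H_b(\tilde\gamma)+H_{\rm sum}(\eta'\star\tilde\gamma,q_3)-H_b(q_3)\big)\\&\qquad+(n_c-n_d)\big(H_{\rm sum}(p_2,\gamma')-H_b(\gamma')\big)+(6n_d-5n_c)\big(H_{\rm sum}(p_2,q_3)-H_b(q_3)\big)\Big].\end{aligned}$$ 8. $\frac65\le\alpha\le\frac43$: $$\begin{aligned}R_1={}&\big(2n_d-\tfrac{3n_c}2\big)+(1-p)\Big[\big(2n_d-\tfrac{3n_c}2\big)H_b(\eta_1)+2(n_c-n_d)+(n_c-n_d)H_b(p_1)\Big]\\&+p\Big[(n_c-n_d)(1-H_b(q_3))+\big(2n_d-\tfrac{3n_c}2\big)(1-H_b(\tilde\gamma))+\big(\tfrac{5n_c}2-3n_d\big)\Big].\end{aligned}$$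 9. $\frac43\le\alpha\le\frac32$: $$\begin{aligned}R_1={}&\big(n_d-\tfrac{n_c}2\big)+(1-p)\Big[(3n_d-2n_c)(1+H_b(p_1))+\big(\tfrac{3n_c}2-2n_d\big)(1+H_b(\eta_1))\Big]\\&+p\Big[(3n_d-2n_c)(1-H_b(q_3))+\big(\tfrac{3n_c}2-2n_d\big)(1-H_b(\tilde\gamma))\Big].\end{aligned}$$ 10. $\frac32\le\alpha\le2$: $$R_1=(n_c-n_d)+(1-p)\big(n_d-\tfrac{n_c}2\big)(1+H_b(\eta_1))+p\big(n_d-\tfrac{n_c}2\big)(1-H_b(\tilde\gamma)).$$ -/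

import Mathlib

open Filter Topology

namespace BurstyIC

/-! ### Entropy functions (logarithms to base 2) -/

/-- Binary entropy `H_b(x)` in bits. -/
noncomputable def Hb (x : ℝ) : ℝ :=
  -x * Real.logb 2 x - (1 - x) * Real.logb 2 (1 - x)

/-- `H_sum(x, y)`: entropy of the modulo-2 sum of independent Bernoulli variables with
parameters `x` and `y`. -/
noncomputable def Hsum (x y : ℝ) : ℝ := Hb (x * (1 - y) + (1 - x) * y)

/-! ### The bursty linear deterministic interference channel -/

/-- Input or output of one coherence block: a `q × T` matrix over `𝔽₂`.
Row `0` is the top (most significant) level, the columns are the `T` channel uses. -/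
abbrev Block (q T : ℕ) : Type := Matrix (Fin q) (Fin T) (ZMod 2)

/-- The down-shift matrix `S_u` (for `u ≤ q`): it moves the top `u` components of a vector of
length `q` to the bottom `u` positions and puts zeros above. -/
def shiftMatrix (q u : ℕ) : Matrix (Fin q) (Fin q) (ZMod 2) :=
  Matrix.of fun i j => if (i : ℕ) = (j : ℕ) + (q - u) then 1 else 0

/-- Received block `S_{nd} X ⊕ B S_{nc} X'` of a user that sends `X`, while the other user sends
`X'` and `B = b` is the interference state. -/
def output (nd nc : ℕ) {T : ℕ} (b : Bool) (X X' : Block (max nd nc) T) : Block (max nd nc) T :=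
  shiftMatrix (max nd nc) nd * X +
    (if b then (1 : ZMod 2) else 0) • (shiftMatrix (max nd nc) nc * X')

/-- A code over `K` coherence blocks of length `T`, with local state information at transmitters
and receivers: encoder `i` and decoder `i` know the state sequence `B_i^K`, and nothing about
the states of the other user. -/
structure Code (nd nc K T M₁ M₂ : ℕ) where
  enc₁ : Fin M₁ → (Fin K → Bool) → Fin K → Block (max nd nc) T
  enc₂ : Fin M₂ → (Fin K → Bool) → Fin K → Block (max nd nc) T
  dec₁ : (Fin K → Block (max nd nc) T) → (Fin K → Bool) → Fin M₁
  dec₂ : (Fin K → Block (max nd nc) T) → (Fin K → Bool) → Fin M₂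

/-- Probability of a state sequence that is i.i.d. Bernoulli with activation probability `p`. -/
noncomputable def stateProb (p : ℝ) {K : ℕ} (b : Fin K → Bool) : ℝ :=
  ∏ k, if b k then p else 1 - p

namespace Code

variable {nd nc K T M₁ M₂ : ℕ}

/-- Message estimate of receiver 1 for messages `w₁, w₂` and state sequences `b₁, b₂`. -/
def est₁ (c : Code nd nc K T M₁ M₂) (w₁ : Fin M₁) (w₂ : Fin M₂) (b₁ b₂ : Fin K → Bool) :
    Fin M₁ :=
  c.dec₁ (fun k => output nd nc (b₁ k) (c.enc₁ w₁ b₁ k) (c.enc₂ w₂ b₂ k)) b₁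

/-- Message estimate of receiver 2 for messages `w₁, w₂` and state sequences `b₁, b₂`. -/
def est₂ (c : Code nd nc K T M₁ M₂) (w₁ : Fin M₁) (w₂ : Fin M₂) (b₁ b₂ : Fin K → Bool) :
    Fin M₂ :=
  c.dec₂ (fun k => output nd nc (b₂ k) (c.enc₂ w₂ b₂ k) (c.enc₁ w₁ b₁ k)) b₂

/-- The probability that at least one message estimate is wrong. The two messages are uniformly
distributed, and the messages and the two state sequences are independent. -/
noncomputable def errorProb (c : Code nd nc K T M₁ M₂) (p : ℝ) : ℝ :=
  ∑ w₁ : Fin M₁, ∑ w₂ : Fin M₂, ∑ b₁ : Fin K → Bool, ∑ b₂ : Fin K → Bool,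
    (1 / (M₁ : ℝ)) * (1 / (M₂ : ℝ)) * stateProb p b₁ * stateProb p b₂ *
      (if c.est₁ w₁ w₂ b₁ b₂ ≠ w₁ ∨ c.est₂ w₁ w₂ b₁ b₂ ≠ w₂ then 1 else 0)

end Code

/-- Number of messages `⌈2^{K T R}⌉` of a user with rate `R` (bits per channel use). -/
noncomputable def numMessages (K T : ℕ) (R : ℝ) : ℕ := ⌈(2 : ℝ) ^ ((K : ℝ) * (T : ℝ) * R)⌉₊

/-- `(R₁, R₂)` is achievable for coherence time `T` and activation probability `p`: some sequence
of codes, indexed by the number `K` of coherence blocks, has vanishing error probability. -/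
def Achievable (nd nc T : ℕ) (p : ℝ) (R : ℝ × ℝ) : Prop :=
  0 ≤ R.1 ∧ 0 ≤ R.2 ∧
    ∃ c : ∀ K : ℕ, Code nd nc K T (numMessages K T R.1) (numMessages K T R.2),
      Tendsto (fun K => (c K).errorProb p) atTop (𝓝 0)

/-- The capacity region: the closure of the set of achievable rate pairs. -/
def capacityRegion (nd nc T : ℕ) (p : ℝ) : Set (ℝ × ℝ) :=
  closure {R | Achievable nd nc T p R}

/-! ### The rate expressions

Each function is the rate of one user. The variables `x…`, `e…` are the parameters of that user,
the variables `y…`, `g…` those of the other user. The suffix `t` stands for a tilde, `h` for a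
hat, and `e'`, `g'` for a prime. -/

/-- `(1 - p) a + p b`. -/
def mix (p a b : ℝ) : ℝ := (1 - p) * a + p * b

/-- Weak interference. -/
noncomputable def rateWI (nd nc p x1 y1 y2 : ℝ) : ℝ :=
  let y3 := mix p y1 y2
  (nd - nc) + (1 - p) * ((nd - nc) + (2 * nc - nd) * Hb x1)
    + p * (2 * nc - nd) * (1 - Hb y3)

/-- Moderate interference, `2/3 ≤ α ≤ 3/4`. -/
noncomputable def rateMI1 (nd nc p x1 x2 xt1 xt2 xh1 e1 y1 y2 yt1 yt2 yh1 g1 : ℝ) : ℝ :=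
  let y3 := mix p y1 y2
  let yt3 := mix p yt1 yt2
  let yh3 := (1 - p) * yh1
  let gt := p + g1 * (1 - p)
  (nd - nc)
    + (1 - p) * ((3 * nc - 2 * nd) / 2 * (Hb e1 + Hb xh1 + Hb x1)
        + (4 * nd - 5 * nc) / 2 * Hb xt1 + (nd - nc))
    + p * ((3 * nc - 2 * nd) / 2 *
          (1 + Hsum x2 gt - Hb gt + Hsum xt2 y3 - Hb y3 - Hb yh3)
        + (4 * nd - 5 * nc) / 2 * (1 - Hb yt3))

/-- Moderate interference, `3/4 ≤ α ≤ 4/5`. -/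
noncomputable def rateMI2 (nd nc p x1 x2 xt1 xt2 xh1 e1 y1 y2 yt1 yt2 yh1 g1 : ℝ) : ℝ :=
  let y3 := mix p y1 y2
  let yt3 := mix p yt1 yt2
  let yh3 := (1 - p) * yh1
  let gt := p + g1 * (1 - p)
  (nd - nc)
    + (1 - p) * ((3 * nc - 2 * nd) / 2 * (Hb x1 + Hb e1 + Hb xh1)
        + (4 * nd - 5 * nc) / 2 * Hb xt1 + (nd - nc))
    + p * ((3 * nc - 2 * nd) / 2 * (Hsum x2 gt - Hb gt + 1 - Hb yh3)
        + (4 * nd - 5 * nc) / 2 * (Hsum xt2 y3 - Hb y3 + 1 - Hb yt3))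

/-- Moderate interference, `4/5 ≤ α ≤ 6/7`. -/
noncomputable def rateMI3 (nd nc p x1 x2 xh1 e1 e' y1 y2 yh1 g1 g' : ℝ) : ℝ :=
  let y3 := mix p y1 y2
  let yh3 := (1 - p) * yh1
  let gt := p + g1 * (1 - p)
  (nd - nc)
    + (1 - p) * ((5 * nc - 4 * nd) / 2 * (1 + Hb e')
        + (nd - nc) * (1 + Hb x1 + Hb e1 + Hb xh1))
    + p * ((5 * nc - 4 * nd) / 2 *
          (1 - Hb gt + Hsum x2 g' - Hb g' + Hsum (e' * (1 - gt) + (1 - e') * gt) y3 - Hb y3)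
        + (6 * nd - 7 * nc) / 2 * (Hsum x2 gt - Hb gt)
        + (nd - nc) * (1 - Hb yh3))

/-- Moderate interference, `6/7 ≤ α ≤ 1`. -/
noncomputable def rateMI4 (nd nc p x1 x2 xh1 e1 e' y1 y2 yh1 g1 g' : ℝ) : ℝ :=
  let y3 := mix p y1 y2
  let yh3 := (1 - p) * yh1
  let gt := p + g1 * (1 - p)
  (nd - nc)
    + (1 - p) * ((6 * nc - 5 * nd) * Hb x1
        + (nd - nc) * (2 + Hb e1 + Hb e' + Hb xh1))
    + p * ((nd - nc) *
          (2 - Hb gt - Hb yh3 + Hsum (e' * (1 - gt) + (1 - e') * gt) y3 - Hb y3)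
        + (nd - nc) * (Hsum x2 g' - Hb g')
        + (7 * nc - 6 * nd) * (Hsum x2 y3 - Hb y3))

/-- Strong interference, `1 ≤ α ≤ 6/5`. -/
noncomputable def rateSI1 (nd nc p x1 x2 e1 e' y1 y2 g1 g' : ℝ) : ℝ :=
  let y3 := mix p y1 y2
  let gt := p + g1 * (1 - p)
  (nc - nd)
    + (1 - p) * ((5 * nd - 4 * nc) * Hb x1 + (nc - nd) * (1 + Hb e1 + Hb e'))
    + p * ((nc - nd) *
          (1 - Hb gt + Hsum (e' * (1 - gt) + (1 - e') * gt) y3 - Hb y3)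
        + (nc - nd) * (Hsum x2 g' - Hb g')
        + (6 * nd - 5 * nc) * (Hsum x2 y3 - Hb y3))

/-- Strong interference, `6/5 ≤ α ≤ 4/3`. -/
noncomputable def rateSI2 (nd nc p x1 e1 y1 y2 g1 : ℝ) : ℝ :=
  let y3 := mix p y1 y2
  let gt := p + g1 * (1 - p)
  (2 * nd - 3 * nc / 2)
    + (1 - p) * ((2 * nd - 3 * nc / 2) * Hb e1 + 2 * (nc - nd) + (nc - nd) * Hb x1)
    + p * ((nc - nd) * (1 - Hb y3) + (2 * nd - 3 * nc / 2) * (1 - Hb gt)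
        + (5 * nc / 2 - 3 * nd))

/-- Strong interference, `4/3 ≤ α ≤ 3/2`. -/
noncomputable def rateSI3 (nd nc p x1 e1 y1 y2 g1 : ℝ) : ℝ :=
  let y3 := mix p y1 y2
  let gt := p + g1 * (1 - p)
  (nd - nc / 2)
    + (1 - p) * ((3 * nd - 2 * nc) * (1 + Hb x1) + (3 * nc / 2 - 2 * nd) * (1 + Hb e1))
    + p * ((3 * nd - 2 * nc) * (1 - Hb y3) + (3 * nc / 2 - 2 * nd) * (1 - Hb gt))

/-- Strong interference, `3/2 ≤ α ≤ 2`. -/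
noncomputable def rateSI4 (nd nc p e1 g1 : ℝ) : ℝ :=
  let gt := p + g1 * (1 - p)
  (nc - nd) + (1 - p) * ((nd - nc / 2) * (1 + Hb e1)) + p * (nd - nc / 2) * (1 - Hb gt)

end BurstyIC

/-! Let $D=|n_d-n_c|>0$. Both shifts preserve the residue of a level modulo $D$, so the channel is a
union of $D$ non-interacting chains in which interference arrives displaced by one level from the
own signal. With $q=nD+r$ there are $r$ chains of $n+1$ levels and $D-r$ chains of $n$ levels. Every
rate formula is the corresponding combination of one rate pair for each of the two chain lengths
(`mem_capacityRegion_of_chainDom`). For $n_c=n_d$ the chains have a single level.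

Interference is treated as noise. A user draws independent latent bits whose parameters depend on
its own state, and draws a fresh random codeword for every message and state sequence. A threshold
decoder compares product metrics: Markov's inequality controls the wrong codewords and a Chernoff
bound the right one (`exists_code`, `outage_le`). The metric acts as if the noise bits in different
readings were independent. Only the mean of its logarithm enters, so repeated noise bits do no harm,
and the rate is the sum over bits of $H_{\rm sum}(\pi,\nu)-H_b(\nu)$ (`rate_toBlock`). Schemes can
be time-shared, hence by Hahn–Banach it is enough to find, for each nonnegative direction, a scheme
whose weighted sum rate is at least that of the target (`mem_capacityRegion`). `ChainDom` is this
property for a single chain.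

Short chains are served by explicit signalling: independent bits, repetition of a bit so that the
other receiver can cancel it, or sums of two bits. The terms with $\eta',\gamma'$ are handled
differently, since no scheme with exactly these rates is constructed. The inequality $H_{\rm
sum}(x,y)\le H_b(x)+H_b(y)-H_b(x)H_b(y)$ (`Hsum_le`) bounds the weighted sum rate of these levels by
an affine function of $H_b(\eta')$ and $H_b(\gamma')$. If both slopes are nonnegative, its maximum
is at $\eta'=\gamma'=\frac12$, which independent bits attain. Otherwise a repetition scheme does at
least as well (`core_le`). On long chains the levels where both users collide must be traded as
well, and `sum_rate_level_le` does this.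

The analytic input concerns $C(u)=1-H_b((1-u)/2)$. It is a power series in $u^2$ with nonnegative
coefficients whose partial sums are at most one. This yields $C(u)C(v)\le C(uv)$, which is `Hsum_le`
in disguise, and $C(cu)\le c^2C(u)$ for $0\le c\le1$. -/

namespace BurstyIC

/-! ### Binary entropy -/

theorem Hb_eq_binEntropy (x : ℝ) : Hb x = Real.binEntropy x / Real.log 2 := by
  unfold Hb Real.logb
  rw [Real.binEntropy_eq_negMulLog_add_negMulLog_one_sub]
  unfold Real.negMulLog
  ring

theorem log_two_pos : 0 < Real.log 2 := Real.log_pos one_lt_two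

@[simp] theorem Hb_zero : Hb 0 = 0 := by simp [Hb_eq_binEntropy]

@[simp] theorem Hb_half : Hb (1 / 2) = 1 := by
  rw [Hb_eq_binEntropy, one_div, Real.binEntropy_two_inv, div_self log_two_pos.ne']

theorem Hb_one_sub (x : ℝ) : Hb (1 - x) = Hb x := by simp [Hb_eq_binEntropy]

theorem Hb_nonneg {x : ℝ} (h0 : 0 ≤ x) (h1 : x ≤ 1) : 0 ≤ Hb x := by
  rw [Hb_eq_binEntropy]
  exact div_nonneg (Real.binEntropy_nonneg h0 h1) log_two_pos.le

theorem Hb_le_one (x : ℝ) : Hb x ≤ 1 := by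
  rw [Hb_eq_binEntropy, div_le_one log_two_pos]
  exact Real.binEntropy_le_log_two

theorem concaveOn_Hb : ConcaveOn ℝ (Set.Icc 0 1) Hb := by
  have h := Real.strictConcave_binEntropy.concaveOn.smul (c := (Real.log 2)⁻¹)
    (inv_nonneg.2 log_two_pos.le)
  have e : Hb = fun x => (Real.log 2)⁻¹ • Real.binEntropy x := by
    funext x
    rw [Hb_eq_binEntropy, smul_eq_mul, div_eq_inv_mul]
  rw [e]
  exact h

theorem continuous_Hb : Continuous Hb := by
  have : Hb = fun x => Real.binEntropy x / Real.log 2 := funext Hb_eq_binEntropy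
  rw [this]
  fun_prop

theorem Hb_mono {x y : ℝ} (h0 : 0 ≤ x) (hxy : x ≤ y) (hy : y ≤ 1 / 2) : Hb x ≤ Hb y := by
  rw [Hb_eq_binEntropy, Hb_eq_binEntropy]
  refine div_le_div_of_nonneg_right ?_ log_two_pos.le
  refine Real.binEntropy_strictMonoOn.monotoneOn ⟨h0, ?_⟩ ⟨h0.trans hxy, ?_⟩ hxy
  · norm_num at hy ⊢; linarith
  · norm_num at hy ⊢; linarith

theorem mix_mem {p a b : ℝ} (hp : p ∈ Set.Icc (0 : ℝ) 1) {l u : ℝ} (ha : a ∈ Set.Icc l u)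
    (hb : b ∈ Set.Icc l u) : mix p a b ∈ Set.Icc l u := by
  obtain ⟨h0, h1⟩ := hp
  obtain ⟨ha0, ha1⟩ := ha
  obtain ⟨hb0, hb1⟩ := hb
  unfold mix
  constructor <;> nlinarith

theorem mix_Hb_le {p a b : ℝ} (hp : p ∈ Set.Icc (0 : ℝ) 1) (ha : a ∈ Set.Icc (0 : ℝ) 1)
    (hb : b ∈ Set.Icc (0 : ℝ) 1) : (1 - p) * Hb a + p * Hb b ≤ Hb (mix p a b) := by
  have := concaveOn_Hb.2 ha hb (sub_nonneg.2 hp.2) hp.1 (by ring)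
  simpa [mix] using this

theorem star_mem {x y : ℝ} (hx : x ∈ Set.Icc (0 : ℝ) 1) (hy : y ∈ Set.Icc (0 : ℝ) 1) :
    x * (1 - y) + (1 - x) * y ∈ Set.Icc (0 : ℝ) 1 := by
  obtain ⟨h0, h1⟩ := hx
  obtain ⟨h2, h3⟩ := hy
  constructor <;> nlinarith [mul_nonneg h0 h2, mul_nonneg (sub_nonneg.2 h1) (sub_nonneg.2 h3),
    mul_nonneg h0 (sub_nonneg.2 h3), mul_nonneg (sub_nonneg.2 h1) h2]

theorem Hsum_comm (x y : ℝ) : Hsum x y = Hsum y x := by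
  unfold Hsum; congr 1; ring

@[simp] theorem Hsum_half (y : ℝ) : Hsum (1 / 2) y = 1 := by
  unfold Hsum
  rw [show (1 / 2 : ℝ) * (1 - y) + (1 - 1 / 2) * y = 1 / 2 by ring, Hb_half]

@[simp] theorem Hsum_half' (x : ℝ) : Hsum x (1 / 2) = 1 := by rw [Hsum_comm, Hsum_half]

@[simp] theorem Hsum_zero (y : ℝ) : Hsum 0 y = Hb y := by simp [Hsum]

@[simp] theorem Hsum_zero' (x : ℝ) : Hsum x 0 = Hb x := by simp [Hsum]

theorem Hsum_le_one (x y : ℝ) : Hsum x y ≤ 1 := Hb_le_one _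

/-- The parameter of the sum is a mixture of `y` and `1 - y`, which have equal entropy; concavity
does the rest. Every information term of a noisy bit is nonnegative for this reason. -/
theorem Hb_le_Hsum {x y : ℝ} (hx : x ∈ Set.Icc (0 : ℝ) 1) (hy : y ∈ Set.Icc (0 : ℝ) 1) :
    Hb y ≤ Hsum x y := by
  have := mix_Hb_le hx hy (b := 1 - y) ⟨by linarith [hy.2], by linarith [hy.1]⟩
  rw [Hb_one_sub] at this
  unfold Hsum
  unfold mix at this
  rw [show x * (1 - y) + (1 - x) * y = (1 - x) * y + x * (1 - y) by ring]
  linarith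

/-- `1 - H_b((1 - u) / 2)`, the capacity of a binary symmetric channel with bias `u`. -/
noncomputable def bscCap (u : ℝ) : ℝ := 1 - Hb ((1 - u) / 2)

theorem Hb_eq_bscCap (x : ℝ) : Hb x = 1 - bscCap (1 - 2 * x) := by
  unfold bscCap
  rw [show (1 - (1 - 2 * x)) / 2 = x by ring]; ring

theorem Hsum_eq_bscCap (x y : ℝ) : Hsum x y = 1 - bscCap ((1 - 2 * x) * (1 - 2 * y)) := by
  unfold Hsum
  rw [Hb_eq_bscCap]; congr 2; ring

@[simp] theorem bscCap_zero : bscCap 0 = 0 := by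
  unfold bscCap
  rw [sub_zero, Hb_half, sub_self]

@[simp] theorem bscCap_one : bscCap 1 = 1 := by simp [bscCap]

theorem bscCap_neg (u : ℝ) : bscCap (-u) = bscCap u := by
  unfold bscCap
  rw [← Hb_one_sub]; congr 2; ring

theorem bscCap_nonneg (u : ℝ) : 0 ≤ bscCap u := by
  unfold bscCap; linarith [Hb_le_one ((1 - u) / 2)]

theorem bscCap_mono {u v : ℝ} (h0 : 0 ≤ u) (huv : u ≤ v) (hv : v ≤ 1) : bscCap u ≤ bscCap v := by
  unfold bscCap
  linarith [Hb_mono (x := (1 - v) / 2) (y := (1 - u) / 2) (by linarith) (by linarith)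
    (by linarith)]

theorem convexOn_bscCap : ConvexOn ℝ (Set.Icc 0 1) bscCap := by
  refine ⟨convex_Icc 0 1, ?_⟩
  intro x hx y hy a b ha hb hab
  have := concaveOn_Hb.2 (x := (1 - x) / 2) (y := (1 - y) / 2)
    ⟨by linarith [hx.2], by linarith [hx.1]⟩ ⟨by linarith [hy.2], by linarith [hy.1]⟩ ha hb hab
  simp only [smul_eq_mul, bscCap] at this ⊢
  have e : (1 - (a * x + b * y)) / 2 = a * ((1 - x) / 2) + b * ((1 - y) / 2) := by
    have : b = 1 - a := by linarith
    subst this; ring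
  rw [e]
  nlinarith

/-- Coefficients of the power series of `bscCap`. -/
noncomputable def bscCoeff (k : ℕ) : ℝ := 1 / (Real.log 2 * ((2 * k + 1) * (2 * k + 2)))

theorem bscCoeff_nonneg (k : ℕ) : 0 ≤ bscCoeff k := by
  have := log_two_pos
  unfold bscCoeff; positivity

/-- One has $2\log 2\cdot C(u)=u\log\frac{1+u}{1-u}+\log(1-u^2)$. The two known logarithm series
combine into coefficients proportional to $\frac1{(2k+1)(2k+2)}$, all positive. -/
theorem hasSum_bscCap {u : ℝ} (h0 : 0 ≤ u) (h1 : u < 1) :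
    HasSum (fun k : ℕ => bscCoeff k * (u ^ 2) ^ (k + 1)) (bscCap u) := by
  have hu : |u| < 1 := by rwa [abs_of_nonneg h0]
  have hu2 : |u ^ 2| < 1 := by rw [abs_of_nonneg (sq_nonneg u)]; nlinarith
  have hA := (Real.hasSum_log_sub_log_of_abs_lt_one hu).mul_left u
  have hB := Real.hasSum_pow_div_log_of_abs_lt_one hu2
  have hC := (hA.sub hB).mul_left (1 / (2 * Real.log 2))
  have hl := log_two_pos.ne'
  have e1 : 1 - u ^ 2 = (1 - u) * (1 + u) := by ring
  have hn : (1 - u) ≠ 0 := by linarith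
  have hn' : (1 + u) ≠ 0 := by linarith
  have e2 : (fun k : ℕ => bscCoeff k * (u ^ 2) ^ (k + 1)) = fun k : ℕ =>
      1 / (2 * Real.log 2) * (u * (2 * (1 / (2 * (k : ℝ) + 1)) * u ^ (2 * k + 1))
        - (u ^ 2) ^ (k + 1) / ((k : ℝ) + 1)) := by
    funext k
    have h2 : (2 * (k : ℝ) + 1) ≠ 0 := by positivity
    have h3 : ((k : ℝ) + 1) ≠ 0 := by positivity
    unfold bscCoeff
    field_simp
    ring
  have e3 : bscCap u = 1 / (2 * Real.log 2) *
      (u * (Real.log (1 + u) - Real.log (1 - u)) - -Real.log (1 - u ^ 2)) := by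
    unfold bscCap
    rw [Hb, e1, Real.log_mul hn hn', show 1 - (1 - u) / 2 = (1 + u) / 2 by ring]
    unfold Real.logb
    rw [Real.log_div hn two_ne_zero, Real.log_div hn' two_ne_zero]
    field_simp
    ring
  rw [e2, e3]
  exact hC

/-- Partial sums of a nonnegative series lie below its sum. The endpoint `u = 1`, where the series
expansion is not available, follows by continuity; it is what bounds the sums of the coefficients by
one. -/
theorem sum_bscCoeff_mul_le {u : ℝ} (h0 : 0 ≤ u) (h1 : u ≤ 1) (n : ℕ) :
    ∑ k ∈ Finset.range n, bscCoeff k * (u ^ 2) ^ (k + 1) ≤ bscCap u := by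
  have key : ∀ v : ℝ, 0 ≤ v → v < 1 →
      ∑ k ∈ Finset.range n, bscCoeff k * (v ^ 2) ^ (k + 1) ≤ bscCap v := fun v hv0 hv1 =>
    sum_le_hasSum _ (fun k _ => mul_nonneg (bscCoeff_nonneg k) (by positivity))
      (hasSum_bscCap hv0 hv1)
  have hc : Continuous bscCap := by
    unfold bscCap
    exact continuous_const.sub (continuous_Hb.comp (by fun_prop))
  rcases h1.lt_or_eq with h | rfl
  · exact key u h0 h
  · have hmem : (1 : ℝ) ∈ closure (Set.Ico (0 : ℝ) 1) := by
      rw [closure_Ico zero_ne_one]; exact ⟨zero_le_one, le_rfl⟩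
    have hcl : IsClosed {v : ℝ | ∑ k ∈ Finset.range n, bscCoeff k * (v ^ 2) ^ (k + 1)
        ≤ bscCap v} := isClosed_le (by fun_prop) hc
    exact hcl.closure_subset_iff.2 (fun v hv => key v hv.1 hv.2) hmem

/-- Termwise: every power of $u^2$ in the series is at least the first, so scaling $u$ by $c$ gains
at least the factor $c^2$. -/
theorem bscCap_mul_le {c u : ℝ} (hc0 : 0 ≤ c) (hc1 : c ≤ 1) (h0 : 0 ≤ u) (h1 : u ≤ 1) :
    bscCap (c * u) ≤ c ^ 2 * bscCap u := by
  rcases hc1.lt_or_eq with hc | rfl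
  · have hcu : c * u < 1 := by nlinarith
    have hs := hasSum_bscCap (mul_nonneg hc0 h0) hcu
    refine hasSum_le_of_sum_le hs fun s => ?_
    obtain ⟨n, hn⟩ := s.exists_nat_subset_range
    have hle : ∀ k, bscCoeff k * ((c * u) ^ 2) ^ (k + 1)
        ≤ c ^ 2 * (bscCoeff k * (u ^ 2) ^ (k + 1)) := by
      intro k
      rw [mul_pow, mul_pow]
      have : (c ^ 2) ^ (k + 1) ≤ c ^ 2 := by
        rw [pow_succ]
        exact mul_le_of_le_one_left (sq_nonneg c) (pow_le_one₀ (sq_nonneg c) (by nlinarith))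
      have hb := mul_nonneg (bscCoeff_nonneg k) (pow_nonneg (sq_nonneg u) (k + 1))
      nlinarith [mul_le_mul_of_nonneg_right this hb]
    calc ∑ k ∈ s, bscCoeff k * ((c * u) ^ 2) ^ (k + 1)
        ≤ ∑ k ∈ Finset.range n, bscCoeff k * ((c * u) ^ 2) ^ (k + 1) :=
          Finset.sum_le_sum_of_subset_of_nonneg hn fun k _ _ =>
            mul_nonneg (bscCoeff_nonneg k) (by positivity)
      _ ≤ ∑ k ∈ Finset.range n, c ^ 2 * (bscCoeff k * (u ^ 2) ^ (k + 1)) :=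
          Finset.sum_le_sum fun k _ => hle k
      _ = c ^ 2 * ∑ k ∈ Finset.range n, bscCoeff k * (u ^ 2) ^ (k + 1) := by
          rw [Finset.mul_sum]
      _ ≤ c ^ 2 * bscCap u :=
          mul_le_mul_of_nonneg_left (sum_bscCoeff_mul_le h0 h1 n) (sq_nonneg c)
  · simp

/-- Weighted form of Chebyshev's sum inequality for powers. -/
theorem sum_mul_sum_pow_le (c : ℕ → ℝ) (hc : ∀ k, 0 ≤ c k) {x y : ℝ} (hx0 : 0 ≤ x) (hx1 : x ≤ 1)
    (hy0 : 0 ≤ y) (hy1 : y ≤ 1) (n : ℕ) :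
    (∑ k ∈ Finset.range n, c k * x ^ (k + 1)) * (∑ k ∈ Finset.range n, c k * y ^ (k + 1))
      ≤ (∑ k ∈ Finset.range n, c k) * ∑ k ∈ Finset.range n, c k * (x * y) ^ (k + 1) := by
  have h : 0 ≤ ∑ j ∈ Finset.range n, ∑ k ∈ Finset.range n,
      c j * c k * ((x ^ (j + 1) - x ^ (k + 1)) * (y ^ (j + 1) - y ^ (k + 1))) := by
    refine Finset.sum_nonneg fun j _ => Finset.sum_nonneg fun k _ =>
      mul_nonneg (mul_nonneg (hc j) (hc k)) ?_
    rcases le_total j k with hjk | hjk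
    · exact mul_nonneg (sub_nonneg.2 (pow_le_pow_of_le_one hx0 hx1 (by omega)))
        (sub_nonneg.2 (pow_le_pow_of_le_one hy0 hy1 (by omega)))
    · exact mul_nonneg_of_nonpos_of_nonpos
        (sub_nonpos.2 (pow_le_pow_of_le_one hx0 hx1 (by omega)))
        (sub_nonpos.2 (pow_le_pow_of_le_one hy0 hy1 (by omega)))
  have e : ∑ j ∈ Finset.range n, ∑ k ∈ Finset.range n,
      c j * c k * ((x ^ (j + 1) - x ^ (k + 1)) * (y ^ (j + 1) - y ^ (k + 1)))
      = 2 * ((∑ k ∈ Finset.range n, c k) * ∑ k ∈ Finset.range n, c k * (x * y) ^ (k + 1))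
        - 2 * ((∑ k ∈ Finset.range n, c k * x ^ (k + 1))
          * (∑ k ∈ Finset.range n, c k * y ^ (k + 1))) := by
    -- Expanding the double sum of products of differences gives twice the difference of the two
    -- sides. Each product is nonnegative because $x^{k+1}$ and $y^{k+1}$ both decrease in $k$.
    have e1 : ∀ j k, c j * c k * ((x ^ (j + 1) - x ^ (k + 1)) * (y ^ (j + 1) - y ^ (k + 1)))
        = (c j * (x * y) ^ (j + 1)) * c k + c j * (c k * (x * y) ^ (k + 1))
          - (c j * x ^ (j + 1)) * (c k * y ^ (k + 1))
          - (c j * y ^ (j + 1)) * (c k * x ^ (k + 1)) := by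
      intro j k; rw [mul_pow, mul_pow]; ring
    simp_rw [e1, Finset.sum_sub_distrib, Finset.sum_add_distrib, ← Finset.sum_mul_sum]
    ring
  linarith

/-- Chebyshev's inequality for the two power series, with the coefficients as weights: their partial
sums are at most $C(1)=1$, so the normalising factor can be dropped. Where an argument equals one,
the claim is trivial. -/
theorem bscCap_mul_bscCap_le {u v : ℝ} (hu0 : 0 ≤ u) (hu1 : u ≤ 1) (hv0 : 0 ≤ v) (hv1 : v ≤ 1) :
    bscCap u * bscCap v ≤ bscCap (u * v) := by
  rcases hu1.lt_or_eq with hu | rfl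
  · rcases hv1.lt_or_eq with hv | rfl
    · have hlim := (hasSum_bscCap hu0 hu).tendsto_sum_nat.mul (hasSum_bscCap hv0 hv).tendsto_sum_nat
      refine le_of_tendsto' hlim fun n => ?_
      have huv0 := mul_nonneg hu0 hv0
      have huv1 : u * v ≤ 1 := by nlinarith
      refine (sum_mul_sum_pow_le bscCoeff bscCoeff_nonneg (sq_nonneg u) (by nlinarith)
        (sq_nonneg v) (by nlinarith) n).trans ?_
      have h1 : ∑ k ∈ Finset.range n, bscCoeff k ≤ 1 := by
        have := sum_bscCoeff_mul_le zero_le_one le_rfl n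
        simpa using this
      have h2 := sum_bscCoeff_mul_le huv0 huv1 n
      rw [mul_pow] at h2
      have h3 : 0 ≤ ∑ k ∈ Finset.range n, bscCoeff k * (u ^ 2 * v ^ 2) ^ (k + 1) :=
        Finset.sum_nonneg fun k _ => mul_nonneg (bscCoeff_nonneg k) (by positivity)
      nlinarith
    · simp
  · simp

theorem bscCap_abs (u : ℝ) : bscCap |u| = bscCap u := by
  rcases abs_cases u with ⟨h, _⟩ | ⟨h, _⟩ <;> rw [h]
  exact bscCap_neg u

/-- The entropy of a modulo-2 sum is at most that of the inclusion-exclusion of the entropies. -/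
theorem Hsum_le {x y : ℝ} (hx : x ∈ Set.Icc (0 : ℝ) 1) (hy : y ∈ Set.Icc (0 : ℝ) 1) :
    Hsum x y ≤ Hb x + Hb y - Hb x * Hb y := by
  have h := bscCap_mul_bscCap_le (abs_nonneg (1 - 2 * x))
    (abs_le.2 ⟨by linarith [hx.2], by linarith [hx.1]⟩) (abs_nonneg (1 - 2 * y))
    (abs_le.2 ⟨by linarith [hy.2], by linarith [hy.1]⟩)
  rw [← abs_mul, bscCap_abs, bscCap_abs, bscCap_abs] at h
  rw [Hsum_eq_bscCap, Hb_eq_bscCap x, Hb_eq_bscCap y]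
  nlinarith

/-- Two terms of the series already suffice: $C(u)\ge(u^2/2+u^4/12)/\log 2$. -/
theorem one_le_bscCap_add {t : ℝ} (h0 : 0 ≤ t) (h1 : t ≤ 1) :
    1 ≤ 2 * bscCap t + 4 * bscCap (1 - t) := by
  have hq : ∀ u : ℝ, 0 ≤ u → u ≤ 1 → (u ^ 2 / 2 + u ^ 4 / 12) / Real.log 2 ≤ bscCap u := by
    intro u hu0 hu1
    refine le_trans (le_of_eq ?_) (sum_bscCoeff_mul_le hu0 hu1 2)
    have := log_two_pos.ne'
    simp [Finset.sum_range_succ, bscCoeff]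
    field_simp
    ring
  have ha := hq t h0 h1
  have hb := hq (1 - t) (by linarith) (by linarith)
  have hl : Real.log 2 < 0.6931471808 := Real.log_two_lt_d9
  have hpoly : (0.694 : ℝ) ≤ 2 * (t ^ 2 / 2 + t ^ 4 / 12)
      + 4 * ((1 - t) ^ 2 / 2 + (1 - t) ^ 4 / 12) := by
    -- The polynomial is smallest near $t=13/20$, where it is about $0.702$ and so just above $\log
    -- 2$.
    nlinarith [sq_nonneg (t - 13 / 20), sq_nonneg (t ^ 2 - (13 / 20) ^ 2),
      sq_nonneg ((1 - t) ^ 2 - (7 / 20) ^ 2)]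
  have : 1 ≤ (2 * (t ^ 2 / 2 + t ^ 4 / 12)
      + 4 * ((1 - t) ^ 2 / 2 + (1 - t) ^ 4 / 12)) / Real.log 2 := by
    rw [le_div_iff₀ log_two_pos]; linarith
  have e : (2 * (t ^ 2 / 2 + t ^ 4 / 12)
      + 4 * ((1 - t) ^ 2 / 2 + (1 - t) ^ 4 / 12)) / Real.log 2
      = 2 * ((t ^ 2 / 2 + t ^ 4 / 12) / Real.log 2)
        + 4 * (((1 - t) ^ 2 / 2 + (1 - t) ^ 4 / 12) / Real.log 2) := by ring
  linarith

/-- Write `z` and `A` as the fractions $t$ and $1-t$ of their sum. Supermultiplicativity gives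
$C(A+z)C(t)\le C(z)$ and $C(A+z)C(1-t)\le C(A)$, and `one_le_bscCap_add` combines the two. -/
theorem bscCap_add_le {A z : ℝ} (hA : 0 ≤ A) (hz : 0 ≤ z) (h : A + z ≤ 1) :
    bscCap (A + z) ≤ 2 * bscCap z + 4 * bscCap A := by
  rcases (add_nonneg hA hz).eq_or_lt with h0 | h0
  · rw [← h0, bscCap_zero]; linarith [bscCap_nonneg z, bscCap_nonneg A]
  · have ht0 : 0 ≤ z / (A + z) := div_nonneg hz h0.le
    have ht1 : z / (A + z) ≤ 1 := (div_le_one h0).2 (by linarith)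
    have e1 : (A + z) * (z / (A + z)) = z := by field_simp
    have e2 : (A + z) * (1 - z / (A + z)) = A := by field_simp; ring
    have h1 := bscCap_mul_bscCap_le h0.le h ht0 ht1
    have h2 := bscCap_mul_bscCap_le h0.le h (v := 1 - z / (A + z)) (by linarith) (by linarith)
    rw [e1] at h1
    rw [e2] at h2
    have h3 := mul_le_mul_of_nonneg_left (one_le_bscCap_add ht0 ht1) (bscCap_nonneg (A + z))
    nlinarith

/-- Increments of `bscCap` grow with the base point. -/
theorem bscCap_add_add_le {x y s t : ℝ} (hx : 0 ≤ x) (hs : 0 ≤ s) (ht : 0 ≤ t)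
    (h : x + s + t ≤ y) (hy : y ≤ 1) :
    bscCap (x + s) + bscCap (x + t) ≤ bscCap y + bscCap x := by
  rcases (add_nonneg hs ht).eq_or_lt with h0 | h0
  · have : s = 0 := by linarith
    have : t = 0 := by linarith
    subst_vars
    simp only [add_zero] at *
    linarith [bscCap_mono hx h hy]
  · have hz1 : x + s + t ∈ Set.Icc (0 : ℝ) 1 := ⟨by linarith, by linarith⟩
    have hx1 : x ∈ Set.Icc (0 : ℝ) 1 := ⟨hx, by linarith⟩
    -- `x + s` and `x + t` are complementary convex combinations of `x` and `x + s + t`; adding the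
    -- two convexity bounds gives the claim with `x + s + t` in place of `y`.
    have ha : s / (s + t) + t / (s + t) = 1 := by field_simp
    have h1 := convexOn_bscCap.2 hz1 hx1 (div_nonneg hs h0.le) (div_nonneg ht h0.le) ha
    have h2 := convexOn_bscCap.2 hx1 hz1 (div_nonneg hs h0.le) (div_nonneg ht h0.le) ha
    simp only [smul_eq_mul] at h1 h2
    have e1 : s / (s + t) * (x + s + t) + t / (s + t) * x = x + s := by field_simp; ring
    have e2 : s / (s + t) * x + t / (s + t) * (x + s + t) = x + t := by field_simp; ring
    rw [e1] at h1
    rw [e2] at h2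
    have h3 := bscCap_mono (u := x + s + t) (by linarith) h hy
    have e3 : s / (s + t) = 1 - t / (s + t) := by linarith
    rw [e3] at h1 h2
    linarith

/-- Bound on the sum rate of one fully interfering level. -/
theorem sum_rate_level_le {p p1 p2 q1 q2 : ℝ} (hp : p ∈ Set.Icc (0 : ℝ) 1)
    (hp1 : p1 ∈ Set.Icc (0 : ℝ) (1 / 2)) (hp2 : p2 ∈ Set.Icc (0 : ℝ) (1 / 2))
    (hq1 : q1 ∈ Set.Icc (0 : ℝ) (1 / 2)) (hq2 : q2 ∈ Set.Icc (0 : ℝ) (1 / 2)) (hpq : p1 ≤ q1) :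
    (1 - p) * Hb q1 + p * (Hsum q2 (mix p p1 p2) - Hb (mix p p1 p2)
      + Hsum p2 (mix p q1 q2) - Hb (mix p q1 q2)) ≤ 1 - p * Hb ((1 - p) * p1) := by
  obtain ⟨hp0, hpl⟩ := hp
  obtain ⟨w1, hw1⟩ : ∃ w1, w1 = 1 - 2 * p1 := ⟨_, rfl⟩
  obtain ⟨w, hw⟩ : ∃ w, w = 1 - 2 * q1 := ⟨_, rfl⟩
  obtain ⟨v1, hv1⟩ : ∃ v1, v1 = 1 - 2 * p2 := ⟨_, rfl⟩
  obtain ⟨v, hv⟩ : ∃ v, v = 1 - 2 * q2 := ⟨_, rfl⟩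
  have hw0 : 0 ≤ w := by linarith [hq1.2]
  have hwl : w ≤ 1 := by linarith [hq1.1]
  have hw1l : w1 ≤ 1 := by linarith [hp1.1]
  have hv0 : 0 ≤ v := by linarith [hq2.2]
  have hvl : v ≤ 1 := by linarith [hq2.1]
  have hv10 : 0 ≤ v1 := by linarith [hp2.2]
  have hv1l : v1 ≤ 1 := by linarith [hp2.1]
  have hww : w ≤ w1 := by linarith
  have hr : 0 ≤ 1 - p := by linarith
  rw [Hb_eq_bscCap q1, Hb_eq_bscCap (mix p p1 p2), Hb_eq_bscCap (mix p q1 q2),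
    Hb_eq_bscCap ((1 - p) * p1), Hsum_eq_bscCap, Hsum_eq_bscCap]
  have e1 : 1 - 2 * mix p p1 p2 = (1 - p) * w1 + p * v1 := by unfold mix; subst_vars; ring
  have e2 : 1 - 2 * mix p q1 q2 = (1 - p) * w + p * v := by unfold mix; subst_vars; ring
  have e3 : 1 - 2 * ((1 - p) * p1) = (1 - p) * w1 + p := by subst_vars; ring
  rw [e1, e2, e3, ← hw, ← hv, ← hv1]
  have hA : 0 ≤ (1 - p) * w := mul_nonneg hr hw0
  have hAA : (1 - p) * w ≤ (1 - p) * w1 := mul_le_mul_of_nonneg_left hww hr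
  have hAl : (1 - p) * w1 + p ≤ 1 := by nlinarith
  -- In terms of biases, with $A=(1-p)w$ and $A_1=(1-p)w_1$, the claim bounds $p$ times
  -- $C(A_1+pv_1)+C(A+pv)-C(v(A_1+pv_1))-C(v_1(A+pv))-C(A_1+p)$ by $(1-p)C(w)$.
  have s6 : bscCap ((1 - p) * w) ≤ (1 - p) ^ 2 * bscCap w :=
    bscCap_mul_le hr (by linarith) hw0 hwl
  clear e1 e2 e3
  generalize (1 - p) * w = A at *
  generalize (1 - p) * w1 = A1 at *
  have hpv : 0 ≤ p * v := mul_nonneg hp0 hv0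
  have hpv1 : 0 ≤ p * v1 := mul_nonneg hp0 hv10
  have hpv1l : p * v1 ≤ p := by nlinarith
  have hpvl : p * v ≤ p := by nlinarith
  have hz : 0 ≤ p * v * v1 := mul_nonneg hpv hv10
  have hz1 : p * v * v1 ≤ p * v := by nlinarith
  have hz2 : p * v * v1 ≤ p * v1 := by nlinarith [mul_le_mul_of_nonneg_right hvl hpv1]
  have hd : 0 ≤ A1 - A := by linarith
  -- Two exchange steps replace the pair $C(A_1+pv_1)+C(A+pv)$ by $C(A_1+p)+C(A+pvv_1)$.
  have s1 := bscCap_add_add_le (x := A + p * v1) (y := A1 + p) (s := A1 - A) (t := p - p * v1)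
    (by linarith) hd (by linarith) (by linarith) hAl
  have s2 := bscCap_add_add_le (x := A + p * v * v1) (y := A + p) (s := p * v1 - p * v * v1)
    (t := p * v - p * v * v1) (by linarith) (by linarith) (by linarith)
    (by nlinarith [mul_nonneg hp0 (mul_nonneg (sub_nonneg.2 hvl) (sub_nonneg.2 hv1l))])
    (by linarith)
  rw [show A + p * v1 + (A1 - A) = A1 + p * v1 by ring,
    show A + p * v1 + (p - p * v1) = A + p by ring] at s1
  rw [show A + p * v * v1 + (p * v1 - p * v * v1) = A + p * v1 by ring,
    show A + p * v * v1 + (p * v - p * v * v1) = A + p * v by ring] at s2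
  -- With $z=pvv_1$, the remaining $C(A+z)$ costs $2C(z)+4C(A)$; the two copies of $C(z)$ are
  -- absorbed by the two subtracted capacities, since $z$ is below both of their arguments.
  have s3 := bscCap_add_le hA hz (by linarith)
  have s4 : bscCap (p * v * v1) ≤ bscCap (v * (A1 + p * v1)) :=
    bscCap_mono hz (by nlinarith [mul_nonneg hv0 (hA.trans hAA)])
      (by nlinarith [mul_le_mul_of_nonneg_right hvl (by linarith : 0 ≤ A1 + p * v1)])
  have s5 : bscCap (p * v * v1) ≤ bscCap (v1 * (A + p * v)) :=
    bscCap_mono hz (by nlinarith [mul_nonneg hv10 hA])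
      (by nlinarith [mul_le_mul_of_nonneg_right hv1l (by linarith : 0 ≤ A + p * v)])
  -- The leftover is paid for by the interference-free state: $4p(1-p)^2C(w)\le(1-p)C(w)$ because
  -- $4p(1-p)\le1$.
  have s7 : p * (4 * bscCap A) ≤ (1 - p) * bscCap w := by
    have h4 : 4 * p * (1 - p) ≤ 1 := by nlinarith [sq_nonneg (2 * p - 1)]
    have := mul_le_mul_of_nonneg_left s6 (by linarith : 0 ≤ 4 * p)
    have h5 := mul_le_mul_of_nonneg_right h4 (mul_nonneg hr (bscCap_nonneg w))
    linear_combination this + h5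
  have s8 := mul_le_mul_of_nonneg_left
    (by linarith : bscCap (A1 + p * v1) + bscCap (A + p * v)
      ≤ bscCap (A1 + p) + bscCap (v * (A1 + p * v1)) + bscCap (v1 * (A + p * v))
        + 4 * bscCap A) hp0
  linear_combination s7 + s8

end BurstyIC

namespace BurstyIC

/-! ### Random coding with a threshold decoder -/

section Product

variable {I A : Type*} [Fintype I] [Fintype A]

theorem prod_sum_univ {B : I → Type*} [DecidableEq I] [∀ i, Fintype (B i)] (f : ∀ i, B i → ℝ) :
    ∏ i, ∑ a, f i a = ∑ c : ∀ i, B i, ∏ i, f i (c i) := by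
  rw [Finset.prod_univ_sum, Fintype.piFinset_univ]

variable [DecidableEq I]

theorem sum_prod_mul_apply (Q : I → A → ℝ) (hQ : ∀ i, ∑ a, Q i a = 1) (i₀ : I) (f : A → ℝ) :
    ∑ c : I → A, (∏ i, Q i (c i)) * f (c i₀) = ∑ a, Q i₀ a * f a := by
  have h : ∀ c : I → A, (∏ i, Q i (c i)) * f (c i₀)
      = ∏ i, Q i (c i) * (if i = i₀ then f (c i) else 1) := by
    intro c
    rw [Finset.prod_mul_distrib, Finset.prod_ite_eq' Finset.univ i₀ (fun i => f (c i)),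
      if_pos (Finset.mem_univ _)]
  simp_rw [h]
  rw [← prod_sum_univ (fun i a => Q i a * (if i = i₀ then f a else 1)),
    Finset.prod_eq_single i₀]
  · simp
  · intro i _ hi
    simp [hi, hQ]
  · simp

/-- Distinct coordinates of a product measure are independent. The value at `i₁` is frozen by
summing over an indicator, after which the summand factors over the coordinates. -/
theorem sum_prod_mul_apply₂ [DecidableEq A] (Q : I → A → ℝ) (hQ : ∀ i, ∑ a, Q i a = 1) {i₀ i₁ : I}
    (hi : i₀ ≠ i₁) (g : A → A → ℝ) :
    ∑ c : I → A, (∏ i, Q i (c i)) * g (c i₀) (c i₁)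
      = ∑ a, ∑ a', Q i₀ a * Q i₁ a' * g a a' := by
  have h : ∀ c : I → A, (∏ i, Q i (c i)) * g (c i₀) (c i₁)
      = ∑ a', (∏ i, Q i (c i) * (if i = i₁ then (if c i = a' then 1 else 0) else 1))
        * g (c i₀) a' := by
    intro c
    simp_rw [Finset.prod_mul_distrib]
    simp_rw [Finset.prod_ite_eq' Finset.univ i₁, if_pos (Finset.mem_univ _), mul_ite, mul_one,
      mul_zero, ite_mul, zero_mul]
    simp
  simp_rw [h]
  rw [Finset.sum_comm]
  have h2 : ∀ a' : A, ∑ c : I → A,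
      (∏ i, Q i (c i) * (if i = i₁ then (if c i = a' then 1 else 0) else 1)) * g (c i₀) a'
      = ∑ a, Q i₀ a * Q i₁ a' * g a a' := by
    intro a'
    have h3 : ∀ c : I → A,
        (∏ i, Q i (c i) * (if i = i₁ then (if c i = a' then 1 else 0) else 1)) * g (c i₀) a'
        = ∏ i, Q i (c i) * (if i = i₁ then (if c i = a' then 1 else 0) else 1)
          * (if i = i₀ then g (c i) a' else 1) := by
      intro c
      rw [Finset.prod_mul_distrib (g := fun i => if i = i₀ then g (c i) a' else 1),
        Finset.prod_ite_eq' Finset.univ i₀ (fun i => g (c i) a'), if_pos (Finset.mem_univ _)]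
    simp_rw [h3]
    rw [← prod_sum_univ (fun i a => Q i a * (if i = i₁ then (if a = a' then 1 else 0) else 1)
          * (if i = i₀ then g a a' else 1)),
      Finset.prod_eq_mul i₀ i₁ hi]
    · simp [hi, hi.symm, Finset.sum_mul]
      refine Finset.sum_congr rfl fun a _ => by ring
    · intro i _ h
      simp [h.1, h.2, hQ]
    · simp
    · simp
  simp_rw [h2]
  rw [Finset.sum_comm]

theorem sum_prod_eq_one (Q : I → A → ℝ) (hQ : ∀ i, ∑ a, Q i a = 1) :
    ∑ c : I → A, ∏ i, Q i (c i) = 1 := by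
  rw [← prod_sum_univ]
  simp [hQ]

end Product

/-- A weighted average of `e` that is at most `E` forces some value of `e` to be at most `E`. -/
theorem exists_le_of_weighted_sum_le {ι : Type*} [Fintype ι] (w e : ι → ℝ) (hw : ∀ i, 0 ≤ w i)
    (hw1 : ∑ i, w i = 1) {E : ℝ} (h : ∑ i, w i * e i ≤ E) : ∃ i, e i ≤ E := by
  by_contra! hc
  have h1 : ∑ i, w i * (e i - E) ≤ 0 := by
    simp_rw [mul_sub, Finset.sum_sub_distrib, ← Finset.sum_mul, hw1]
    linarith
  have h2 : ∀ i ∈ Finset.univ, 0 ≤ w i * (e i - E) := fun i _ =>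
    mul_nonneg (hw i) (sub_nonneg.2 (hc i).le)
  have h3 := (Finset.sum_eq_zero_iff_of_nonneg h2).1 (le_antisymm h1 (Finset.sum_nonneg h2))
  have h4 : ∑ i, w i = 0 := Finset.sum_eq_zero fun i hi => by
    rcases mul_eq_zero.1 (h3 i hi) with h | h
    · exact h
    · linarith [hc i]
  linarith

open Classical in
/-- Threshold decoder: the unique message whose metric exceeds `γ`. -/
noncomputable def thresholdDec {M : ℕ} [NeZero M] (m : Fin M → ℝ) (γ : ℝ) : Fin M :=
  if h : ∃ w, γ < m w ∧ ∀ w', w' ≠ w → m w' ≤ γ then h.choose else 0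

theorem thresholdDec_eq {M : ℕ} [NeZero M] {m : Fin M → ℝ} {γ : ℝ} {w : Fin M} (h : γ < m w)
    (h' : ∀ w', w' ≠ w → m w' ≤ γ) : thresholdDec m γ = w := by
  have hex : ∃ w, γ < m w ∧ ∀ w', w' ≠ w → m w' ≤ γ := ⟨w, h, h'⟩
  unfold thresholdDec
  rw [dif_pos hex]
  by_contra hne
  linarith [hex.choose_spec.2 w (Ne.symm hne)]

-- A wrong decision means that the true metric is too small or that some competitor exceeds `γ`. In
-- the second case the competitor alone contributes a ratio of at least one; this is Markov's
-- inequality before taking expectations.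
open Classical in
theorem indicator_thresholdDec_le {M : ℕ} [NeZero M] {m : Fin M → ℝ} (hm : ∀ w, 0 ≤ m w) {γ : ℝ}
    (hγ : 0 < γ) (w : Fin M) :
    (if thresholdDec m γ ≠ w then (1 : ℝ) else 0)
      ≤ (if m w ≤ γ then 1 else 0) + ∑ w' ∈ Finset.univ.erase w, m w' / γ := by
  have hs : ∀ w' ∈ Finset.univ.erase w, 0 ≤ m w' / γ := fun w' _ => div_nonneg (hm w') hγ.le
  have h0 := Finset.sum_nonneg hs
  by_cases h1 : m w ≤ γ
  · rw [if_pos h1]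
    split_ifs <;> linarith
  · by_cases h2 : ∃ w', w' ≠ w ∧ γ < m w'
    · obtain ⟨w', hne, hlt⟩ := h2
      have h3 := Finset.single_le_sum hs (Finset.mem_erase.2 ⟨hne, Finset.mem_univ w'⟩)
      have h4 : 1 ≤ m w' / γ := by rw [le_div_iff₀ hγ]; linarith
      split_ifs <;> linarith
    · push Not at h1 h2
      rw [if_neg (not_not.2 (thresholdDec_eq h1 h2))]
      split_ifs <;> linarith

/-! ### Average error of the threshold decoder -/

section RandomCode

variable {B A A' Y : Type*} [Fintype B] [DecidableEq B] [Fintype A] [DecidableEq A] [Fintype A']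

open Classical in
/-- Average error probability of the threshold decoder for a random codebook, given the message,
the state, and the distribution `Q'` of the interfering codeword. -/
theorem random_code_bound {M : ℕ} [NeZero M] (Q : B → A → ℝ)
    (hQ0 : ∀ b a, 0 ≤ Q b a) (hQ : ∀ b, ∑ a, Q b a = 1) (Q' : A' → ℝ) (hQ0' : ∀ a, 0 ≤ Q' a)
    (hQ' : ∑ a, Q' a = 1) (out : A → A' → Y) (L : B → Y → A → ℝ) (hL0 : ∀ b y a, 0 ≤ L b y a)
    (hL : ∀ b y, ∑ a, Q b a * L b y a ≤ 1) {γ : ℝ} (hγ : 0 < γ) (w : Fin M) (b : B) :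
    ∑ c : Fin M × B → A, ∑ a', (∏ i, Q i.2 (c i)) * Q' a' *
        (if thresholdDec (fun w' => L b (out (c (w, b)) a') (c (w', b))) γ ≠ w then 1 else 0)
      ≤ ∑ a, ∑ a', Q b a * Q' a' * (if L b (out a a') a ≤ γ then 1 else 0)
        + (M - 1) / γ := by
  have hM1 := sum_prod_mul_apply (fun i : Fin M × B => Q i.2) (fun i => hQ i.2)
  have hM2 := fun (i₀ i₁ : Fin M × B) (h : i₀ ≠ i₁) =>
    sum_prod_mul_apply₂ (fun i : Fin M × B => Q i.2) (fun i => hQ i.2) h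
  calc ∑ c : Fin M × B → A, ∑ a', (∏ i, Q i.2 (c i)) * Q' a' *
        (if thresholdDec (fun w' => L b (out (c (w, b)) a') (c (w', b))) γ ≠ w then 1 else 0)
      ≤ ∑ c : Fin M × B → A, ∑ a', (∏ i, Q i.2 (c i)) * Q' a' *
          ((if L b (out (c (w, b)) a') (c (w, b)) ≤ γ then 1 else 0)
            + ∑ w' ∈ Finset.univ.erase w, L b (out (c (w, b)) a') (c (w', b)) / γ) := by
        refine Finset.sum_le_sum fun c _ => Finset.sum_le_sum fun a' _ => ?_
        refine mul_le_mul_of_nonneg_left ?_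
          (mul_nonneg (Finset.prod_nonneg fun i _ => hQ0 _ _) (hQ0' a'))
        exact indicator_thresholdDec_le (m := fun w' => L b (out (c (w, b)) a') (c (w', b)))
          (fun w' => hL0 _ _ _) hγ w
    _ = ∑ a', Q' a' * (∑ c : Fin M × B → A, (∏ i, Q i.2 (c i)) *
          (if L b (out (c (w, b)) a') (c (w, b)) ≤ γ then 1 else 0))
        + ∑ a', Q' a' * ∑ w' ∈ Finset.univ.erase w, (∑ c : Fin M × B → A, (∏ i, Q i.2 (c i)) *
          L b (out (c (w, b)) a') (c (w', b))) / γ := by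
        rw [Finset.sum_comm, ← Finset.sum_add_distrib]
        refine Finset.sum_congr rfl fun a' _ => ?_
        simp_rw [mul_add, Finset.sum_add_distrib, Finset.mul_sum, Finset.sum_div]
        congr 1
        · refine Finset.sum_congr rfl fun c _ => by ring
        · rw [Finset.sum_comm]
          refine Finset.sum_congr rfl fun w' _ => ?_
          rw [Finset.mul_sum]
          refine Finset.sum_congr rfl fun c _ => by ring
    _ ≤ _ := by
        refine add_le_add (le_of_eq ?_) ?_
        · simp_rw [fun a' => hM1 (w, b) (fun a => if L b (out a a') a ≤ γ then (1 : ℝ) else 0)]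
          rw [Finset.sum_comm]
          refine Finset.sum_congr rfl fun a' _ => ?_
          rw [Finset.mul_sum]
          refine Finset.sum_congr rfl fun a _ => by ring
        · have h1 : ∀ a', ∑ w' ∈ Finset.univ.erase w,
              (∑ c : Fin M × B → A, (∏ i, Q i.2 (c i)) *
                L b (out (c (w, b)) a') (c (w', b))) / γ ≤ (M - 1) / γ := by
            intro a'
            calc _ ≤ ∑ w' ∈ Finset.univ.erase w, 1 / γ := by
                  refine Finset.sum_le_sum fun w' hw' => ?_
                  refine div_le_div_of_nonneg_right ?_ hγ.le
                  -- The competing codeword sits at another index of the codebook, hence is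
                  -- independent of the one that produced the output, and its metric has mean at
                  -- most one.
                  have hne : (w, b) ≠ (w', b) := fun h =>
                    (Finset.mem_erase.1 hw').1 (Prod.ext_iff.1 h).1.symm
                  rw [hM2 _ _ hne (fun a a'' => L b (out a a') a'')]
                  calc _ = ∑ a, Q b a * ∑ a'', Q b a'' * L b (out a a') a'' := by
                        refine Finset.sum_congr rfl fun a _ => ?_
                        rw [Finset.mul_sum]
                        refine Finset.sum_congr rfl fun a'' _ => by ring
                    _ ≤ ∑ a, Q b a * 1 := Finset.sum_le_sum fun a _ =>
                        mul_le_mul_of_nonneg_left (hL _ _) (hQ0 _ _)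
                    _ = 1 := by simp [hQ]
              _ = (M - 1) / γ := by
                  rw [Finset.sum_const, Finset.card_erase_of_mem (Finset.mem_univ w),
                    Finset.card_univ, Fintype.card_fin, nsmul_eq_mul,
                    Nat.cast_sub (Nat.one_le_iff_ne_zero.2 (NeZero.ne M))]
                  simp [div_eq_mul_inv]
          calc _ ≤ ∑ a', Q' a' * ((M - 1) / γ) := Finset.sum_le_sum fun a' _ =>
                mul_le_mul_of_nonneg_left (h1 a') (hQ0' a')
            _ = (M - 1) / γ := by rw [← Finset.sum_mul, hQ', one_mul]

end RandomCode

end BurstyIC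

namespace BurstyIC

/-! ### Coding theorem for block schemes with interference treated as noise -/

/-- Probability of an interference state. -/
noncomputable def stateWt (p : ℝ) (b : Bool) : ℝ := if b then p else 1 - p

theorem stateWt_nonneg {p : ℝ} (hp : p ∈ Set.Icc (0 : ℝ) 1) (b : Bool) : 0 ≤ stateWt p b := by
  unfold stateWt
  split_ifs
  · exact hp.1
  · exact sub_nonneg.2 hp.2

theorem sum_stateWt (p : ℝ) : ∑ b, stateWt p b = 1 := by
  simp [stateWt]

theorem stateProb_eq (p : ℝ) {K : ℕ} (b : Fin K → Bool) : stateProb p b = ∏ k, stateWt p (b k) :=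
  rfl

theorem stateProb_nonneg {p : ℝ} (hp : p ∈ Set.Icc (0 : ℝ) 1) {K : ℕ} (b : Fin K → Bool) :
    0 ≤ stateProb p b :=
  Finset.prod_nonneg fun _ _ => stateWt_nonneg hp _

theorem sum_stateProb (p : ℝ) (K : ℕ) : ∑ b : Fin K → Bool, stateProb p b = 1 :=
  sum_prod_eq_one (fun _ => stateWt p) fun _ => sum_stateWt p

/-- The signalling of one user in one coherence block: a latent block is drawn according to
`prob` given the state, encoded by `enc`, and decoded with the metric `met`. -/
structure BlockUser (nd nc T : ℕ) where
  prob : Bool → Block (max nd nc) T → ℝ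
  enc : Bool → Block (max nd nc) T → Block (max nd nc) T
  met : Bool → Block (max nd nc) T → Block (max nd nc) T → ℝ
  prob_nonneg : ∀ b z, 0 ≤ prob b z
  sum_prob : ∀ b, ∑ z, prob b z = 1
  met_nonneg : ∀ b y z, 0 ≤ met b y z
  sum_met_le : ∀ b y, ∑ z, prob b z * met b y z ≤ 1

variable {nd nc T : ℕ}

namespace BlockUser

/-- Joint probability of the states and latent blocks of both users. -/
noncomputable def wt (p : ℝ) (u v : BlockUser nd nc T) (b b' : Bool)
    (z z' : Block (max nd nc) T) : ℝ :=
  stateWt p b * stateWt p b' * u.prob b z * v.prob b' z'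

/-- Metric of the transmitted latent block. -/
noncomputable def density (u v : BlockUser nd nc T) (b b' : Bool)
    (z z' : Block (max nd nc) T) : ℝ :=
  u.met b (output nd nc b (u.enc b z) (v.enc b' z')) z

/-- The rate, in bits per block, of the first user. -/
noncomputable def rate (p : ℝ) (u v : BlockUser nd nc T) : ℝ :=
  ∑ b, ∑ b', ∑ z, ∑ z', wt p u v b b' z z' * Real.logb 2 (density u v b b' z z')

/-- The metric of the first user is positive with probability one. -/
def Sound (p : ℝ) (u v : BlockUser nd nc T) : Prop :=
  ∀ b b' z z', wt p u v b b' z z' ≠ 0 → 0 < density u v b b' z z'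

/-- The information density of the first user is bounded by `D`. -/
def DensityBound (u v : BlockUser nd nc T) (D : ℝ) : Prop :=
  ∀ b b' z z', |Real.logb 2 (density u v b b' z z')| ≤ D

theorem wt_nonneg {p : ℝ} (hp : p ∈ Set.Icc (0 : ℝ) 1) (u v : BlockUser nd nc T) (b b' : Bool)
    (z z' : Block (max nd nc) T) : 0 ≤ wt p u v b b' z z' :=
  mul_nonneg (mul_nonneg (mul_nonneg (stateWt_nonneg hp b) (stateWt_nonneg hp b'))
    (u.prob_nonneg b z)) (v.prob_nonneg b' z')

theorem sum_wt (p : ℝ) (u v : BlockUser nd nc T) :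
    ∑ b, ∑ b', ∑ z, ∑ z', wt p u v b b' z z' = 1 := by
  unfold wt
  simp_rw [← Finset.mul_sum, v.sum_prob, mul_one, ← Finset.mul_sum, u.sum_prob, mul_one,
    ← Finset.mul_sum, sum_stateWt, mul_one, sum_stateWt]

theorem exists_densityBound (u v : BlockUser nd nc T) : ∃ D, DensityBound u v D := by
  classical
  obtain ⟨D, hD⟩ := (Set.finite_range fun x : Bool × Bool × Block (max nd nc) T ×
    Block (max nd nc) T => |Real.logb 2 (density u v x.1 x.2.1 x.2.2.1 x.2.2.2)|).bddAbove
  exact ⟨D, fun b b' z z' => hD ⟨(b, b', z, z'), rfl⟩⟩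

end BlockUser

open BlockUser

theorem sum_comm₄ {ι α β δ ε : Type*} [Fintype ι] [Fintype α] [Fintype β] [Fintype δ] [Fintype ε]
    (f : ι → α → β → δ → ε → ℝ) :
    ∑ i, ∑ a, ∑ b, ∑ d, ∑ e, f i a b d e = ∑ a, ∑ b, ∑ d, ∑ e, ∑ i, f i a b d e := by
  rw [Finset.sum_comm]
  refine Finset.sum_congr rfl fun a _ => ?_
  rw [Finset.sum_comm]
  refine Finset.sum_congr rfl fun b _ => ?_
  rw [Finset.sum_comm]
  refine Finset.sum_congr rfl fun d _ => ?_
  rw [Finset.sum_comm]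

/-! ### Error bound for words of `K` blocks -/

section OneShot

variable {K : ℕ}

/-- Probability of a latent codeword given the state sequence. -/
noncomputable def wordProb (u : Fin K → BlockUser nd nc T) (b : Fin K → Bool)
    (a : Fin K → Block (max nd nc) T) : ℝ :=
  ∏ k, (u k).prob (b k) (a k)

/-- Metric of a latent codeword. -/
noncomputable def wordMet (u : Fin K → BlockUser nd nc T) (b : Fin K → Bool)
    (y a : Fin K → Block (max nd nc) T) : ℝ :=
  ∏ k, (u k).met (b k) (y k) (a k)

/-- Received word. -/
noncomputable def wordOut (u v : Fin K → BlockUser nd nc T) (b b' : Fin K → Bool)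
    (a a' : Fin K → Block (max nd nc) T) (k : Fin K) : Block (max nd nc) T :=
  output nd nc (b k) ((u k).enc (b k) (a k)) ((v k).enc (b' k) (a' k))

open Classical in
/-- Probability that the metric of the transmitted codeword is at most `γ`. -/
noncomputable def outage (p : ℝ) (u v : Fin K → BlockUser nd nc T) (γ : ℝ) : ℝ :=
  ∑ b : Fin K → Bool, ∑ b' : Fin K → Bool, stateProb p b * stateProb p b' *
    ∑ a, ∑ a', wordProb u b a * wordProb v b' a' *
      (if wordMet u b (wordOut u v b b' a a') a ≤ γ then 1 else 0)

theorem wordProb_nonneg (u : Fin K → BlockUser nd nc T) (b : Fin K → Bool)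
    (a : Fin K → Block (max nd nc) T) : 0 ≤ wordProb u b a :=
  Finset.prod_nonneg fun k _ => (u k).prob_nonneg _ _

theorem sum_wordProb (u : Fin K → BlockUser nd nc T) (b : Fin K → Bool) :
    ∑ a, wordProb u b a = 1 :=
  sum_prod_eq_one (fun k => (u k).prob (b k)) fun k => (u k).sum_prob _

theorem wordMet_nonneg (u : Fin K → BlockUser nd nc T) (b : Fin K → Bool)
    (y a : Fin K → Block (max nd nc) T) : 0 ≤ wordMet u b y a :=
  Finset.prod_nonneg fun k _ => (u k).met_nonneg _ _ _

/-- Blocks are drawn independently and the metric is a product, so the mean factors into block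
means, each at most one. -/
theorem sum_wordProb_mul_wordMet_le (u : Fin K → BlockUser nd nc T) (b : Fin K → Bool)
    (y : Fin K → Block (max nd nc) T) : ∑ a, wordProb u b a * wordMet u b y a ≤ 1 := by
  unfold wordProb wordMet
  simp_rw [← Finset.prod_mul_distrib]
  rw [← prod_sum_univ (fun k z => (u k).prob (b k) z * (u k).met (b k) (y k) z)]
  exact Finset.prod_le_one (fun k _ => Finset.sum_nonneg fun z _ =>
    mul_nonneg ((u k).prob_nonneg _ _) ((u k).met_nonneg _ _ _)) fun k _ => (u k).sum_met_le _ _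

variable {M M₁ M₂ : ℕ}

/-- Codebooks assign a latent codeword to every message and state sequence. -/
abbrev Codebook (nd nc T K M : ℕ) : Type :=
  Fin M × (Fin K → Bool) → Fin K → Block (max nd nc) T

/-- Probability of a random codebook. -/
noncomputable def bookProb (u : Fin K → BlockUser nd nc T) (c : Codebook nd nc T K M) : ℝ :=
  ∏ i, wordProb u i.2 (c i)

theorem bookProb_nonneg (u : Fin K → BlockUser nd nc T) (c : Codebook nd nc T K M) :
    0 ≤ bookProb u c :=
  Finset.prod_nonneg fun _ _ => wordProb_nonneg _ _ _

theorem sum_bookProb (u : Fin K → BlockUser nd nc T) :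
    ∑ c : Codebook nd nc T K M, bookProb u c = 1 :=
  sum_prod_eq_one (fun i : Fin M × (Fin K → Bool) => wordProb u i.2) fun i => sum_wordProb u i.2

open Classical in
/-- Error indicator of the first user for given codebooks. -/
noncomputable def errInd [NeZero M₁] (u v : Fin K → BlockUser nd nc T) (γ : ℝ)
    (c : Codebook nd nc T K M₁) (c' : Codebook nd nc T K M₂) (w : Fin M₁) (w' : Fin M₂)
    (b b' : Fin K → Bool) : ℝ :=
  if thresholdDec (fun m => wordMet u b (wordOut u v b b' (c (w, b)) (c' (w', b'))) (c (m, b))) γ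
    ≠ w then 1 else 0

-- Given messages and states, the interfering codebook enters only through its codeword at `(w',
-- b')`. It can be averaged out first, which leaves the setting of `random_code_bound`.
open Classical in
theorem sum_errInd_le [NeZero M₁] (u v : Fin K → BlockUser nd nc T) {γ : ℝ} (hγ : 0 < γ)
    (w : Fin M₁) (w' : Fin M₂) (b b' : Fin K → Bool) :
    ∑ c : Codebook nd nc T K M₁, ∑ c' : Codebook nd nc T K M₂,
      bookProb u c * bookProb v c' * errInd u v γ c c' w w' b b'
    ≤ (∑ a, ∑ a', wordProb u b a * wordProb v b' a' *
      (if wordMet u b (wordOut u v b b' a a') a ≤ γ then 1 else 0)) + (M₁ - 1) / γ := by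
  refine le_trans (le_of_eq ?_) (random_code_bound (wordProb u) (wordProb_nonneg u)
    (sum_wordProb u) (wordProb v b') (wordProb_nonneg v b') (sum_wordProb v b')
    (wordOut u v b b') (wordMet u) (wordMet_nonneg u) (sum_wordProb_mul_wordMet_le u) hγ w b)
  refine Finset.sum_congr rfl fun c _ => ?_
  have h := sum_prod_mul_apply (fun i : Fin M₂ × (Fin K → Bool) => wordProb v i.2)
    (fun i => sum_wordProb v i.2) (w', b') (fun a' => if thresholdDec (fun m =>
      wordMet u b (wordOut u v b b' (c (w, b)) a') (c (m, b))) γ ≠ w then (1 : ℝ) else 0)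
  simp_rw [mul_assoc, ← Finset.mul_sum]
  congr 1

/-- Averaging a bound over messages and states. -/
theorem average_errInd_le [NeZero M₁] [NeZero M₂] {p : ℝ} (hp : p ∈ Set.Icc (0 : ℝ) 1)
    (u v : Fin K → BlockUser nd nc T) {γ : ℝ} (hγ : 0 < γ) :
    ∑ c : Codebook nd nc T K M₁, ∑ c' : Codebook nd nc T K M₂, bookProb u c * bookProb v c' *
      (∑ w : Fin M₁, ∑ w' : Fin M₂, ∑ b, ∑ b', (1 / (M₁ : ℝ)) * (1 / (M₂ : ℝ)) *
        stateProb p b * stateProb p b' * errInd u v γ c c' w w' b b')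
    ≤ outage p u v γ + (M₁ - 1) / γ := by
  classical
  have hM₁ : (M₁ : ℝ) ≠ 0 := Nat.cast_ne_zero.2 (NeZero.ne M₁)
  have hM₂ : (M₂ : ℝ) ≠ 0 := Nat.cast_ne_zero.2 (NeZero.ne M₂)
  calc _ = ∑ w : Fin M₁, ∑ w' : Fin M₂, ∑ b, ∑ b',
        (1 / (M₁ : ℝ)) * (1 / (M₂ : ℝ)) * stateProb p b * stateProb p b' *
        ∑ c : Codebook nd nc T K M₁, ∑ c' : Codebook nd nc T K M₂,
          bookProb u c * bookProb v c' * errInd u v γ c c' w w' b b' := by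
        simp_rw [Finset.mul_sum]
        simp_rw [sum_comm₄ (ι := Codebook nd nc T K M₂)]
        rw [sum_comm₄]
        refine Finset.sum_congr rfl fun w _ => Finset.sum_congr rfl fun w' _ =>
          Finset.sum_congr rfl fun b _ => Finset.sum_congr rfl fun b' _ =>
          Finset.sum_congr rfl fun c _ => Finset.sum_congr rfl fun c' _ => by ring
    _ ≤ ∑ w : Fin M₁, ∑ w' : Fin M₂, ∑ b, ∑ b',
        (1 / (M₁ : ℝ)) * (1 / (M₂ : ℝ)) * stateProb p b * stateProb p b' *
        ((∑ a, ∑ a', wordProb u b a * wordProb v b' a' *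
      (if wordMet u b (wordOut u v b b' a a') a ≤ γ then 1 else 0)) + (M₁ - 1) / γ) := by
        refine Finset.sum_le_sum fun w _ => Finset.sum_le_sum fun w' _ =>
          Finset.sum_le_sum fun b _ => Finset.sum_le_sum fun b' _ => ?_
        refine mul_le_mul_of_nonneg_left (sum_errInd_le u v hγ w w' b b') ?_
        have := stateProb_nonneg hp b
        have := stateProb_nonneg hp b'
        positivity
    _ = _ := by
        have h1 : ∑ b : Fin K → Bool, ∑ b' : Fin K → Bool, stateProb p b * stateProb p b' = 1 := by
          simp_rw [← Finset.mul_sum, sum_stateProb, mul_one, sum_stateProb]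
        have h2 : ∑ b : Fin K → Bool, ∑ b' : Fin K → Bool,
            (1 / (M₁ : ℝ)) * (1 / (M₂ : ℝ)) * stateProb p b * stateProb p b' *
            ((∑ a, ∑ a', wordProb u b a * wordProb v b' a' *
              (if wordMet u b (wordOut u v b b' a a') a ≤ γ then 1 else 0)) + (M₁ - 1) / γ)
            = (1 / (M₁ : ℝ)) * (1 / (M₂ : ℝ)) * (outage p u v γ + (M₁ - 1) / γ) := by
          have h3 : ∀ t : ℝ, t = ∑ b : Fin K → Bool, ∑ b' : Fin K → Bool,
              t * (stateProb p b * stateProb p b') := by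
            intro t
            simp_rw [← Finset.mul_sum] at h1 ⊢
            rw [h1, mul_one]
          unfold outage
          conv_rhs => rw [mul_add, h3 ((M₁ - 1 : ℝ) / γ)]
          simp_rw [Finset.mul_sum (s := (Finset.univ : Finset (Fin K → Bool))),
            ← Finset.sum_add_distrib]
          refine Finset.sum_congr rfl fun b _ => Finset.sum_congr rfl fun b' _ => by ring
        simp_rw [h2]
        simp only [Finset.sum_const, Finset.card_univ, Fintype.card_fin, nsmul_eq_mul]
        field_simp

/-- The code given by a pair of codebooks. -/
noncomputable def bookCode [NeZero M₁] [NeZero M₂] (u v : Fin K → BlockUser nd nc T) (γ₁ γ₂ : ℝ)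
    (c : Codebook nd nc T K M₁) (c' : Codebook nd nc T K M₂) : Code nd nc K T M₁ M₂ where
  enc₁ w b k := (u k).enc (b k) (c (w, b) k)
  enc₂ w b k := (v k).enc (b k) (c' (w, b) k)
  dec₁ y b := thresholdDec (fun m => wordMet u b y (c (m, b))) γ₁
  dec₂ y b := thresholdDec (fun m => wordMet v b y (c' (m, b))) γ₂

/-- The union bound over the two users holds for each pair of codebooks. Averaging over independent
codebooks bounds both terms at once, so a single pair is good for both users. -/
theorem exists_code [NeZero M₁] [NeZero M₂] {p : ℝ} (hp : p ∈ Set.Icc (0 : ℝ) 1)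
    (u v : Fin K → BlockUser nd nc T) {γ₁ γ₂ : ℝ} (h₁ : 0 < γ₁) (h₂ : 0 < γ₂) :
    ∃ c : Code nd nc K T M₁ M₂, c.errorProb p ≤
      (outage p u v γ₁ + (M₁ - 1) / γ₁) + (outage p v u γ₂ + (M₂ - 1) / γ₂) := by
  classical
  have key : ∀ (c : Codebook nd nc T K M₁) (c' : Codebook nd nc T K M₂),
      (bookCode u v γ₁ γ₂ c c').errorProb p ≤
      (∑ w : Fin M₁, ∑ w' : Fin M₂, ∑ b, ∑ b', (1 / (M₁ : ℝ)) * (1 / (M₂ : ℝ)) *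
        stateProb p b * stateProb p b' * errInd u v γ₁ c c' w w' b b') +
      (∑ w' : Fin M₂, ∑ w : Fin M₁, ∑ b', ∑ b, (1 / (M₂ : ℝ)) * (1 / (M₁ : ℝ)) * stateProb p b' * stateProb p b *
        errInd v u γ₂ c' c w' w b' b) := by
    intro c c'
    have e : (∑ w' : Fin M₂, ∑ w : Fin M₁, ∑ b', ∑ b, (1 / (M₂ : ℝ)) * (1 / (M₁ : ℝ)) * stateProb p b' *
          stateProb p b * errInd v u γ₂ c' c w' w b' b)
        = ∑ w : Fin M₁, ∑ w' : Fin M₂, ∑ b, ∑ b', (1 / (M₁ : ℝ)) * (1 / (M₂ : ℝ)) * stateProb p b * stateProb p b' *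
          errInd v u γ₂ c' c w' w b' b := by
      rw [Finset.sum_comm]
      refine Finset.sum_congr rfl fun w _ => Finset.sum_congr rfl fun w' _ => ?_
      rw [Finset.sum_comm]
      refine Finset.sum_congr rfl fun b _ => Finset.sum_congr rfl fun b' _ => by ring
    rw [e]
    simp_rw [← Finset.sum_add_distrib, ← mul_add]
    refine Finset.sum_le_sum fun w _ => Finset.sum_le_sum fun w' _ =>
          Finset.sum_le_sum fun b _ => Finset.sum_le_sum fun b' _ => ?_
    have := stateProb_nonneg hp b
    have := stateProb_nonneg hp b'
    refine mul_le_mul_of_nonneg_left ?_ (by positivity)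
    have e₁ : errInd u v γ₁ c c' w w' b b' =
        if (bookCode u v γ₁ γ₂ c c').est₁ w w' b b' ≠ w then 1 else 0 := rfl
    have e₂ : errInd v u γ₂ c' c w' w b' b =
        if (bookCode u v γ₁ γ₂ c c').est₂ w w' b b' ≠ w' then 1 else 0 := rfl
    rw [e₁, e₂]
    by_cases hh₁ : (bookCode u v γ₁ γ₂ c c').est₁ w w' b b' ≠ w <;>
      by_cases hh₂ : (bookCode u v γ₁ γ₂ c c').est₂ w w' b b' ≠ w' <;> simp [hh₁, hh₂]
  have hw : ∑ cc : Codebook nd nc T K M₁ × Codebook nd nc T K M₂,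
      bookProb u cc.1 * bookProb v cc.2 = 1 := by
    rw [Fintype.sum_prod_type]
    simp_rw [← Finset.mul_sum, sum_bookProb, mul_one, sum_bookProb]
  obtain ⟨cc, hcc⟩ := exists_le_of_weighted_sum_le
    (fun cc : Codebook nd nc T K M₁ × Codebook nd nc T K M₂ => bookProb u cc.1 * bookProb v cc.2)
    (fun cc => (bookCode (M₁ := M₁) (M₂ := M₂) u v γ₁ γ₂ cc.1 cc.2).errorProb p)
    (fun cc => mul_nonneg (bookProb_nonneg _ _) (bookProb_nonneg _ _)) hw
    (E := (outage p u v γ₁ + (M₁ - 1) / γ₁) + (outage p v u γ₂ + (M₂ - 1) / γ₂)) (by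
      refine le_trans (Finset.sum_le_sum fun cc _ => mul_le_mul_of_nonneg_left (key cc.1 cc.2)
        (mul_nonneg (bookProb_nonneg _ _) (bookProb_nonneg _ _))) ?_
      simp_rw [mul_add, Finset.sum_add_distrib]
      refine add_le_add ?_ ?_
      · rw [Fintype.sum_prod_type]
        exact average_errInd_le hp u v h₁
      · rw [Fintype.sum_prod_type_right]
        refine le_trans (le_of_eq ?_) (average_errInd_le (M₁ := M₂) (M₂ := M₁) hp v u h₂)
        refine Finset.sum_congr rfl fun c _ => Finset.sum_congr rfl fun c' _ => ?_
        rw [mul_comm (bookProb u c')])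
  exact ⟨_, hcc⟩

end OneShot

end BurstyIC

/-! ### Chernoff bound and rates achieved by sequences of schemes -/

namespace BurstyIC

open BlockUser

variable {nd nc T : ℕ}

theorem exp_neg_le_quadratic {x : ℝ} (hx : |x| ≤ 1) : Real.exp (-x) ≤ 1 - x + x ^ 2 := by
  have h := (abs_le.1 (Real.abs_exp_sub_one_sub_id_le (x := -x) (by rwa [abs_neg]))).2
  nlinarith

/-- A bounded information density allows $e^{-x}\le1-x+x^2$ under the mean. This leaves the mean
rate and a quadratic error, which $1+x\le e^x$ puts back into the exponent. -/
theorem sum_wt_mul_exp_le {p : ℝ} (hp : p ∈ Set.Icc (0 : ℝ) 1) (u v : BlockUser nd nc T) {D θ : ℝ}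
    (hD : DensityBound u v D) (hθ : 0 ≤ θ) (hθD : θ * D ≤ 1) :
    ∑ b, ∑ b', ∑ z, ∑ z', wt p u v b b' z z' *
        Real.exp (-(θ * Real.logb 2 (density u v b b' z z')))
      ≤ Real.exp (-(θ * rate p u v) + θ ^ 2 * D ^ 2) := by
  have h1 : ∀ b b' z z', wt p u v b b' z z' *
        Real.exp (-(θ * Real.logb 2 (density u v b b' z z')))
      ≤ wt p u v b b' z z' * (1 + θ ^ 2 * D ^ 2)
        - θ * (wt p u v b b' z z' * Real.logb 2 (density u v b b' z z')) := by
    intro b b' z z'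
    have hi := hD b b' z z'
    have h2 : |θ * Real.logb 2 (density u v b b' z z')| ≤ 1 := by
      rw [abs_mul, abs_of_nonneg hθ]
      exact (mul_le_mul_of_nonneg_left hi hθ).trans hθD
    have h3 : (θ * Real.logb 2 (density u v b b' z z')) ^ 2 ≤ θ ^ 2 * D ^ 2 := by
      rw [mul_pow]
      refine mul_le_mul_of_nonneg_left ?_ (sq_nonneg θ)
      exact sq_le_sq' (by linarith [(abs_le.1 hi).1]) (abs_le.1 hi).2
    have h4 := mul_le_mul_of_nonneg_left ((exp_neg_le_quadratic h2).trans
      (add_le_add_right h3 _)) (wt_nonneg hp u v b b' z z')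
    linarith
  calc _ ≤ ∑ b, ∑ b', ∑ z, ∑ z', (wt p u v b b' z z' * (1 + θ ^ 2 * D ^ 2)
        - θ * (wt p u v b b' z z' * Real.logb 2 (density u v b b' z z'))) :=
        Finset.sum_le_sum fun b _ => Finset.sum_le_sum fun b' _ =>
          Finset.sum_le_sum fun z _ => Finset.sum_le_sum fun z' _ => h1 b b' z z'
    _ = (-(θ * rate p u v) + θ ^ 2 * D ^ 2) + 1 := by
        simp_rw [Finset.sum_sub_distrib, ← Finset.sum_mul, ← Finset.mul_sum, sum_wt]
        unfold rate
        ring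
    _ ≤ _ := Real.add_one_le_exp _

/-- Chernoff's method: the outage indicator is at most an exponential of the deficit of accumulated
density, and the expectation factors over the blocks. The schemes may differ from block to block, as
time sharing requires. -/
theorem outage_le {K : ℕ} {p : ℝ} (hp : p ∈ Set.Icc (0 : ℝ) 1) (u v : Fin K → BlockUser nd nc T)
    (hs : ∀ k, Sound p (u k) (v k)) {D θ : ℝ} (hD : ∀ k, DensityBound (u k) (v k) D) (hθ : 0 ≤ θ)
    (hθD : θ * D ≤ 1) (c : ℝ) :
    outage p u v (2 ^ c) ≤
      Real.exp (θ * (c - ∑ k, rate p (u k) (v k)) + K * (θ ^ 2 * D ^ 2)) := by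
  classical
  calc outage p u v (2 ^ c)
      ≤ ∑ b : Fin K → Bool, ∑ b' : Fin K → Bool, ∑ a : Fin K → Block (max nd nc) T,
          ∑ a' : Fin K → Block (max nd nc) T, Real.exp (θ * c) *
          ∏ k, (wt p (u k) (v k) (b k) (b' k) (a k) (a' k) *
            Real.exp (-(θ * Real.logb 2 (density (u k) (v k) (b k) (b' k) (a k) (a' k))))) := by
        unfold outage
        simp_rw [Finset.mul_sum]
        refine Finset.sum_le_sum fun b _ => Finset.sum_le_sum fun b' _ =>
          Finset.sum_le_sum fun a _ => Finset.sum_le_sum fun a' _ => ?_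
        have hw : ∏ k, wt p (u k) (v k) (b k) (b' k) (a k) (a' k)
            = stateProb p b * stateProb p b' * (wordProb u b a * wordProb v b' a') := by
          simp only [wt, Finset.prod_mul_distrib, stateProb_eq, wordProb]
          ring
        have hw0 : 0 ≤ ∏ k, wt p (u k) (v k) (b k) (b' k) (a k) (a' k) :=
          Finset.prod_nonneg fun k _ => wt_nonneg hp _ _ _ _ _ _
        rw [Finset.prod_mul_distrib, ← mul_assoc, ← mul_assoc, mul_assoc (stateProb p b * _), ← hw,
          ← Real.exp_sum, mul_comm (Real.exp (θ * c)), mul_assoc, ← Real.exp_add]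
        -- Off the support a metric may vanish, so that its logarithm carries no meaning; positivity
        -- is known, and needed, only where the joint weight is nonzero.
        rcases hw0.eq_or_lt with h0 | h0
        · rw [← h0]; simp
        · refine mul_le_mul_of_nonneg_left ?_ hw0
          split_ifs with hle
          · refine Real.one_le_exp ?_
            have hpos : ∀ k, 0 < density (u k) (v k) (b k) (b' k) (a k) (a' k) := fun k =>
              hs k _ _ _ _ ((Finset.prod_ne_zero_iff.1 h0.ne') k (Finset.mem_univ k))
            have hmet : wordMet u b (wordOut u v b b' a a') a
                = ∏ k, density (u k) (v k) (b k) (b' k) (a k) (a' k) := rfl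
            rw [hmet] at hle
            have h2 := Real.logb_le_logb_of_le one_lt_two
              (Finset.prod_pos fun k _ => hpos k) hle
            rw [Real.logb_rpow (by norm_num) (by norm_num),
              Real.logb_prod _ _ fun k _ => (hpos k).ne'] at h2
            rw [Finset.sum_neg_distrib, ← Finset.mul_sum]
            nlinarith [mul_le_mul_of_nonneg_left h2 hθ]
          · positivity
    _ = Real.exp (θ * c) * ∏ k, ∑ b, ∑ b', ∑ z, ∑ z', wt p (u k) (v k) b b' z z' *
          Real.exp (-(θ * Real.logb 2 (density (u k) (v k) b b' z z'))) := by
        simp_rw [← Finset.mul_sum]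
        congr 1
        rw [prod_sum_univ]
        refine Finset.sum_congr rfl fun b _ => ?_
        rw [prod_sum_univ]
        refine Finset.sum_congr rfl fun b' _ => ?_
        rw [prod_sum_univ]
        refine Finset.sum_congr rfl fun z _ => ?_
        rw [prod_sum_univ]
    _ ≤ Real.exp (θ * c) * ∏ k : Fin K,
          Real.exp (-(θ * rate p (u k) (v k)) + θ ^ 2 * D ^ 2) := by
        refine mul_le_mul_of_nonneg_left ?_ (Real.exp_pos _).le
        refine Finset.prod_le_prod (fun k _ => ?_) fun k _ =>
          sum_wt_mul_exp_le hp (u k) (v k) (hD k) hθ hθD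
        exact Finset.sum_nonneg fun b _ => Finset.sum_nonneg fun b' _ =>
          Finset.sum_nonneg fun z _ => Finset.sum_nonneg fun z' _ =>
            mul_nonneg (wt_nonneg hp _ _ _ _ _ _) (Real.exp_pos _).le
    _ = _ := by
        rw [← Real.exp_sum, ← Real.exp_add, Finset.sum_add_distrib, Finset.sum_neg_distrib,
          ← Finset.mul_sum]
        simp only [Finset.sum_const, Finset.card_univ, Fintype.card_fin, nsmul_eq_mul]
        congr 1
        ring

theorem Code.errorProb_nonneg {K M₁ M₂ : ℕ} {p : ℝ} (hp : p ∈ Set.Icc (0 : ℝ) 1)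
    (c : Code nd nc K T M₁ M₂) : 0 ≤ c.errorProb p := by
  refine Finset.sum_nonneg fun w _ => Finset.sum_nonneg fun w' _ => Finset.sum_nonneg fun b _ =>
    Finset.sum_nonneg fun b' _ => ?_
  have := stateProb_nonneg hp b
  have := stateProb_nonneg hp b'
  split_ifs <;> positivity

/-- A pair of block users whose metrics are almost surely positive. -/
structure Scheme (nd nc T : ℕ) (p : ℝ) where
  u : BlockUser nd nc T
  v : BlockUser nd nc T
  sound₁ : Sound p u v
  sound₂ : Sound p v u

namespace Scheme

variable {p : ℝ}

/-- Rate of user 1 in bits per block. -/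
noncomputable def rate₁ (s : Scheme nd nc T p) : ℝ := rate p s.u s.v

/-- Rate of user 2 in bits per block. -/
noncomputable def rate₂ (s : Scheme nd nc T p) : ℝ := rate p s.v s.u

end Scheme

/-- Rate pairs, in bits per block, attained by a sequence of schemes up to a bounded deficit. -/
def schemeRegion (nd nc T : ℕ) (p : ℝ) : Set (ℝ × ℝ) :=
  {r | ∃ (σ : ℕ → Scheme nd nc T p) (D C : ℝ),
    (∀ k, DensityBound (σ k).u (σ k).v D ∧ DensityBound (σ k).v (σ k).u D) ∧
    ∀ K : ℕ, K * r.1 - C ≤ ∑ k ∈ Finset.range K, (σ k).rate₁ ∧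
      K * r.2 - C ≤ ∑ k ∈ Finset.range K, (σ k).rate₂}

theorem numMessages_pos (K T : ℕ) (R : ℝ) : 0 < numMessages K T R :=
  Nat.ceil_pos.2 (by positivity)

/-- The threshold stays `K δ` below the accumulated information and the rate `2 δ` per block below
`r`, so a factor $2^{-\delta}$ per block is left. At `R = 0` there is one message and nothing to
confuse, which admits rates truncated at zero. -/
theorem numMessages_sub_one_div_le {K T : ℕ} {R r δ C S : ℝ} (h : R = 0 ∨ T * R ≤ r - 2 * δ)
    (hS : K * r - C ≤ S) :
    ((numMessages K T R : ℝ) - 1) / 2 ^ (S - K * δ) ≤ 2 ^ C * (2 ^ (-δ)) ^ K := by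
  have hpos : (0 : ℝ) < 2 ^ (S - K * δ) := by positivity
  rw [div_le_iff₀ hpos, ← Real.rpow_natCast, ← Real.rpow_mul (by norm_num),
    ← Real.rpow_add (by norm_num), ← Real.rpow_add (by norm_num)]
  rcases h with rfl | h
  · have : numMessages K T 0 = 1 := by simp [numMessages]
    rw [this]
    simp
    positivity
  · have h1 : (numMessages K T R : ℝ) < 2 ^ ((K : ℝ) * T * R) + 1 :=
      Nat.ceil_lt_add_one (by positivity)
    refine le_trans (by linarith : (numMessages K T R : ℝ) - 1 ≤ 2 ^ ((K : ℝ) * T * R)) ?_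
    refine Real.rpow_le_rpow_of_exponent_le one_le_two ?_
    have := mul_le_mul_of_nonneg_left h (Nat.cast_nonneg (α := ℝ) K)
    nlinarith

theorem achievable_of_mem_schemeRegion {p : ℝ} (hp : p ∈ Set.Icc (0 : ℝ) 1) {r R : ℝ × ℝ}
    (hr : r ∈ schemeRegion nd nc T p) {δ : ℝ} (hδ : 0 < δ) (h₁ : 0 ≤ R.1) (h₂ : 0 ≤ R.2)
    (hR₁ : R.1 = 0 ∨ T * R.1 ≤ r.1 - 2 * δ) (hR₂ : R.2 = 0 ∨ T * R.2 ≤ r.2 - 2 * δ) :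
    Achievable nd nc T p R := by
  obtain ⟨σ, D, C, hD, hσ⟩ := hr
  refine ⟨h₁, h₂, ?_⟩
  have hden : 0 < 2 * (D ^ 2 + 1) * (δ + 1) := by positivity
  -- The denominator ensures both `θ * D ≤ 1`, the range of the quadratic bound, and `θ * D ^ 2 ≤ δ
  -- / 2`, so that half of the Chernoff exponent `θ * δ` per block survives.
  obtain ⟨θ, hθ⟩ : ∃ θ, θ = δ / (2 * (D ^ 2 + 1) * (δ + 1)) := ⟨_, rfl⟩
  have hθ0 : 0 < θ := by rw [hθ]; positivity
  have hθD : θ * D ≤ 1 := by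
    rw [hθ, div_mul_eq_mul_div, div_le_one hden]
    nlinarith [mul_nonneg hδ.le (sq_nonneg (D - 1)), sq_nonneg D]
  have hθD2 : θ * D ^ 2 ≤ δ / 2 := by
    rw [hθ, div_mul_eq_mul_div, div_le_div_iff₀ hden two_pos]
    nlinarith [mul_nonneg (mul_nonneg hδ.le hδ.le) (sq_nonneg D), mul_pos hδ hδ]
  have hcode : ∀ K : ℕ, ∃ c : Code nd nc K T (numMessages K T R.1) (numMessages K T R.2),
      c.errorProb p ≤ 2 * Real.exp (-(θ * δ / 2)) ^ K + 2 * (2 ^ C * (2 ^ (-δ)) ^ K) := by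
    intro K
    have : NeZero (numMessages K T R.1) := ⟨(numMessages_pos _ _ _).ne'⟩
    have : NeZero (numMessages K T R.2) := ⟨(numMessages_pos _ _ _).ne'⟩
    obtain ⟨c, hc⟩ := exists_code (M₁ := numMessages K T R.1) (M₂ := numMessages K T R.2) hp
      (fun k : Fin K => (σ k).u) (fun k : Fin K => (σ k).v)
      (γ₁ := 2 ^ ((∑ k ∈ Finset.range K, (σ k).rate₁) - K * δ))
      (γ₂ := 2 ^ ((∑ k ∈ Finset.range K, (σ k).rate₂) - K * δ)) (by positivity) (by positivity)
    refine ⟨c, hc.trans ?_⟩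
    have hexp : ∀ S : ℝ, Real.exp (θ * (S - K * δ - S) + K * (θ ^ 2 * D ^ 2))
        ≤ Real.exp (-(θ * δ / 2)) ^ K := by
      intro S
      rw [← Real.exp_nat_mul]
      refine Real.exp_le_exp.2 ?_
      have := mul_le_mul_of_nonneg_left (mul_le_mul_of_nonneg_left hθD2 hθ0.le)
        (Nat.cast_nonneg (α := ℝ) K)
      nlinarith
    have o₁ := outage_le hp (fun k : Fin K => (σ k).u) (fun k : Fin K => (σ k).v)
      (fun k => (σ k).sound₁) (fun k => (hD k).1) hθ0.le hθD
      ((∑ k ∈ Finset.range K, (σ k).rate₁) - K * δ)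
    have o₂ := outage_le hp (fun k : Fin K => (σ k).v) (fun k : Fin K => (σ k).u)
      (fun k => (σ k).sound₂) (fun k => (hD k).2) hθ0.le hθD
      ((∑ k ∈ Finset.range K, (σ k).rate₂) - K * δ)
    rw [Finset.sum_range] at o₁ o₂
    have o₁' := o₁.trans (hexp _)
    have o₂' := o₂.trans (hexp _)
    rw [← Finset.sum_range (fun k => (σ k).rate₁)] at o₁'
    rw [← Finset.sum_range (fun k => (σ k).rate₂)] at o₂'
    have m₁ := numMessages_sub_one_div_le hR₁ (hσ K).1
    have m₂ := numMessages_sub_one_div_le hR₂ (hσ K).2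
    linarith
  choose c hc using hcode
  refine ⟨c, squeeze_zero (fun K => (c K).errorProb_nonneg hp) hc ?_⟩
  have t₁ : Tendsto (fun K : ℕ => Real.exp (-(θ * δ / 2)) ^ K) atTop (𝓝 0) :=
    tendsto_pow_atTop_nhds_zero_of_lt_one (Real.exp_pos _).le
      (by
        rw [← Real.exp_zero]
        exact Real.exp_lt_exp.2 (by have := mul_pos hθ0 hδ; linarith))
  have t₂ : Tendsto (fun K : ℕ => ((2 : ℝ) ^ (-δ)) ^ K) atTop (𝓝 0) :=
    tendsto_pow_atTop_nhds_zero_of_lt_one (by positivity)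
      (Real.rpow_lt_one_of_one_lt_of_neg one_lt_two (by linarith))
  have := (t₁.const_mul 2).add ((t₂.const_mul (2 ^ C)).const_mul 2)
  simpa using this

/-! ### Convexity and a dual criterion -/

/-- Merge two sequences, using the first one with frequency `t`. -/
noncomputable def interleave {α : Type*} (t : ℝ) (σ τ : ℕ → α) (k : ℕ) : α :=
  if ⌊t * k⌋₊ < ⌊t * (k + 1 : ℕ)⌋₊ then σ ⌊t * k⌋₊ else τ (k - ⌊t * k⌋₊)

/-- As `t ≤ 1`, the floor of `t * k` grows by zero or one at each step. Hence exactly `⌊t * K⌋₊` of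
the first `K` places go to `σ`, and both sequences are used in order without gaps. -/
theorem sum_interleave {α : Type*} {t : ℝ} (ht0 : 0 ≤ t) (ht1 : t ≤ 1) (σ τ : ℕ → α) (f : α → ℝ)
    (K : ℕ) : ∑ k ∈ Finset.range K, f (interleave t σ τ k)
      = ∑ k ∈ Finset.range ⌊t * K⌋₊, f (σ k) + ∑ k ∈ Finset.range (K - ⌊t * K⌋₊), f (τ k) := by
  induction K with
  | zero => simp
  | succ K ih =>
    rw [Finset.sum_range_succ, ih]
    have hle : ⌊t * K⌋₊ ≤ K := by
      refine Nat.floor_le_of_le ?_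
      exact mul_le_of_le_one_left (Nat.cast_nonneg K) ht1
    have hmono : ⌊t * K⌋₊ ≤ ⌊t * (K + 1 : ℕ)⌋₊ := by
      refine Nat.floor_mono (mul_le_mul_of_nonneg_left ?_ ht0)
      push_cast; linarith
    have hsucc : ⌊t * (K + 1 : ℕ)⌋₊ ≤ ⌊t * K⌋₊ + 1 := by
      rw [← Nat.floor_add_one (by positivity)]
      refine Nat.floor_mono ?_
      push_cast; linarith
    unfold interleave
    split_ifs with h
    · have e : ⌊t * (K + 1 : ℕ)⌋₊ = ⌊t * K⌋₊ + 1 := by omega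
      rw [e, Finset.sum_range_succ, show K + 1 - (⌊t * K⌋₊ + 1) = K - ⌊t * K⌋₊ by omega]
      ring
    · have e : ⌊t * (K + 1 : ℕ)⌋₊ = ⌊t * K⌋₊ := by omega
      rw [e, show K + 1 - ⌊t * K⌋₊ = (K - ⌊t * K⌋₊) + 1 by omega, Finset.sum_range_succ]
      ring

/-- Rounding moves at most one block from one sequence to the other, at a cost of at most $|r-r'|$;
this is why the deficit stays bounded. -/
theorem interleave_deficit {a b t r r' C C' S S' : ℝ} (m n K : ℝ) (hm : t * K - 1 ≤ m)
    (hm' : m ≤ t * K) (hn : n = K - m) (hab : a = t) (hab' : b = 1 - t) (h : m * r - C ≤ S)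
    (h' : n * r' - C' ≤ S') : K * (a * r + b * r') - (C + C' + |r - r'|) ≤ S + S' := by
  subst hn hab hab'
  have h1 : (a * K - m) * (r - r') ≤ |r - r'| := by
    refine (le_abs_self _).trans ?_
    rw [abs_mul]
    refine mul_le_of_le_one_left (abs_nonneg _) ?_
    rw [abs_le]; constructor <;> linarith
  nlinarith

theorem convex_schemeRegion (nd nc T : ℕ) (p : ℝ) : Convex ℝ (schemeRegion nd nc T p) := by
  rintro r ⟨σ, D, C, hD, hσ⟩ r' ⟨σ', D', C', hD', hσ'⟩ a b ha hb hab
  have ha1 : a ≤ 1 := by linarith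
  refine ⟨interleave a σ σ', max D D',
    max (C + C' + |r.1 - r'.1|) (C + C' + |r.2 - r'.2|), ?_, ?_⟩
  · intro k
    unfold interleave
    split_ifs
    · exact ⟨fun b b' z z' => ((hD _).1 b b' z z').trans (le_max_left _ _),
        fun b b' z z' => ((hD _).2 b b' z z').trans (le_max_left _ _)⟩
    · exact ⟨fun b b' z z' => ((hD' _).1 b b' z z').trans (le_max_right _ _),
        fun b b' z z' => ((hD' _).2 b b' z z').trans (le_max_right _ _)⟩
  · intro K
    have hK : 0 ≤ a * (K : ℝ) := by positivity
    have hle : ⌊a * K⌋₊ ≤ K := Nat.floor_le_of_le (mul_le_of_le_one_left (Nat.cast_nonneg K) ha1)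
    have hm := Nat.floor_le hK
    have hm' := (Nat.lt_floor_add_one (a * (K : ℝ))).le
    have hn : ((K - ⌊a * K⌋₊ : ℕ) : ℝ) = K - (⌊a * K⌋₊ : ℝ) := by rw [Nat.cast_sub hle]
    rw [sum_interleave ha ha1 σ σ' Scheme.rate₁, sum_interleave ha ha1 σ σ' Scheme.rate₂]
    have h1 := interleave_deficit (a := a) (b := b) (t := a) _ _ (K : ℝ) (by linarith) hm hn rfl
      (by linarith) (hσ ⌊a * K⌋₊).1 (hσ' (K - ⌊a * K⌋₊)).1
    have h2 := interleave_deficit (a := a) (b := b) (t := a) _ _ (K : ℝ) (by linarith) hm hn rfl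
      (by linarith) (hσ ⌊a * K⌋₊).2 (hσ' (K - ⌊a * K⌋₊)).2
    have m1 := le_max_left (C + C' + |r.1 - r'.1|) (C + C' + |r.2 - r'.2|)
    have m2 := le_max_right (C + C' + |r.1 - r'.1|) (C + C' + |r.2 - r'.2|)
    simp only [Prod.fst_add, Prod.snd_add, Prod.smul_fst, Prod.smul_snd, smul_eq_mul]
    constructor <;> linarith

/-- The region is closed downwards, even into negative coordinates; this forces separating
functionals to have nonnegative coefficients. -/
theorem mem_schemeRegion_of_le {p : ℝ} (s : Scheme nd nc T p) {r : ℝ × ℝ} (h₁ : r.1 ≤ s.rate₁)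
    (h₂ : r.2 ≤ s.rate₂) : r ∈ schemeRegion nd nc T p := by
  obtain ⟨D, hD⟩ := exists_densityBound s.u s.v
  obtain ⟨D', hD'⟩ := exists_densityBound s.v s.u
  refine ⟨fun _ => s, max D D', 0, fun _ => ⟨fun b b' z z' => (hD b b' z z').trans
    (le_max_left _ _), fun b b' z z' => (hD' b b' z z').trans (le_max_right _ _)⟩, fun K => ?_⟩
  simp only [Finset.sum_const, Finset.card_range, nsmul_eq_mul, sub_zero]
  exact ⟨mul_le_mul_of_nonneg_left h₁ (Nat.cast_nonneg K),
    mul_le_mul_of_nonneg_left h₂ (Nat.cast_nonneg K)⟩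

/-- A point dominated by schemes in every nonnegative direction lies in the closure of the
region of the schemes. -/
theorem mem_closure_schemeRegion {p : ℝ} {r : ℝ × ℝ} (h : ∀ l₁ l₂ : ℝ, 0 ≤ l₁ → 0 ≤ l₂ →
      ∃ s : Scheme nd nc T p, l₁ * r.1 + l₂ * r.2 ≤ l₁ * s.rate₁ + l₂ * s.rate₂) :
    r ∈ closure (schemeRegion nd nc T p) := by
  by_contra hr
  obtain ⟨f, c, hf, hc⟩ := geometric_hahn_banach_closed_point
    (convex_schemeRegion nd nc T p).closure isClosed_closure hr
  have hlin : ∀ x : ℝ × ℝ, f x = f (1, 0) * x.1 + f (0, 1) * x.2 := by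
    intro x
    have : x = x.1 • ((1, 0) : ℝ × ℝ) + x.2 • ((0, 1) : ℝ × ℝ) := by ext <;> simp
    conv_lhs => rw [this]
    rw [map_add, map_smul, map_smul, smul_eq_mul, smul_eq_mul]
    ring
  obtain ⟨s₀, -⟩ := h 0 0 le_rfl le_rfl
  have hmem : ∀ x : ℝ × ℝ, x ∈ schemeRegion nd nc T p → f (1, 0) * x.1 + f (0, 1) * x.2 < c :=
    fun x hx => by rw [← hlin]; exact hf x (subset_closure hx)
  -- A functional bounded on a downward ray cannot have a negative coefficient in that direction.
  have unbdd : ∀ l A : ℝ, (∀ y : ℝ, 0 ≤ y → A - l * y < c) → 0 ≤ l := by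
    intro l A hA
    by_contra! hl
    -- With this `y` one gets $A-ly=c+|c-A|$, which is not below `c`.
    have h1 := hA ((c - A) / (-l) + |c - A| / (-l)) (by
      rw [← add_div]
      exact div_nonneg (by linarith [neg_abs_le (c - A)]) (by linarith))
    have h2 : l * ((c - A) / (-l) + |c - A| / (-l)) = -(c - A) - |c - A| := by
      have hl' := hl.ne
      field_simp
      ring
    rw [h2] at h1
    linarith [abs_nonneg (c - A)]
  have hl₁ : 0 ≤ f (1, 0) := unbdd _ (f (1, 0) * s₀.rate₁ + f (0, 1) * s₀.rate₂) fun y hy => by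
    have := hmem (s₀.rate₁ - y, s₀.rate₂) (mem_schemeRegion_of_le s₀ (by simpa using hy) le_rfl)
    simp only at this
    linarith
  have hl₂ : 0 ≤ f (0, 1) := unbdd _ (f (1, 0) * s₀.rate₁ + f (0, 1) * s₀.rate₂) fun y hy => by
    have := hmem (s₀.rate₁, s₀.rate₂ - y) (mem_schemeRegion_of_le s₀ le_rfl (by simpa using hy))
    simp only at this
    linarith
  obtain ⟨s, hs⟩ := h _ _ hl₁ hl₂
  have h1 := hmem (s.rate₁, s.rate₂) (mem_schemeRegion_of_le s le_rfl le_rfl)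
  rw [hlin] at hc
  simp only at h1
  linarith

/-- The approximation error and the back-off `2 * (ε / 8)` are each at most `ε / 4`. Dividing by `t
≥ 1` does not enlarge them, and truncation at zero does not leave the neighbourhood of a nonnegative
`R`. -/
theorem shrink_dist {t R r ε : ℝ} (ht : 1 ≤ t) (hR : 0 ≤ R) (hε : 0 < ε)
    (h : |t * R - r| < ε / 4) :
    |max 0 ((r - 2 * (ε / 8)) / t) - R| < ε := by
  have ht0 : 0 < t := by linarith
  obtain ⟨ha, hb⟩ := abs_lt.1 h
  have hx : (r - 2 * (ε / 8)) / t - R < ε := by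
    rw [sub_lt_iff_lt_add, div_lt_iff₀ ht0]
    nlinarith
  have hx' : -ε < (r - 2 * (ε / 8)) / t - R := by
    rw [lt_sub_iff_add_lt, lt_div_iff₀ ht0]
    nlinarith
  rw [abs_lt]
  constructor
  · linarith [le_max_right 0 ((r - 2 * (ε / 8)) / t)]
  · rw [sub_lt_iff_lt_add]
    exact max_lt (by linarith) (by linarith)

/-- Dual criterion for membership in the capacity region. -/
theorem mem_capacityRegion {p : ℝ} (hp : p ∈ Set.Icc (0 : ℝ) 1) (hT : 0 < T) {R : ℝ × ℝ}
    (h₁ : 0 ≤ R.1) (h₂ : 0 ≤ R.2) (h : ∀ l₁ l₂ : ℝ, 0 ≤ l₁ → 0 ≤ l₂ →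
      ∃ s : Scheme nd nc T p,
        l₁ * (T * R.1) + l₂ * (T * R.2) ≤ l₁ * s.rate₁ + l₂ * s.rate₂) :
    R ∈ capacityRegion nd nc T p := by
  have hcl := mem_closure_schemeRegion (r := (T * R.1, T * R.2)) h
  rw [capacityRegion, Metric.mem_closure_iff]
  intro ε hε
  obtain ⟨r, hr, hd⟩ := Metric.mem_closure_iff.1 hcl (ε / 4) (by positivity)
  have hT1 : (1 : ℝ) ≤ T := by exact_mod_cast hT
  have hT0 : (0 : ℝ) < T := by linarith
  rw [Prod.dist_eq, max_lt_iff, Real.dist_eq, Real.dist_eq] at hd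
  refine ⟨(max 0 ((r.1 - 2 * (ε / 8)) / T), max 0 ((r.2 - 2 * (ε / 8)) / T)), ?_, ?_⟩
  · refine achievable_of_mem_schemeRegion hp hr (δ := ε / 8) (by positivity) (le_max_left _ _)
      (le_max_left _ _) ?_ ?_
    · rcases max_choice 0 ((r.1 - 2 * (ε / 8)) / T) with h | h
      · exact Or.inl h
      · right
        simp only [h]
        rw [mul_div_cancel₀ _ hT0.ne']
    · rcases max_choice 0 ((r.2 - 2 * (ε / 8)) / T) with h | h
      · exact Or.inl h
      · right
        simp only [h]
        rw [mul_div_cancel₀ _ hT0.ne']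
  · rw [dist_comm, Prod.dist_eq, max_lt_iff, Real.dist_eq, Real.dist_eq]
    exact ⟨shrink_dist hT1 h₁ hε hd.1, shrink_dist hT1 h₂ hε hd.2⟩

end BurstyIC

namespace BurstyIC

open BlockUser

/-! ### Bitwise schemes -/

/-- Probability mass function of a Bernoulli bit. -/
noncomputable def bern (x : ℝ) (z : ZMod 2) : ℝ := if z = 1 then x else 1 - x

/-- `a (1 - b) + (1 - a) b`, the parameter of a modulo-2 sum. -/
noncomputable def star (a b : ℝ) : ℝ := a * (1 - b) + (1 - a) * b

theorem bern_nonneg {x : ℝ} (hx : x ∈ Set.Icc (0 : ℝ) 1) (z : ZMod 2) : 0 ≤ bern x z :=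
  stateWt_nonneg (p := x) hx (decide (z = 1)) |>.trans_eq (by unfold stateWt bern; simp)

theorem sum_zmod_two (f : ZMod 2 → ℝ) : ∑ z, f z = f 0 + f 1 := Fin.sum_univ_two f

theorem bern_at_one (x : ℝ) : bern x 1 = x := by simp [bern]

theorem bern_at_zero (x : ℝ) : bern x 0 = 1 - x := by simp [bern]

theorem sum_bern (x : ℝ) : ∑ z, bern x z = 1 := by
  rw [sum_zmod_two, bern_at_one, bern_at_zero]; ring

theorem zmod_two_cases (a : ZMod 2) : a = 0 ∨ a = 1 := by
  revert a; decide

theorem one_add_one_zmod_two : (1 + 1 : ZMod 2) = 0 := rfl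

theorem add_add_cancel_zmod_two (a b : ZMod 2) : a + b + a = b := by
  revert a b; decide

/-- The probability of the observed sum contains the product of the two positive probabilities as
one of its terms, so the denominator of the metric does not vanish on the support. -/
theorem bern_star_pos {x y : ℝ} (hx : x ∈ Set.Icc (0 : ℝ) 1) (hy : y ∈ Set.Icc (0 : ℝ) 1)
    {z w : ZMod 2} (hz : bern x z ≠ 0) (hw : bern y w ≠ 0) : 0 < bern (star x y) (z + w) := by
  have hz' := (bern_nonneg hx z).lt_of_ne' hz
  have hw' := (bern_nonneg hy w).lt_of_ne' hw
  have h : bern (star x y) (z + w) = bern x z * bern y w + bern x (z + 1) * bern y (w + 1) := by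
    have : ∀ a b : ZMod 2, bern (star x y) (a + b)
        = bern x a * bern y b + bern x (a + 1) * bern y (b + 1) := by
      intro a b
      rcases zmod_two_cases a with rfl | rfl <;> rcases zmod_two_cases b with rfl | rfl <;>
        simp [bern, star, one_add_one_zmod_two] <;> ring
    exact this z w
  rw [h]
  exact add_pos_of_pos_of_nonneg (mul_pos hz' hw')
    (mul_nonneg (bern_nonneg hx _) (bern_nonneg hy _))

/-- Mutual information of a Bernoulli bit observed in Bernoulli noise. -/
theorem sum_bern_logb {x y : ℝ} (hx : x ∈ Set.Icc (0 : ℝ) 1) (hy : y ∈ Set.Icc (0 : ℝ) 1) :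
    ∑ z, ∑ w, bern x z * bern y w * Real.logb 2 (bern y w / bern (star x y) (z + w))
      = Hsum x y - Hb y := by
  have h : ∀ z w, bern x z * bern y w * Real.logb 2 (bern y w / bern (star x y) (z + w))
      = bern x z * bern y w * (Real.logb 2 (bern y w) - Real.logb 2 (bern (star x y) (z + w))) := by
    intro z w
    by_cases hz : bern x z = 0
    · simp [hz]
    by_cases hw : bern y w = 0
    · simp [hw]
    rw [Real.logb_div hw (bern_star_pos hx hy hz hw).ne']
  simp_rw [h, sum_zmod_two]
  simp only [bern_at_zero, bern_at_one, add_zero, zero_add, one_add_one_zmod_two]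
  unfold Hsum Hb star
  ring

/-- How a receiver uses a latent bit of its own user: not at all, free of noise, or with a latent
bit of the other user as noise. -/
inductive Obs where
  | unused : Obs
  | clean : Obs
  | noisy (j : ℕ) : Obs

/-- Relabel the noise bit of an observation. -/
def Obs.map (f : ℕ → ℕ) : Obs → Obs
  | Obs.unused => Obs.unused
  | Obs.clean => Obs.clean
  | Obs.noisy j => Obs.noisy (f j)

/-- Signalling of one user on a column of levels, bit by bit. Level `i` carries the latent bit
`i`, drawn with probability `prob s i` of being one in state `s`; `read s i` is the function of the
received column from which bit `i` is recovered. -/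
structure LevelUser where
  prob : Bool → ℕ → ℝ
  enc : Bool → (ℕ → ZMod 2) → ℕ → ZMod 2
  obs : Bool → ℕ → Obs
  read : Bool → ℕ → (ℕ → ZMod 2) → ZMod 2

/-- Received column: the own signal is shifted down by `a`, the interference by `b`. -/
def levelOut (a b : ℕ) (s : Bool) (x x' : ℕ → ZMod 2) (i : ℕ) : ZMod 2 :=
  (if a ≤ i then x (i - a) else 0) + (if s then (if b ≤ i then x' (i - b) else 0) else 0)

namespace LevelUser

/-- Parameter of the noise seen in an observation. -/
noncomputable def noise (p : ℝ) (V : LevelUser) : Obs → ℝ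
  | Obs.noisy j => mix p (V.prob false j) (V.prob true j)
  | _ => 0

/-- Information, in bits, that an observation provides about a bit with parameter `π`. -/
noncomputable def obsGain (p : ℝ) (V : LevelUser) (π : ℝ) : Obs → ℝ
  | Obs.unused => 0
  | Obs.clean => Hb π
  | Obs.noisy j => Hsum π (mix p (V.prob false j) (V.prob true j))
      - Hb (mix p (V.prob false j) (V.prob true j))

/-- Information, in bits, obtained about bit `i` in state `s`. -/
noncomputable def gain (p : ℝ) (U V : LevelUser) (s : Bool) (i : ℕ) : ℝ :=
  obsGain p V (U.prob s i) (U.obs s i)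

/-- Average information about bit `i`. -/
noncomputable def bitRate (p : ℝ) (U V : LevelUser) (i : ℕ) : ℝ :=
  (1 - p) * gain p U V false i + p * gain p U V true i

/-- Rate of the first user on a column of `n` levels. -/
noncomputable def colRate (p : ℝ) (n : ℕ) (U V : LevelUser) : ℝ :=
  ∑ i ∈ Finset.range n, bitRate p U V i

/-- The reading `r` is consistent with the observation `o` of the bit `z`. -/
def ObsValid (n : ℕ) (z' : ℕ → ZMod 2) (r z : ZMod 2) : Obs → Prop
  | Obs.unused => True
  | Obs.clean => r = z
  | Obs.noisy j => j < n ∧ r = z + z' j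

/-- `z` has positive probability in state `s`. -/
def Supp (n : ℕ) (U : LevelUser) (s : Bool) (z : ℕ → ZMod 2) : Prop :=
  ∀ i < n, bern (U.prob s i) (z i) ≠ 0

/-- The observations of the first user describe the channel correctly. -/
structure Valid (n a b : ℕ) (U V : LevelUser) : Prop where
  prob_mem : ∀ s, ∀ i < n, U.prob s i ∈ Set.Icc (0 : ℝ) 1
  obs_valid : ∀ s s' z z' y, Supp n U s z → Supp n V s' z' →
    (∀ i < n, y i = levelOut a b s (U.enc s z) (V.enc s' z') i) →
    ∀ i < n, ObsValid n z' (U.read s i y) (z i) (U.obs s i)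

open Classical in
/-- Decoding metric of a single bit. -/
noncomputable def bitMet (p : ℝ) (U V : LevelUser) (s : Bool) (i : ℕ) (r z : ZMod 2) : ℝ :=
  if U.obs s i = Obs.unused then 1
  else bern (noise p V (U.obs s i)) (r + z)
    / bern (star (U.prob s i) (noise p V (U.obs s i))) r

variable {n a b : ℕ} {U V : LevelUser} {p : ℝ}

theorem noise_mem (hp : p ∈ Set.Icc (0 : ℝ) 1) (hV : ∀ s, ∀ i < n, V.prob s i ∈ Set.Icc (0 : ℝ) 1)
    {o : Obs} (ho : ∀ j, o = Obs.noisy j → j < n) : noise p V o ∈ Set.Icc (0 : ℝ) 1 := by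
  cases o with
  | unused => exact ⟨le_rfl, zero_le_one⟩
  | clean => exact ⟨le_rfl, zero_le_one⟩
  | noisy j => exact mix_mem hp (hV _ _ (ho j rfl)) (hV _ _ (ho j rfl))

theorem exists_supp (n : ℕ) (V : LevelUser) (s : Bool) : ∃ z, Supp n V s z := by
  refine ⟨fun i => if V.prob s i = 0 then 0 else 1, fun i _ => ?_⟩
  by_cases h : V.prob s i = 0 <;> simp [h, bern]

/-- Validity speaks only about columns in the support; inserting any such pair extracts the index
bound. -/
theorem Valid.obs_lt (h : Valid n a b U V) (s : Bool) {i : ℕ} (hi : i < n)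
    {j : ℕ} (hj : U.obs s i = Obs.noisy j) : j < n := by
  obtain ⟨z, hz⟩ := exists_supp n U s
  obtain ⟨z', hz'⟩ := exists_supp n V s
  have := h.obs_valid s s z z' _ hz hz' (fun i _ => rfl) i hi
  rw [hj] at this
  exact this.1

theorem Valid.noise_mem (hp : p ∈ Set.Icc (0 : ℝ) 1) (h : Valid n a b U V) (h' : Valid n a b V U)
    (s : Bool) {i : ℕ} (hi : i < n) : noise p V (U.obs s i) ∈ Set.Icc (0 : ℝ) 1 :=
  LevelUser.noise_mem hp h'.prob_mem fun _ hj => h.obs_lt s hi hj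

theorem bitMet_nonneg (hp : p ∈ Set.Icc (0 : ℝ) 1) (h : Valid n a b U V) (h' : Valid n a b V U)
    (s : Bool) {i : ℕ} (hi : i < n) (r z : ZMod 2) : 0 ≤ bitMet p U V s i r z := by
  unfold bitMet
  split_ifs
  · exact zero_le_one
  · have h1 := h.noise_mem hp h' s hi
    exact div_nonneg (bern_nonneg h1 _) (bern_nonneg (star_mem (h.prob_mem s i hi) h1) _)

/-- For a used observation the numerators add up to the denominator. Only an inequality holds,
because a vanishing denominator makes the quotient zero. -/
theorem sum_bitMet_le (p : ℝ) (U V : LevelUser) (s : Bool) (i : ℕ) (r : ZMod 2) :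
    ∑ z, bern (U.prob s i) z * bitMet p U V s i r z ≤ 1 := by
  unfold bitMet
  split_ifs
  · simp [sum_bern]
  · generalize noise p V (U.obs s i) = ν
    generalize U.prob s i = π
    have e : ∑ z, bern π z * (bern ν (r + z) / bern (star π ν) r)
        = bern (star π ν) r / bern (star π ν) r := by
      simp_rw [← mul_div_assoc, ← Finset.sum_div]
      congr 1
      rw [sum_zmod_two]
      rcases zmod_two_cases r with rfl | rfl <;> simp [bern, star, one_add_one_zmod_two] <;> ring
    rw [e]
    exact div_self_le_one _

end LevelUser

open LevelUser

variable {nd nc T : ℕ}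

/-- Column `t` of a block, extended by zero. -/
def column {q T : ℕ} (x : Block q T) (t : Fin T) (i : ℕ) : ZMod 2 :=
  if h : i < q then x ⟨i, h⟩ t else 0

theorem column_coe {q T : ℕ} (x : Block q T) (t : Fin T) (i : Fin q) :
    column x t i = x i t := by
  simp [column]

theorem shiftMatrix_mul_apply {q u : ℕ} (x : Block q T) (i : Fin q) (t : Fin T) :
    (shiftMatrix q u * x) i t
      = if q - u ≤ (i : ℕ) then column x t (i - (q - u)) else 0 := by
  rw [Matrix.mul_apply]
  simp only [shiftMatrix, Matrix.of_apply, ite_mul, one_mul, zero_mul]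
  split_ifs with h
  · have hlt : (i : ℕ) - (q - u) < q := lt_of_le_of_lt (Nat.sub_le _ _) i.2
    rw [Finset.sum_eq_single ⟨(i : ℕ) - (q - u), hlt⟩]
    · rw [if_pos (by simp; omega), column, dif_pos hlt]
    · intro j _ hj
      rw [if_neg]
      intro hij
      exact hj (Fin.ext (by simp; omega))
    · simp
  · refine Finset.sum_eq_zero fun j _ => ?_
    rw [if_neg]
    omega

theorem output_apply (b : Bool) (x x' : Block (max nd nc) T) (i : Fin (max nd nc)) (t : Fin T) :
    output nd nc b x x' i t
      = levelOut (max nd nc - nd) (max nd nc - nc) b (column x t) (column x' t) i := by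
  unfold output levelOut
  rw [Matrix.add_apply, Matrix.smul_apply, shiftMatrix_mul_apply, shiftMatrix_mul_apply]
  cases b <;> simp

/-- Product distribution of a latent block. -/
noncomputable def latentProb {q : ℕ} (Q : ℕ → ZMod 2 → ℝ) (z : Block q T) : ℝ :=
  ∏ i : Fin q, ∏ t : Fin T, Q i (z i t)

theorem sum_latentProb_mul_apply {q : ℕ} (Q : ℕ → ZMod 2 → ℝ) (hQ : ∀ i : Fin q, ∑ x, Q i x = 1)
    (i : Fin q) (t : Fin T) (f : ZMod 2 → ℝ) :
    ∑ z : Block q T, latentProb Q z * f (z i t) = ∑ x, Q i x * f x := by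
  have h1 := sum_prod_mul_apply (fun (i : Fin q) (c : Fin T → ZMod 2) => ∏ t, Q i (c t))
    (fun i => sum_prod_eq_one (fun _ => Q i) fun _ => hQ i) i (fun c => f (c t))
  rw [sum_prod_mul_apply (fun _ : Fin T => Q i) (fun _ => hQ i) t f] at h1
  exact h1

theorem sum_prod_block {q : ℕ} (g : Fin q → Fin T → ZMod 2 → ℝ) :
    ∑ z : Block q T, ∏ i, ∏ t, g i t (z i t) = ∏ i, ∏ t, ∑ x, g i t x := by
  have h1 : ∀ i, ∏ t, ∑ x, g i t x = ∑ c : Fin T → ZMod 2, ∏ t, g i t (c t) := fun i =>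
    prod_sum_univ fun t => g i t
  simp_rw [h1]
  exact (prod_sum_univ fun i (c : Fin T → ZMod 2) => ∏ t, g i t (c t)).symm

theorem sum_latentProb {q : ℕ} (Q : ℕ → ZMod 2 → ℝ) (hQ : ∀ i : Fin q, ∑ x, Q i x = 1) :
    ∑ z : Block q T, latentProb Q z = 1 := by
  unfold latentProb
  rw [sum_prod_block (fun i _ => Q i)]
  simp [hQ]

namespace LevelUser

/-- Use a level scheme in each column of a block. -/
noncomputable def toBlock (nd nc T : ℕ) {p : ℝ} (hp : p ∈ Set.Icc (0 : ℝ) 1) {a b : ℕ}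
    (U V : LevelUser) (h : Valid (max nd nc) a b U V) (h' : Valid (max nd nc) a b V U) :
    BlockUser nd nc T where
  prob s z := latentProb (fun i => bern (U.prob s i)) z
  enc s z i t := U.enc s (column z t) i
  met s y z := ∏ i : Fin (max nd nc), ∏ t : Fin T, bitMet p U V s i (U.read s i (column y t)) (z i t)
  prob_nonneg s z := Finset.prod_nonneg fun i _ => Finset.prod_nonneg fun t _ =>
    bern_nonneg (h.prob_mem s i i.2) _
  sum_prob s := sum_latentProb _ fun i => sum_bern _
  met_nonneg s y z := Finset.prod_nonneg fun i _ => Finset.prod_nonneg fun t _ =>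
    bitMet_nonneg hp h h' s i.2 _ _
  sum_met_le s y := by
    unfold latentProb
    simp_rw [← Finset.prod_mul_distrib]
    rw [sum_prod_block (fun i t x => bern (U.prob s i) x *
      bitMet p U V s i (U.read s i (column y t)) x)]
    have h0 : ∀ (i : Fin (max nd nc)) (t : Fin T), 0 ≤ ∑ x, bern (U.prob s i) x *
        bitMet p U V s i (U.read s i (column y t)) x := fun i t =>
      Finset.sum_nonneg fun x _ => mul_nonneg (bern_nonneg (h.prob_mem s i i.2) _)
        (bitMet_nonneg hp h h' s i.2 _ _)
    exact Finset.prod_le_one (fun i _ => Finset.prod_nonneg fun t _ => h0 i t) fun i _ =>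
      Finset.prod_le_one (fun t _ => h0 i t) fun t _ => sum_bitMet_le p U V s i _

variable {p : ℝ} {U V : LevelUser}

theorem supp_of_prob_ne_zero {q : ℕ} {s : Bool} {z : Block q T}
    (hz : latentProb (fun i => bern (U.prob s i)) z ≠ 0) (t : Fin T) : Supp q U s (column z t) := by
  intro i hi
  unfold latentProb at hz
  have h1 := Finset.prod_ne_zero_iff.1 ((Finset.prod_ne_zero_iff.1 hz) ⟨i, hi⟩ (Finset.mem_univ _))
    t (Finset.mem_univ t)
  rw [column, dif_pos hi]
  exact h1

/-- The noise bit in an observation. -/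
def noiseBit (z' : ℕ → ZMod 2) : Obs → ZMod 2
  | Obs.noisy j => z' j
  | _ => 0

theorem ObsValid.read_eq {n : ℕ} {z' : ℕ → ZMod 2} {r z : ZMod 2} {o : Obs}
    (h : ObsValid n z' r z o) (ho : o ≠ Obs.unused) : r = z + noiseBit z' o := by
  cases o with
  | unused => exact absurd rfl ho
  | clean => simpa [noiseBit, ObsValid] using h
  | noisy j => exact h.2

/-- The receiver models the noise bit by its law averaged over the unknown state of the other user.
A bit that actually occurs has positive probability in a state of positive weight, hence under the
average. -/
theorem bern_noise_ne_zero {q : ℕ} (hp : p ∈ Set.Icc (0 : ℝ) 1)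
    (hV : ∀ s, ∀ i < q, V.prob s i ∈ Set.Icc (0 : ℝ) 1) {s' : Bool} (hs : stateWt p s' ≠ 0)
    {z' : ℕ → ZMod 2} (hz : Supp q V s' z') {o : Obs} (ho : ∀ j, o = Obs.noisy j → j < q) :
    bern (noise p V o) (noiseBit z' o) ≠ 0 := by
  cases o with
  | unused => simp [noise, noiseBit, bern]
  | clean => simp [noise, noiseBit, bern]
  | noisy j =>
    have hj := ho j rfl
    have e : ∀ x, bern (mix p (V.prob false j) (V.prob true j)) x
        = stateWt p false * bern (V.prob false j) x + stateWt p true * bern (V.prob true j) x := by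
      intro x
      unfold bern mix stateWt
      split_ifs <;> simp at * <;> ring
    have hn : ∀ s, 0 ≤ stateWt p s * bern (V.prob s j) (z' j) := fun s =>
      mul_nonneg (stateWt_nonneg hp s) (bern_nonneg (hV s j hj) _)
    have hne : 0 < stateWt p s' * bern (V.prob s' j) (z' j) :=
      (hn s').lt_of_ne' (mul_ne_zero hs (hz j hj))
    simp only [noise, noiseBit]
    rw [e]
    cases s'
    · exact (add_pos_of_pos_of_nonneg hne (hn true)).ne'
    · exact (add_pos_of_nonneg_of_pos (hn false) hne).ne'

theorem sum_stateWt_mul_bern (p : ℝ) (V : LevelUser) (j : ℕ) (x : ZMod 2) :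
    ∑ s, stateWt p s * bern (V.prob s j) x
      = bern (mix p (V.prob false j) (V.prob true j)) x := by
  unfold bern mix stateWt
  rw [Fintype.sum_bool]
  split_ifs <;> simp at * <;> ring

end LevelUser

end BurstyIC

/-! ### Metric and rate of the block scheme built from level users -/

namespace BurstyIC

open BlockUser

variable {nd nc T : ℕ}

theorem sum_comm₃ {ι α β δ : Type*} [Fintype ι] [Fintype α] [Fintype β] [Fintype δ]
    (f : ι → α → β → δ → ℝ) :
    ∑ i, ∑ a, ∑ b, ∑ d, f i a b d = ∑ a, ∑ b, ∑ d, ∑ i, f i a b d := by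
  rw [Finset.sum_comm]
  refine Finset.sum_congr rfl fun a _ => ?_
  rw [Finset.sum_comm]
  refine Finset.sum_congr rfl fun b _ => ?_
  rw [Finset.sum_comm]

namespace LevelUser

variable {p : ℝ} {U V : LevelUser}

/-- All other latent bits of the interferer integrate out, and averaging over its state turns the
parameter of the noise bit into a mixture. -/
theorem sum_noiseBit {q : ℕ} (p : ℝ) (V : LevelUser) {o : Obs}
    (ho : ∀ j, o = Obs.noisy j → j < q) (t : Fin T) (h : ZMod 2 → ℝ) :
    ∑ s', stateWt p s' * ∑ z' : Block q T, latentProb (fun i => bern (V.prob s' i)) z' *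
        h (noiseBit (column z' t) o)
      = ∑ w, bern (noise p V o) w * h w := by
  have h0 : ∑ s', stateWt p s' * ∑ z' : Block q T,
      latentProb (fun i => bern (V.prob s' i)) z' * h 0 = ∑ w, bern 0 w * h w := by
    simp_rw [← Finset.sum_mul]
    simp_rw [fun s' => sum_latentProb (q := q) (T := T) (fun i => bern (V.prob s' i))
      fun i => sum_bern _, one_mul, ← Finset.sum_mul, sum_stateWt, sum_zmod_two]
    simp [bern]
  cases o with
  | unused => exact h0
  | clean => exact h0
  | noisy j =>
    have hj := ho j rfl
    have e : ∀ z' : Block q T, column z' t j = z' ⟨j, hj⟩ t := fun z' => by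
      rw [column, dif_pos hj]
    simp only [noiseBit, noise, e]
    simp_rw [fun s' => sum_latentProb_mul_apply (q := q) (fun i => bern (V.prob s' i))
      (fun i => sum_bern _) ⟨j, hj⟩ t h]
    simp_rw [← sum_stateWt_mul_bern, Finset.sum_mul, Finset.mul_sum]
    rw [Finset.sum_comm]
    refine Finset.sum_congr rfl fun w _ => Finset.sum_congr rfl fun s _ => by ring

theorem obsGain_eq (p : ℝ) (V : LevelUser) (π : ℝ) {o : Obs} (ho : o ≠ Obs.unused) :
    obsGain p V π o = Hsum π (noise p V o) - Hb (noise p V o) := by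
  cases o with
  | unused => exact absurd rfl ho
  | clean => simp [obsGain, noise]
  | noisy j => rfl

theorem sum_bern_logb_bitMet {π ν : ℝ} {s : Bool} {i : ℕ} (hπ : U.prob s i = π)
    (hν : noise p V (U.obs s i) = ν) (hπ' : π ∈ Set.Icc (0 : ℝ) 1) (hν' : ν ∈ Set.Icc (0 : ℝ) 1) :
    ∑ x, ∑ w, bern π x * bern ν w * Real.logb 2 (bitMet p U V s i (x + w) x) = gain p U V s i := by
  unfold gain bitMet
  split_ifs with h
  · simp [h, obsGain]
  · rw [obsGain_eq p V _ h, hπ, hν, ← sum_bern_logb hπ' hν']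
    simp_rw [add_add_cancel_zmod_two]

variable {a b : ℕ} (h : Valid (max nd nc) a b U V) (h' : Valid (max nd nc) a b V U)
  (hp : p ∈ Set.Icc (0 : ℝ) 1)

theorem bitMet_pos {q : ℕ} (hp : p ∈ Set.Icc (0 : ℝ) 1)
    (hV : ∀ s, ∀ i < q, V.prob s i ∈ Set.Icc (0 : ℝ) 1)
    {s s' : Bool} (hs : stateWt p s' ≠ 0) {z' : ℕ → ZMod 2} (hz' : Supp q V s' z') {i : ℕ}
    (ho : ∀ j, U.obs s i = Obs.noisy j → j < q) (hπ : U.prob s i ∈ Set.Icc (0 : ℝ) 1) {x : ZMod 2}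
    (hx : bern (U.prob s i) x ≠ 0) :
    0 < bitMet p U V s i (x + noiseBit z' (U.obs s i)) x := by
  have hν := noise_mem hp hV ho
  have hw := bern_noise_ne_zero hp hV hs hz' ho
  unfold bitMet
  split_ifs
  · exact one_pos
  · rw [add_add_cancel_zmod_two]
    exact div_pos ((bern_nonneg hν _).lt_of_ne' hw) (bern_star_pos hπ hν hx hw)

-- On the support every used reading equals the own bit plus its noise bit, so the decoder's metric
-- becomes a function of latent bits alone. Unused bits contribute the factor one, whatever is read.
include h h' in
theorem density_toBlock (ha : max nd nc - nd = a) (hb : max nd nc - nc = b) (s s' : Bool)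
    (z z' : Block (max nd nc) T)
    (hw : wt p (toBlock nd nc T hp U V h h') (toBlock nd nc T hp V U h' h) s s' z z' ≠ 0) :
    density (toBlock nd nc T hp U V h h') (toBlock nd nc T hp V U h' h) s s' z z'
      = ∏ i : Fin (max nd nc), ∏ t : Fin T,
        bitMet p U V s i (z i t + noiseBit (column z' t) (U.obs s i)) (z i t)
    ∧ ∀ (i : Fin (max nd nc)) (t : Fin T),
        0 < bitMet p U V s i (z i t + noiseBit (column z' t) (U.obs s i)) (z i t) := by
  have hv : stateWt p s' ≠ 0 := (mul_ne_zero_iff.1 (mul_ne_zero_iff.1 (mul_ne_zero_iff.1 hw).1).1).2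
  have hz := (mul_ne_zero_iff.1 (mul_ne_zero_iff.1 hw).1).2
  have hz' := (mul_ne_zero_iff.1 hw).2
  constructor
  · change ∏ i : Fin (max nd nc), ∏ t : Fin T, bitMet p U V s i (U.read s i (column
      (output nd nc s ((toBlock nd nc T hp U V h h').enc s z)
        ((toBlock nd nc T hp V U h' h).enc s' z')) t)) (z i t) = _
    refine Finset.prod_congr rfl fun i _ => Finset.prod_congr rfl fun t _ => ?_
    by_cases ho : U.obs s i = Obs.unused
    · unfold bitMet
      rw [if_pos ho, if_pos ho]
    · have hval := h.obs_valid s s' (column z t) (column z' t)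
        (column (output nd nc s ((toBlock nd nc T hp U V h h').enc s z)
          ((toBlock nd nc T hp V U h' h).enc s' z')) t)
        (supp_of_prob_ne_zero hz t) (supp_of_prob_ne_zero hz' t) (by
          intro i hi
          rw [column, dif_pos hi, output_apply, ha, hb]
          unfold levelOut
          congr 1
          · split_ifs
            · rw [column, dif_pos (by omega)]; rfl
            · rfl
          · split_ifs
            · rw [column, dif_pos (by omega)]; rfl
            · rfl
            · rfl) i i.2
      rw [hval.read_eq ho, column_coe]
  · intro i t
    refine bitMet_pos hp h'.prob_mem hv (supp_of_prob_ne_zero hz' t)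
      (fun _ hj => h.obs_lt s i.2 hj) (h.prob_mem s i i.2) ?_
    have := supp_of_prob_ne_zero hz t i i.2
    rwa [column_coe] at this

theorem sound_toBlock (ha : max nd nc - nd = a) (hb : max nd nc - nc = b) :
    Sound p (toBlock nd nc T hp U V h h') (toBlock nd nc T hp V U h' h) := by
  intro s s' z z' hw
  obtain ⟨h1, h2⟩ := density_toBlock h h' hp ha hb s s' z z' hw
  rw [h1]
  exact Finset.prod_pos fun i _ => Finset.prod_pos fun t _ => h2 i t

/-- The logarithm of the product metric is a sum over levels and channel uses, and linearity of
expectation isolates one bit with one noise bit. No independence between the noises of different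
readings enters, so one interfering bit may occur in several of them. -/
theorem rate_toBlock (ha : max nd nc - nd = a) (hb : max nd nc - nc = b) :
    rate p (toBlock nd nc T hp U V h h') (toBlock nd nc T hp V U h' h)
      = T * colRate p (max nd nc) U V := by
  obtain ⟨g, hg⟩ : ∃ g : ℕ → Bool → ZMod 2 → ZMod 2 → ℝ,
    g = fun i s x w => Real.logb 2 (bitMet p U V s i (x + w) x) := ⟨_, rfl⟩
  have h1 : ∀ s s' z z', wt p (toBlock nd nc T hp U V h h') (toBlock nd nc T hp V U h' h) s s' z z'
        * Real.logb 2 (density (toBlock nd nc T hp U V h h') (toBlock nd nc T hp V U h' h) s s' z z')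
      = ∑ i : Fin (max nd nc), ∑ t : Fin T,
        stateWt p s * (stateWt p s' * (latentProb (fun i => bern (U.prob s i)) z *
          (latentProb (fun i => bern (V.prob s' i)) z' *
            g i s (z i t) (noiseBit (column z' t) (U.obs s i))))) := by
    intro s s' z z'
    have e : wt p (toBlock nd nc T hp U V h h') (toBlock nd nc T hp V U h' h) s s' z z'
        = stateWt p s * stateWt p s' * latentProb (fun i => bern (U.prob s i)) z *
          latentProb (fun i => bern (V.prob s' i)) z' := rfl
    by_cases hw : wt p (toBlock nd nc T hp U V h h') (toBlock nd nc T hp V U h' h) s s' z z' = 0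
    · rw [hw, zero_mul]
      refine (Finset.sum_eq_zero fun i _ => Finset.sum_eq_zero fun t _ => ?_).symm
      rw [e] at hw
      linear_combination hw * g i s (z i t) (noiseBit (column z' t) (U.obs s i))
    · obtain ⟨h1, h2⟩ := density_toBlock h h' hp ha hb s s' z z' hw
      rw [h1, Real.logb_prod _ _ fun i _ => (Finset.prod_pos fun t _ => h2 i t).ne',
        Finset.mul_sum]
      refine Finset.sum_congr rfl fun i _ => ?_
      rw [Real.logb_prod _ _ fun t _ => (h2 i t).ne', Finset.mul_sum]
      refine Finset.sum_congr rfl fun t _ => ?_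
      rw [e, hg]
      ring
  have h2 : ∀ (i : Fin (max nd nc)) (t : Fin T) (s : Bool),
      ∑ s', ∑ z : Block (max nd nc) T, ∑ z' : Block (max nd nc) T,
        stateWt p s * (stateWt p s' * (latentProb (fun i => bern (U.prob s i)) z *
          (latentProb (fun i => bern (V.prob s' i)) z' *
            g i s (z i t) (noiseBit (column z' t) (U.obs s i)))))
      = stateWt p s * gain p U V s i := by
    intro i t s
    have h3 := fun x => sum_noiseBit (T := T) p V (fun j hj => h.obs_lt s i.2 hj) t (g i s x)
    calc _ = stateWt p s * ∑ z : Block (max nd nc) T, latentProb (fun i => bern (U.prob s i)) z *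
          ∑ s', stateWt p s' * ∑ z' : Block (max nd nc) T,
            latentProb (fun i => bern (V.prob s' i)) z' *
            g i s (z i t) (noiseBit (column z' t) (U.obs s i)) := by
          simp_rw [← Finset.mul_sum]
          congr 1
          simp_rw [Finset.mul_sum]
          rw [Finset.sum_comm]
          refine Finset.sum_congr rfl fun z _ => Finset.sum_congr rfl fun s' _ =>
            Finset.sum_congr rfl fun z' _ => by ring
      _ = stateWt p s * ∑ x, bern (U.prob s i) x *
            ∑ w, bern (noise p V (U.obs s i)) w * g i s x w := by
          simp_rw [h3]
          rw [sum_latentProb_mul_apply (fun i => bern (U.prob s i)) (fun i => sum_bern _) i t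
            (fun x => ∑ w, bern (noise p V (U.obs s i)) w * g i s x w)]
      _ = stateWt p s * gain p U V s i := by
          rw [← sum_bern_logb_bitMet (U := U) (V := V) (p := p) (s := s) (i := i) rfl rfl
            (h.prob_mem s i i.2) (h.noise_mem hp h' s i.2)]
          simp_rw [Finset.mul_sum, hg]
          refine Finset.sum_congr rfl fun x _ => Finset.sum_congr rfl fun w _ => ?_
          ring
  have h5 : rate p (toBlock nd nc T hp U V h h') (toBlock nd nc T hp V U h' h)
      = ∑ s, ∑ i : Fin (max nd nc), ∑ t : Fin T,
      ∑ s', ∑ z : Block (max nd nc) T, ∑ z' : Block (max nd nc) T,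
        stateWt p s * (stateWt p s' * (latentProb (fun i => bern (U.prob s i)) z *
          (latentProb (fun i => bern (V.prob s' i)) z' *
            g i s (z i t) (noiseBit (column z' t) (U.obs s i))))) := by
    unfold rate
    simp_rw [h1]
    refine Finset.sum_congr rfl fun s _ => ?_
    exact ((Finset.sum_congr rfl fun i _ => sum_comm₃ _).trans (sum_comm₃ _)).symm
  rw [h5]
  simp_rw [h2]
  unfold colRate bitRate
  rw [Finset.sum_range, Fintype.sum_bool, ← Finset.sum_add_distrib, Finset.mul_sum]
  refine Finset.sum_congr rfl fun i _ => ?_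
  simp [stateWt]
  ring

/-- The block scheme obtained from two level users. -/
theorem exists_scheme (h : Valid (max nd nc) (max nd nc - nd) (max nd nc - nc) U V)
    (h' : Valid (max nd nc) (max nd nc - nd) (max nd nc - nc) V U)
    (hp : p ∈ Set.Icc (0 : ℝ) 1) : ∃ s : Scheme nd nc T p,
      s.rate₁ = T * colRate p (max nd nc) U V ∧ s.rate₂ = T * colRate p (max nd nc) V U :=
  ⟨⟨toBlock nd nc T hp U V h h', toBlock nd nc T hp V U h' h, sound_toBlock h h' hp rfl rfl,
    sound_toBlock h' h hp rfl rfl⟩, rate_toBlock h h' hp rfl rfl, rate_toBlock h' h hp rfl rfl⟩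

end LevelUser

end BurstyIC

namespace BurstyIC

/-! ### Splitting the levels into independent chains -/

namespace LevelUser

/-- Run the level users `U c` on the residue classes `c` modulo `D`. -/
def chains (D : ℕ) (U : ℕ → LevelUser) : LevelUser where
  prob s i := (U (i % D)).prob s (i / D)
  enc s z i := (U (i % D)).enc s (fun k => z (i % D + D * k)) (i / D)
  obs s i := ((U (i % D)).obs s (i / D)).map fun j => i % D + D * j
  read s i y := (U (i % D)).read s (i / D) (fun k => y (i % D + D * k))

variable {D q a b : ℕ} {U V : ℕ → LevelUser} {p : ℝ}

theorem add_mul_mod_div (hD : 0 < D) {c : ℕ} (hc : c < D) (i : ℕ) :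
    (c + D * i) % D = c ∧ (c + D * i) / D = i := by
  constructor
  · rw [Nat.add_mul_mod_self_left, Nat.mod_eq_of_lt hc]
  · rw [Nat.add_mul_div_left _ _ hD, Nat.div_eq_of_lt hc, zero_add]

theorem chains_prob (hD : 0 < D) {c : ℕ} (hc : c < D) (s : Bool) (i : ℕ) :
    (chains D U).prob s (c + D * i) = (U c).prob s i := by
  obtain ⟨h1, h2⟩ := add_mul_mod_div hD hc i
  simp only [chains, h1, h2]

theorem chains_enc (hD : 0 < D) {c : ℕ} (hc : c < D) (s : Bool) (z : ℕ → ZMod 2) (i : ℕ) :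
    (chains D U).enc s z (c + D * i) = (U c).enc s (fun k => z (c + D * k)) i := by
  obtain ⟨h1, h2⟩ := add_mul_mod_div hD hc i
  simp only [chains, h1, h2]

theorem mul_le_add_mul_iff (hD : 0 < D) {c : ℕ} (hc : c < D) (a i : ℕ) :
    a * D ≤ c + D * i ↔ a ≤ i := by
  rw [← (add_mul_mod_div hD hc i).2, Nat.le_div_iff_mul_le hD,
    (add_mul_mod_div hD hc i).2]

/-- Shifts by multiples of `D` keep the residue class, so a received level involves only levels of
its own class, with shifts `a` and `b` there. -/
theorem chains_levelOut (hD : 0 < D) {c : ℕ} (hc : c < D) (s s' : Bool) (z z' : ℕ → ZMod 2)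
    (i : ℕ) : levelOut (a * D) (b * D) s ((chains D U).enc s z) ((chains D V).enc s' z') (c + D * i)
      = levelOut a b s ((U c).enc s fun k => z (c + D * k)) ((V c).enc s' fun k => z' (c + D * k))
        i := by
  have hsub : ∀ m, m ≤ i → c + D * i - m * D = c + D * (i - m) := by
    intro m hm
    obtain ⟨k, rfl⟩ := Nat.exists_eq_add_of_le hm
    rw [Nat.add_sub_cancel_left, mul_add, mul_comm m D]
    omega
  unfold levelOut
  simp only [mul_le_add_mul_iff hD hc]
  congr 1
  · split_ifs with h
    · rw [hsub a h, chains_enc hD hc]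
    · rfl
  · split_ifs with _ h
    · rw [hsub b h, chains_enc hD hc]
    · rfl
    · rfl

theorem chains_valid (hD : 0 < D) {n : ℕ → ℕ} (hn : ∀ c < D, ∀ i, c + D * i < q ↔ i < n c)
    (h : ∀ c < D, Valid (n c) a b (U c) (V c)) :
    Valid q (a * D) (b * D) (chains D U) (chains D V) := by
  have hdiv : ∀ i, i % D + D * (i / D) = i := fun i => Nat.mod_add_div i D
  have hlt : ∀ i < q, i / D < n (i % D) := fun i hi =>
    (hn _ (Nat.mod_lt _ hD) _).1 (by rwa [hdiv])
  constructor
  · intro s i hi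
    exact (h _ (Nat.mod_lt _ hD)).prob_mem s _ (hlt i hi)
  · intro s s' z z' y hz hz' hy i hi
    have hc := Nat.mod_lt i hD
    have hsupp : ∀ (W : ℕ → LevelUser) (s : Bool) (z : ℕ → ZMod 2), Supp q (chains D W) s z →
        Supp (n (i % D)) (W (i % D)) s (fun k => z (i % D + D * k)) := by
      intro W s z hz k hk
      have := hz _ ((hn _ hc k).2 hk)
      rwa [chains_prob hD hc] at this
    have key := (h _ hc).obs_valid s s' _ _ (fun k => y (i % D + D * k)) (hsupp U s z hz)
      (hsupp V s' z' hz') (fun k hk => by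
        rw [← chains_levelOut hD hc]
        exact hy _ ((hn _ hc k).2 hk)) _ (hlt i hi)
    simp only [hdiv] at key
    simp only [chains]
    revert key
    generalize (U (i % D)).obs s (i / D) = o
    intro key
    cases o with
    | unused => trivial
    | clean => exact key
    | noisy j => exact ⟨(hn _ hc j).2 key.1, key.2⟩

theorem chains_bitRate (hD : 0 < D) (i : ℕ) :
    bitRate p (chains D U) (chains D V) i = bitRate p (U (i % D)) (V (i % D)) (i / D) := by
  have hg : ∀ s, gain p (chains D U) (chains D V) s i
      = gain p (U (i % D)) (V (i % D)) s (i / D) := by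
    intro s
    have hc := Nat.mod_lt i hD
    change obsGain p (chains D V) ((U (i % D)).prob s (i / D))
        (((U (i % D)).obs s (i / D)).map fun j => i % D + D * j)
      = obsGain p (V (i % D)) ((U (i % D)).prob s (i / D)) ((U (i % D)).obs s (i / D))
    generalize (U (i % D)).obs s (i / D) = o
    cases o with
    | unused => rfl
    | clean => rfl
    | noisy j => simp only [Obs.map, obsGain, chains_prob hD hc]
  unfold bitRate
  rw [hg, hg]

theorem sum_range_mod_div (hD : 0 < D) (n r : ℕ) (hr : r ≤ D) (f : ℕ → ℕ → ℝ) :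
    ∑ i ∈ Finset.range (n * D + r), f (i % D) (i / D)
      = ∑ i ∈ Finset.range n, ∑ c ∈ Finset.range D, f c i + ∑ c ∈ Finset.range r, f c n := by
  have h : ∀ n r, r ≤ D → ∑ c ∈ Finset.range r, f ((n * D + c) % D) ((n * D + c) / D)
      = ∑ c ∈ Finset.range r, f c n := by
    intro n r hr
    refine Finset.sum_congr rfl fun c hc => ?_
    obtain ⟨h1, h2⟩ := add_mul_mod_div hD (lt_of_lt_of_le (Finset.mem_range.1 hc) hr) n
    rw [add_comm, mul_comm n D, h1, h2]
  rw [Finset.sum_range_add, h n r hr]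
  congr 1
  clear hr
  induction n with
  | zero => simp
  | succ n ih => rw [Nat.succ_mul, Finset.sum_range_add, ih, h n D le_rfl, Finset.sum_range_succ]

end LevelUser

/-! ### From chains to the capacity region -/

open LevelUser

/-- The rate pair `τ` of a chain with `n` levels and shifts `a`, `b` is dominated by bitwise
schemes in every nonnegative direction. -/
def ChainDom (p : ℝ) (n a b : ℕ) (τ : ℝ × ℝ) : Prop :=
  ∀ l₁ l₂ : ℝ, 0 ≤ l₁ → 0 ≤ l₂ → ∃ U V : LevelUser, Valid n a b U V ∧ Valid n a b V U ∧
    l₁ * τ.1 + l₂ * τ.2 ≤ l₁ * colRate p n U V + l₂ * colRate p n V U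

/-- Counts the members of a residue class below `n * D + r`: the first `r` classes have one more. -/
theorem add_mul_lt_iff {D n r c i : ℕ} (hr : r ≤ D) (hc : c < D) :
    c + D * i < n * D + r ↔ i < if c < r then n + 1 else n := by
  rcases lt_trichotomy i n with h | rfl | h
  · obtain ⟨k, rfl⟩ := Nat.exists_eq_add_of_lt h
    have e : (i + k + 1) * D = D * i + k * D + D := by ring
    have := Nat.zero_le (k * D)
    rw [e]
    split_ifs <;> constructor <;> intro <;> omega
  · rw [mul_comm D i]
    split_ifs <;> constructor <;> intro <;> omega
  · obtain ⟨k, rfl⟩ := Nat.exists_eq_add_of_lt h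
    have e : D * (n + k + 1) = n * D + k * D + D := by ring
    rw [e]
    split_ifs <;> constructor <;> intro <;> omega

/-- For a given direction one chooses a good scheme for each chain length and runs it on all classes
of that length. Rates add over classes, so domination on chains passes to the full column. -/
theorem mem_capacityRegion_of_chainDom {nd nc T : ℕ} {p : ℝ} (hp : p ∈ Set.Icc (0 : ℝ) 1)
    (hT : 0 < T) {D n r a b : ℕ} (hD : 0 < D) (hr : r ≤ D) (hq : max nd nc = n * D + r)
    (ha : max nd nc - nd = a * D) (hb : max nd nc - nc = b * D) {τ τ' R : ℝ × ℝ}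
    (hτ : ChainDom p (n + 1) a b τ) (hτ' : ChainDom p n a b τ') (h₁ : 0 ≤ R.1) (h₂ : 0 ≤ R.2)
    (hR₁ : R.1 = r * τ.1 + (D - r) * τ'.1) (hR₂ : R.2 = r * τ.2 + (D - r) * τ'.2) :
    R ∈ capacityRegion nd nc T p := by
  refine mem_capacityRegion hp hT h₁ h₂ fun l₁ l₂ hl₁ hl₂ => ?_
  obtain ⟨U, V, hU, hV, hUV⟩ := hτ l₁ l₂ hl₁ hl₂
  obtain ⟨U', V', hU', hV', hUV'⟩ := hτ' l₁ l₂ hl₁ hl₂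
  have valid : ∀ U V U' V' : LevelUser, Valid (n + 1) a b U V → Valid n a b U' V' →
      Valid (max nd nc) (max nd nc - nd) (max nd nc - nc) (chains D fun c => if c < r then U else U')
        (chains D fun c => if c < r then V else V') := by
    intro U V U' V' h h'
    rw [ha, hb]
    refine chains_valid hD (n := fun c => if c < r then n + 1 else n) (fun c hc i => ?_)
      fun c hc => ?_
    · rw [hq]
      exact add_mul_lt_iff hr hc
    · by_cases hcr : c < r
      · simpa [hcr] using h
      · simpa [hcr] using h'
  have hrate : ∀ U V U' V' : LevelUser, colRate p (max nd nc)
      (chains D fun c => if c < r then U else U') (chains D fun c => if c < r then V else V')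
      = r * colRate p (n + 1) U V + (D - r) * colRate p n U' V' := by
    intro U V U' V'
    unfold colRate
    simp_rw [chains_bitRate hD]
    rw [hq, sum_range_mod_div hD n r hr (fun c i => bitRate p (if c < r then U else U')
      (if c < r then V else V') i)]
    have e1 : ∀ i, ∑ c ∈ Finset.range D, bitRate p (if c < r then U else U')
        (if c < r then V else V') i = r * bitRate p U V i + (D - r) * bitRate p U' V' i := by
      intro i
      obtain ⟨k, rfl⟩ := Nat.exists_eq_add_of_le hr
      rw [Finset.sum_range_add, Finset.sum_congr rfl fun c hc => by
          rw [if_pos (Finset.mem_range.1 hc), if_pos (Finset.mem_range.1 hc)],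
        Finset.sum_congr (s₁ := Finset.range k) rfl fun c _ => by
          rw [if_neg (by omega), if_neg (by omega)]]
      simp
    have e2 : ∑ c ∈ Finset.range r, bitRate p (if c < r then U else U')
        (if c < r then V else V') n = r * bitRate p U V n := by
      rw [Finset.sum_congr rfl fun c hc => by
          rw [if_pos (Finset.mem_range.1 hc), if_pos (Finset.mem_range.1 hc)]]
      simp
    simp_rw [e1]
    rw [e2, Finset.sum_add_distrib, ← Finset.mul_sum, ← Finset.mul_sum, Finset.sum_range_succ]
    ring
  obtain ⟨s, hs₁, hs₂⟩ := exists_scheme (T := T) (valid U V U' V' hU hU')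
    (valid V U V' U' hV hV') hp
  refine ⟨s, ?_⟩
  rw [hs₁, hs₂, hrate, hrate, hR₁, hR₂]
  have hr0 : (0 : ℝ) ≤ r := Nat.cast_nonneg r
  have hDr : (0 : ℝ) ≤ D - r := sub_nonneg.2 (Nat.cast_le.2 hr)
  have hT0 : (0 : ℝ) ≤ T := Nat.cast_nonneg T
  have h3 := mul_le_mul_of_nonneg_left (add_le_add (mul_le_mul_of_nonneg_left hUV hr0)
    (mul_le_mul_of_nonneg_left hUV' hDr)) hT0
  linarith

namespace ChainDom

variable {p : ℝ} {n a b : ℕ}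

theorem of_users {U V : LevelUser} (h : Valid n a b U V) (h' : Valid n a b V U) :
    ChainDom p n a b (colRate p n U V, colRate p n V U) :=
  fun _ _ _ _ => ⟨U, V, h, h', le_rfl⟩

theorem swap {τ : ℝ × ℝ} (h : ChainDom p n a b τ) : ChainDom p n a b (τ.2, τ.1) := by
  intro l₁ l₂ h₁ h₂
  obtain ⟨U, V, hU, hV, hle⟩ := h l₂ l₁ h₂ h₁
  exact ⟨V, U, hV, hU, by linarith⟩

theorem of_le {τ τ' : ℝ × ℝ} (h : ChainDom p n a b τ) (h₁ : τ'.1 ≤ τ.1) (h₂ : τ'.2 ≤ τ.2) :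
    ChainDom p n a b τ' := by
  intro l₁ l₂ hl₁ hl₂
  obtain ⟨U, V, hU, hV, hle⟩ := h l₁ l₂ hl₁ hl₂
  refine ⟨U, V, hU, hV, le_trans ?_ hle⟩
  exact add_le_add (mul_le_mul_of_nonneg_left h₁ hl₁) (mul_le_mul_of_nonneg_left h₂ hl₂)

/-- It suffices to dominate in each direction by some dominated pair. -/
theorem of_forall {τ : ℝ × ℝ} (h : ∀ l₁ l₂ : ℝ, 0 ≤ l₁ → 0 ≤ l₂ → ∃ τ', ChainDom p n a b τ' ∧
    l₁ * τ.1 + l₂ * τ.2 ≤ l₁ * τ'.1 + l₂ * τ'.2) : ChainDom p n a b τ := by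
  intro l₁ l₂ hl₁ hl₂
  obtain ⟨τ', h', hle⟩ := h l₁ l₂ hl₁ hl₂
  obtain ⟨U, V, hU, hV, hle'⟩ := h' l₁ l₂ hl₁ hl₂
  exact ⟨U, V, hU, hV, hle.trans hle'⟩

/-- In each direction the better of the two pairs dominates the midpoint. Mirror-image schemes are
symmetrised in this way. -/
theorem average {τ τ' : ℝ × ℝ} (h : ChainDom p n a b τ) (h' : ChainDom p n a b τ') :
    ChainDom p n a b ((τ.1 + τ'.1) / 2, (τ.2 + τ'.2) / 2) := by
  refine of_forall fun l₁ l₂ _ _ => ?_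
  rcases le_total (l₁ * τ.1 + l₂ * τ.2) (l₁ * τ'.1 + l₂ * τ'.2) with hle | hle
  · exact ⟨τ', h', by dsimp only; linarith⟩
  · exact ⟨τ, h, by dsimp only; linarith⟩

end ChainDom

end BurstyIC

namespace BurstyIC

/-! ### Signalling schemes on a chain -/

theorem add_cancel_zmod_two (c x y : ZMod 2) : x + y + (c + y) + c = x := by
  revert c x y
  decide

namespace LevelUser

/-- Probability assignment from pairs of parameters, one for each state. -/
def pairProb (L : ℕ → ℝ × ℝ) (s : Bool) (i : ℕ) : ℝ := if s then (L i).2 else (L i).1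

/-- Level `i` repeats the latent bit `src i`; the other user does the same with `src'`. Bit `i` is
read where level `i` is received, unless that level repeats another bit. -/
def stdUser (n a b : ℕ) (L : ℕ → ℝ × ℝ) (src src' : ℕ → ℕ) : LevelUser where
  prob := pairProb L
  enc _ z i := z (src i)
  obs s i := if i + a < n ∧ src i = i then
    (if s = true ∧ b ≤ i + a then Obs.noisy (src' (i + a - b)) else Obs.clean) else Obs.unused
  read _ i y := y (i + a)

/-- Level `k'` repeats bit `k`. -/
def dupSrc (k k' i : ℕ) : ℕ := if i = k' then k else i

/-- The user facing the repetition `dupSrc k k'` of the other user: in the presence of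
interference, bit `k + b - a` is cleared of the repeated bit with the help of row `k' + b`, where
the own signal is the constant `c`. -/
def clearUser (n a b : ℕ) (L : ℕ → ℝ × ℝ) (k k' : ℕ) (c : ZMod 2) : LevelUser where
  prob := pairProb L
  enc _ z i := z i
  obs s i := if s = true ∧ i + a = k + b then Obs.clean
    else if s = true ∧ i + a = k' + b then Obs.unused
    else (stdUser n a b L id (dupSrc k k')).obs s i
  read s i y := if s = true ∧ i + a = k + b then y (k + b) + y (k' + b) + c else y (i + a)

variable {n a b : ℕ} {p : ℝ}

/-- Parameters in the unit interval. -/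
def UnitPair (x : ℝ × ℝ) : Prop := x.1 ∈ Set.Icc (0 : ℝ) 1 ∧ x.2 ∈ Set.Icc (0 : ℝ) 1

theorem pairProb_mem {L : ℕ → ℝ × ℝ} (hL : ∀ i, UnitPair (L i)) (s : Bool) (i : ℕ) :
    pairProb L s i ∈ Set.Icc (0 : ℝ) 1 := by
  cases s
  · exact (hL i).1
  · exact (hL i).2

theorem levelOut_add {s : Bool} {x x' : ℕ → ZMod 2} (i : ℕ) :
    levelOut a b s x x' (i + a) = x i + (if s = true ∧ b ≤ i + a then x' (i + a - b) else 0) := by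
  unfold levelOut
  rw [if_pos (Nat.le_add_left a i), Nat.add_sub_cancel, ite_and]

theorem stdUser_valid {L : ℕ → ℝ × ℝ} (hL : ∀ i, UnitPair (L i)) (src : ℕ → ℕ) {src' : ℕ → ℕ}
    (hsrc' : ∀ i < n, src' i < n) {V : LevelUser} (hV : ∀ s z i, V.enc s z i = z (src' i)) :
    Valid n a b (stdUser n a b L src src') V := by
  refine ⟨fun s i _ => pairProb_mem hL s i, ?_⟩
  intro s s' z z' y _ _ hy i hi
  simp only [stdUser]
  by_cases h : i + a < n ∧ src i = i
  · rw [if_pos h, hy _ h.1, levelOut_add, hV]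
    simp only [stdUser, h.2]
    split_ifs with h'
    · exact ⟨hsrc' _ (by omega), rfl⟩
    · simp [ObsValid]
  · rw [if_neg h]
    trivial

/-- Rows `k + b` and `k' + b` contain the same interfering bit, and the own signal in the second is
the known constant `c`: supported under interference on one value, or absent when the row lies above
the own signal, in which case `c = 0`. Adding the two rows and `c` leaves the wanted bit. -/
theorem clearUser_valid {L : ℕ → ℝ × ℝ} (hL : ∀ i, UnitPair (L i)) {k k' : ℕ} {c : ZMod 2}
    (hk : k + b < n) (hk' : k' + b < n)
    (hc : a ≤ k' + b → ∀ x, bern (L (k' + b - a)).2 x ≠ 0 → x = c) (hc' : k' + b < a → c = 0)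
    {U : LevelUser} (hU : ∀ s z i, U.enc s z i = z (dupSrc k k' i)) :
    Valid n a b (clearUser n a b L k k' c) U := by
  refine ⟨fun s i _ => pairProb_mem hL s i, ?_⟩
  intro s s' z z' y hz hz' hy i hi
  by_cases h : s = true ∧ i + a = k + b
  · obtain ⟨rfl, hi'⟩ := h
    simp only [clearUser, hi', and_self, if_true]
    have e1 : y (k + b) = z i + z' k := by
      rw [← hi', hy _ (by omega), levelOut_add, if_pos ⟨rfl, by omega⟩, hU, hi',
        Nat.add_sub_cancel]
      simp only [clearUser, dupSrc]
      split_ifs <;> rfl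
    have e2 : y (k' + b) = c + z' k := by
      rw [hy _ hk']
      unfold levelOut
      rw [if_pos rfl, if_pos (Nat.le_add_left b k'), Nat.add_sub_cancel, hU]
      have : dupSrc k k' k' = k := if_pos rfl
      rw [this]
      congr 1
      split_ifs with hle
      · exact hc hle _ (hz _ (by omega))
      · exact (hc' (by omega)).symm
    rw [e1, e2]
    change z i + z' k + (c + z' k) + c = z i
    exact add_cancel_zmod_two _ _ _
  · have h1 : (clearUser n a b L k k' c).read s i y = y (i + a) := by
      simp only [clearUser]
      rw [if_neg h]
    have h2 : (clearUser n a b L k k' c).obs s i = if s = true ∧ i + a = k' + b then Obs.unused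
        else (stdUser n a b L id (dupSrc k k')).obs s i := by
      simp only [clearUser]
      rw [if_neg h]
    rw [h1, h2]
    split_ifs
    · trivial
    · exact (stdUser_valid (n := n) (a := a) (b := b) hL id (src' := dupSrc k k') (V := U) (by
        intro i hi
        unfold dupSrc
        split_ifs <;> omega) hU).obs_valid s s' z z' y hz hz' hy i hi

/-- Average information about a bit received without interference. -/
noncomputable def cleanRate (p : ℝ) (x : ℝ × ℝ) : ℝ := (1 - p) * Hb x.1 + p * Hb x.2

/-- Average information about a bit that is hit by a bit of the other user in one of the states. -/
noncomputable def noisyRate (p : ℝ) (x y : ℝ × ℝ) : ℝ :=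
  (1 - p) * Hb x.1 + p * (Hsum x.2 (mix p y.1 y.2) - Hb (mix p y.1 y.2))

theorem stdUser_bitRate {L L' : ℕ → ℝ × ℝ} {src src' : ℕ → ℕ} {V : LevelUser}
    (hV : V.prob = pairProb L') (i : ℕ) : bitRate p (stdUser n a b L src src') V i =
      if i + a < n ∧ src i = i then
        (if b ≤ i + a then noisyRate p (L i) (L' (src' (i + a - b))) else cleanRate p (L i))
      else 0 := by
  unfold bitRate gain
  simp only [stdUser]
  split_ifs <;> simp_all [obsGain, noisyRate, cleanRate, pairProb]

theorem clearUser_bitRate {L L' : ℕ → ℝ × ℝ} {k k' : ℕ} {c : ZMod 2} {U : LevelUser}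
    (hU : U.prob = pairProb L') {i : ℕ} (hi : i + a < n) :
    bitRate p (clearUser n a b L k k' c) U i =
      if i + a = k + b then cleanRate p (L i)
      else if i + a = k' + b then (1 - p) * Hb (L i).1
      else if b ≤ i + a then noisyRate p (L i) (L' (i + a - b)) else cleanRate p (L i) := by
  have hd : i + a ≠ k' + b → b ≤ i + a → dupSrc k k' (i + a - b) = i + a - b := by
    intro h1 h2
    unfold dupSrc
    rw [if_neg (by omega)]
  unfold bitRate gain
  simp only [clearUser, stdUser]
  split_ifs <;> simp_all [obsGain, noisyRate, cleanRate, pairProb]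

theorem clearUser_bitRate_of_le {L : ℕ → ℝ × ℝ} {k k' : ℕ} {c : ZMod 2} {U : LevelUser}
    {i : ℕ} (hi : ¬ i + a < n) (hk : k + b < n) :
    bitRate p (clearUser n a b L k k' c) U i = 0 := by
  have h1 : i + a ≠ k + b := by omega
  unfold bitRate gain
  simp only [clearUser, stdUser]
  simp [hi, h1, obsGain]

end LevelUser

/-! ### Rate pairs of independent and of repeated signalling -/

open LevelUser

namespace ChainDom

variable {p : ℝ} {m : ℕ} {L L' : ℕ → ℝ × ℝ}

/-- Independent bits, interference one level below the own signal. -/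
theorem indep_weak (hL : ∀ i, UnitPair (L i)) (hL' : ∀ i, UnitPair (L' i)) :
    ChainDom p (m + 1) 0 1
      (cleanRate p (L 0) + ∑ i ∈ Finset.range m, noisyRate p (L (i + 1)) (L' i),
       cleanRate p (L' 0) + ∑ i ∈ Finset.range m, noisyRate p (L' (i + 1)) (L i)) := by
  have h : ∀ L L' : ℕ → ℝ × ℝ, colRate p (m + 1) (stdUser (m + 1) 0 1 L id id)
      (stdUser (m + 1) 0 1 L' id id)
      = cleanRate p (L 0) + ∑ i ∈ Finset.range m, noisyRate p (L (i + 1)) (L' i) := by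
    intro L L'
    unfold colRate
    rw [Finset.sum_range_succ', add_comm (cleanRate p (L 0))]
    refine congrArg₂ (· + ·) (Finset.sum_congr rfl fun i hi => ?_) ?_
    · have := Finset.mem_range.1 hi
      rw [stdUser_bitRate (L' := L') rfl]
      simp [this]
    · rw [stdUser_bitRate (L' := L') rfl]
      simp
  have := of_users (p := p) (stdUser_valid (n := m + 1) (a := 0) (b := 1) hL id (src' := id)
    (V := stdUser (m + 1) 0 1 L' id id) (fun _ h => h) fun _ _ _ => rfl)
    (stdUser_valid hL' id (fun _ h => h) fun _ _ _ => rfl)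
  rwa [h, h] at this

/-- Independent bits, interference one level above the own signal. -/
theorem indep_strong (hL : ∀ i, UnitPair (L i)) (hL' : ∀ i, UnitPair (L' i)) :
    ChainDom p (m + 1) 1 0
      (∑ i ∈ Finset.range m, noisyRate p (L i) (L' (i + 1)),
       ∑ i ∈ Finset.range m, noisyRate p (L' i) (L (i + 1))) := by
  have h : ∀ L L' : ℕ → ℝ × ℝ, colRate p (m + 1) (stdUser (m + 1) 1 0 L id id)
      (stdUser (m + 1) 1 0 L' id id)
      = ∑ i ∈ Finset.range m, noisyRate p (L i) (L' (i + 1)) := by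
    intro L L'
    unfold colRate
    rw [Finset.sum_range_succ, stdUser_bitRate (L' := L') rfl, if_neg (by omega), add_zero]
    refine Finset.sum_congr rfl fun i hi => ?_
    have := Finset.mem_range.1 hi
    rw [stdUser_bitRate (L' := L') rfl]
    simp [this]
  have := of_users (p := p) (stdUser_valid (n := m + 1) (a := 1) (b := 0) hL id (src' := id)
    (V := stdUser (m + 1) 1 0 L' id id) (fun _ h => h) fun _ _ _ => rfl)
    (stdUser_valid hL' id (fun _ h => h) fun _ _ _ => rfl)
  rwa [h, h] at this

/-- Independent bits, interference at the same level as the own signal. -/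
theorem indep_equal (hL : ∀ i, UnitPair (L i)) (hL' : ∀ i, UnitPair (L' i)) :
    ChainDom p m 0 0
      (∑ i ∈ Finset.range m, noisyRate p (L i) (L' i),
       ∑ i ∈ Finset.range m, noisyRate p (L' i) (L i)) := by
  have h : ∀ L L' : ℕ → ℝ × ℝ, colRate p m (stdUser m 0 0 L id id)
      (stdUser m 0 0 L' id id) = ∑ i ∈ Finset.range m, noisyRate p (L i) (L' i) := by
    intro L L'
    unfold colRate
    refine Finset.sum_congr rfl fun i hi => ?_
    have := Finset.mem_range.1 hi
    rw [stdUser_bitRate (L' := L') rfl]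
    simp [this]
  have := of_users (p := p) (stdUser_valid (n := m) (a := 0) (b := 0) hL id (src' := id)
    (V := stdUser m 0 0 L' id id) (fun _ h => h) fun _ _ _ => rfl)
    (stdUser_valid hL' id (fun _ h => h) fun _ _ _ => rfl)
  rwa [h, h] at this

theorem dupSrc_eq_self {k k' i : ℕ} (hk : k ≠ k') : dupSrc k k' i = i ↔ i ≠ k' := by
  unfold dupSrc
  split_ifs with h
  · subst h; simpa using hk
  · simpa using h

/-- User 1 repeats bit `k` on level `k'`, and user 2 uses the repetition to remove interference;
interference one level below the own signal. -/
theorem dup_weak (hL : ∀ i, UnitPair (L i)) (hL' : ∀ i, UnitPair (L' i)) {k k' : ℕ} (hk : k < m)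
    (hk' : k' + 1 < m) (hne : k ≠ k' + 1) (hc : (L' (k' + 2)).2 = 0) :
    ChainDom p (m + 1) 0 1
      (cleanRate p (L 0) + ∑ i ∈ Finset.range m,
        (if i = k' then 0 else noisyRate p (L (i + 1)) (L' i)),
       cleanRate p (L' 0) + ∑ i ∈ Finset.range m,
        (if i = k then cleanRate p (L' (i + 1))
         else if i = k' + 1 then (1 - p) * Hb (L' (i + 1)).1
         else noisyRate p (L' (i + 1)) (L i))) := by
  -- The copy on level `k' + 1` arrives in row `k' + 2`, where the second user sends the constant
  -- zero under interference by `hc`; hence the constant `0` in `clearUser`.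
  have h := of_users (p := p) (stdUser_valid (n := m + 1) (a := 0) (b := 1) hL (dupSrc k (k' + 1))
    (src' := id) (V := clearUser (m + 1) 0 1 L' k (k' + 1) 0) (fun _ h => h) fun _ _ _ => rfl)
    (clearUser_valid hL' (by omega) (by omega) (fun _ x hx => by
      rw [show k' + 1 + 1 - 0 = k' + 2 by omega, hc] at hx
      unfold bern at hx
      rcases zmod_two_cases x with rfl | rfl
      · rfl
      · simp at hx) (fun _ => rfl) fun _ _ _ => rfl)
  have e1 : colRate p (m + 1) (stdUser (m + 1) 0 1 L (dupSrc k (k' + 1)) id)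
      (clearUser (m + 1) 0 1 L' k (k' + 1) 0) = cleanRate p (L 0) + ∑ i ∈ Finset.range m,
        (if i = k' then 0 else noisyRate p (L (i + 1)) (L' i)) := by
    unfold colRate
    rw [Finset.sum_range_succ', add_comm (cleanRate p (L 0))]
    refine congrArg₂ (· + ·) (Finset.sum_congr rfl fun i hi => ?_) ?_
    · have := Finset.mem_range.1 hi
      rw [stdUser_bitRate (L' := L') rfl]
      by_cases h : i = k' <;> simp [this, h, dupSrc_eq_self hne]
    · rw [stdUser_bitRate (L' := L') rfl]
      simp [dupSrc_eq_self hne]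
  have e2 : colRate p (m + 1) (clearUser (m + 1) 0 1 L' k (k' + 1) 0)
      (stdUser (m + 1) 0 1 L (dupSrc k (k' + 1)) id)
      = cleanRate p (L' 0) + ∑ i ∈ Finset.range m,
        (if i = k then cleanRate p (L' (i + 1))
         else if i = k' + 1 then (1 - p) * Hb (L' (i + 1)).1
         else noisyRate p (L' (i + 1)) (L i)) := by
    unfold colRate
    rw [Finset.sum_range_succ', add_comm (cleanRate p (L' 0))]
    refine congrArg₂ (· + ·) (Finset.sum_congr rfl fun i hi => ?_) ?_
    · have := Finset.mem_range.1 hi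
      rw [clearUser_bitRate (L' := L) rfl (by omega)]
      simp
    · rw [clearUser_bitRate (L' := L) rfl (by omega)]
      simp
  rwa [e1, e2] at h

/-- User 1 repeats bit `k` on level `k'`, and user 2 uses the repetition to remove interference;
interference one level above the own signal. -/
theorem dup_strong (hL : ∀ i, UnitPair (L i)) (hL' : ∀ i, UnitPair (L' i)) {k k' : ℕ}
    (hk : k + 1 < m + 1) (hk' : k' ≤ m) (hne : k + 1 ≠ k') {c : ZMod 2}
    (hc : 1 ≤ k' → ∀ x, bern (L' (k' - 1)).2 x ≠ 0 → x = c) (hc' : k' = 0 → c = 0) :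
    ChainDom p (m + 1) 1 0
      (∑ i ∈ Finset.range m, (if i = k' then 0 else noisyRate p (L i) (L' (i + 1))),
       ∑ i ∈ Finset.range m,
        (if i = k then cleanRate p (L' i)
         else if i + 1 = k' then (1 - p) * Hb (L' i).1
         else noisyRate p (L' i) (L (i + 1)))) := by
  -- Here the interference is unshifted, so row `k'` receives the copy on level `k'`. The own signal
  -- there is level `k' - 1`, or nothing when `k' = 0`.
  have h := of_users (p := p) (stdUser_valid (n := m + 1) (a := 1) (b := 0) hL (dupSrc (k + 1) k')
    (src' := id) (V := clearUser (m + 1) 1 0 L' (k + 1) k' c) (fun _ h => h) fun _ _ _ => rfl)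
    (clearUser_valid hL' (by omega) (by omega) (fun h => hc (by omega))
      (fun h => hc' (by omega)) fun _ _ _ => rfl)
  have e1 : colRate p (m + 1) (stdUser (m + 1) 1 0 L (dupSrc (k + 1) k') id)
      (clearUser (m + 1) 1 0 L' (k + 1) k' c) = ∑ i ∈ Finset.range m,
        (if i = k' then 0 else noisyRate p (L i) (L' (i + 1))) := by
    unfold colRate
    rw [Finset.sum_range_succ, stdUser_bitRate (L' := L') rfl, if_neg (by omega), add_zero]
    refine Finset.sum_congr rfl fun i hi => ?_
    have := Finset.mem_range.1 hi
    rw [stdUser_bitRate (L' := L') rfl]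
    by_cases h : i = k' <;> simp [this, h, dupSrc_eq_self hne]
  have e2 : colRate p (m + 1) (clearUser (m + 1) 1 0 L' (k + 1) k' c)
      (stdUser (m + 1) 1 0 L (dupSrc (k + 1) k') id)
      = ∑ i ∈ Finset.range m,
        (if i = k then cleanRate p (L' i)
         else if i + 1 = k' then (1 - p) * Hb (L' i).1
         else noisyRate p (L' i) (L (i + 1))) := by
    unfold colRate
    rw [Finset.sum_range_succ, clearUser_bitRate_of_le (by omega) (by omega), add_zero]
    refine Finset.sum_congr rfl fun i hi => ?_
    have := Finset.mem_range.1 hi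
    rw [clearUser_bitRate (L' := L) rfl (by omega)]
    simp
  rwa [e1, e2] at h

end ChainDom

end BurstyIC

namespace BurstyIC

open LevelUser

/-! ### Domination of correlated interference by repetition -/

theorem star_assoc (x y z : ℝ) : star (star x y) z = star x (star y z) := by
  unfold star; ring

/-- By associativity, the inclusion-exclusion bound applies with `star y z` as the second variable;
the result is affine in `Hb x`. -/
theorem Hsum_star_le {x y z : ℝ} (hx : x ∈ Set.Icc (0 : ℝ) 1) (hy : y ∈ Set.Icc (0 : ℝ) 1)
    (hz : z ∈ Set.Icc (0 : ℝ) 1) :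
    Hsum (star x y) z ≤ Hb x + Hsum y z - Hb x * Hsum y z := by
  have h := Hsum_le hx (star_mem hy hz)
  have e : Hsum (star x y) z = Hsum x (y * (1 - z) + (1 - y) * z) :=
    congrArg Hb (star_assoc x y z)
  rw [e]
  exact h

theorem Hsum_sub_Hb_le {x y : ℝ} (hx : x ∈ Set.Icc (0 : ℝ) 1) (hy : y ∈ Set.Icc (0 : ℝ) 1) :
    Hsum x y - Hb y ≤ Hb x * (1 - Hb y) := by
  linarith [Hsum_le hx hy]

/-- Rate of three special levels. -/
noncomputable def coreRate (p p1 p2 q1 q2 e' g' gt : ℝ) : ℝ :=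
  (1 - p) * (1 + Hb e' + Hb p1) + p * (1 - Hb gt + Hsum (star e' gt) (mix p q1 q2)
    - Hb (mix p q1 q2) + Hsum p2 g' - Hb g')

/-- Write the weights as `l₁` times (1, 1) plus the excess of `l₂`. It suffices to compare the sum
of the rates and the favoured user alone, and all comparisons below are reduced to these two. -/
theorem weighted_le {l₁ l₂ d₁ d₂ : ℝ} (h₁ : 0 ≤ l₁) (h : l₁ ≤ l₂) (hd : d₂ ≤ 0)
    (hs : d₁ + d₂ ≤ 0) : l₁ * d₁ + l₂ * d₂ ≤ 0 := by
  have h1 := mul_nonneg h₁ (neg_nonneg.2 hs)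
  have h2 := mul_nonneg (sub_nonneg.2 h) (neg_nonneg.2 hd)
  linarith

section

variable {p p1 p2 q1 q2 e' g' et gt : ℝ}

theorem Icc_half_subset {x : ℝ} (h : x ∈ Set.Icc (0 : ℝ) (1 / 2)) : x ∈ Set.Icc (0 : ℝ) 1 :=
  ⟨h.1, h.2.trans (by norm_num)⟩

theorem Hb_scale_le (hp : p ∈ Set.Icc (0 : ℝ) 1) (h1 : p1 ∈ Set.Icc (0 : ℝ) (1 / 2))
    (h2 : p2 ∈ Set.Icc (0 : ℝ) (1 / 2)) : Hb ((1 - p) * p1) ≤ Hb (mix p p1 p2) := by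
  refine Hb_mono (mul_nonneg (sub_nonneg.2 hp.2) h1.1) ?_ (mix_mem hp h1 h2).2
  unfold mix
  linarith [mul_nonneg hp.1 h2.1]

theorem Hb_scale_nonneg (hp : p ∈ Set.Icc (0 : ℝ) 1) (h1 : p1 ∈ Set.Icc (0 : ℝ) (1 / 2)) :
    0 ≤ Hb ((1 - p) * p1) :=
  Hb_nonneg (mul_nonneg (sub_nonneg.2 hp.2) h1.1) (by
    nlinarith [mul_nonneg hp.1 h1.1, h1.2])

/-- The slots are dominated by repetition with the smaller parameter. -/
theorem slot_le (hp : p ∈ Set.Icc (0 : ℝ) 1)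
    (hp1 : p1 ∈ Set.Icc (0 : ℝ) (1 / 2)) (hp2 : p2 ∈ Set.Icc (0 : ℝ) (1 / 2))
    (hq1 : q1 ∈ Set.Icc (0 : ℝ) (1 / 2)) (hq2 : q2 ∈ Set.Icc (0 : ℝ) (1 / 2))
    {l₁ l₂ : ℝ} (h₁ : 0 ≤ l₁) (h : l₁ ≤ l₂) :
    ∃ t ∈ Set.Icc (0 : ℝ) (1 / 2), l₁ * noisyRate p (p1, p2) (q1, q2)
        + l₂ * noisyRate p (q1, q2) (p1, p2)
      ≤ l₂ + (l₁ * ((1 - p) * Hb t) - l₂ * (p * Hb ((1 - p) * t))) := by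
  have hs2 := Hb_le_Hsum (Icc_half_subset hp2) (Icc_half_subset (mix_mem hp hq1 hq2))
  have hs1 := Hb_le_Hsum (Icc_half_subset hq2) (Icc_half_subset (mix_mem hp hp1 hp2))
  have hm2 := mul_nonneg hp.1 (sub_nonneg.2 hs2)
  have hm1 := mul_nonneg hp.1 (sub_nonneg.2 hs1)
  unfold noisyRate
  dsimp only
  rcases le_total p1 q1 with hpq | hpq
  · refine ⟨p1, hp1, ?_⟩
    -- In the comparison scheme the favoured user sends a fair bit and the other a bit with
    -- parameters `(p1, 0)`. The bound says that this has the better sum rate, apart from the first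
    -- user's unchanged information in the interference-free state.
    have hs := sum_rate_level_le hp hp1 hp2 hq1 hq2 hpq
    have := weighted_le h₁ h
      (d₁ := p * (Hsum p2 (mix p q1 q2) - Hb (mix p q1 q2)))
      (d₂ := (1 - p) * Hb q1 + p * (Hsum q2 (mix p p1 p2) - Hb (mix p p1 p2))
        - 1 + p * Hb ((1 - p) * p1)) (by linarith) (by linarith)
    linarith
  · refine ⟨q1, hq1, ?_⟩
    have hs := sum_rate_level_le hp hq1 hq2 hp1 hp2 hpq
    have hmono := mul_nonneg (sub_nonneg.2 hp.2)
      (sub_nonneg.2 (Hb_mono hq1.1 hpq hp1.2))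
    have := weighted_le h₁ h
      (d₁ := (1 - p) * (Hb p1 - Hb q1) + p * (Hsum p2 (mix p q1 q2) - Hb (mix p q1 q2)))
      (d₂ := (1 - p) * Hb q1 + p * (Hsum q2 (mix p p1 p2) - Hb (mix p p1 p2))
        - 1 + p * Hb ((1 - p) * q1)) (by linarith) (by linarith)
    linarith

/-- Bilinear upper bound on `coreRate`. -/
theorem coreRate_le (hp : p ∈ Set.Icc (0 : ℝ) 1) (hp2 : p2 ∈ Set.Icc (0 : ℝ) (1 / 2))
    (hq1 : q1 ∈ Set.Icc (0 : ℝ) (1 / 2)) (hq2 : q2 ∈ Set.Icc (0 : ℝ) (1 / 2))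
    (he' : e' ∈ Set.Icc (0 : ℝ) 1) (hg' : g' ∈ Set.Icc (0 : ℝ) 1) (hgt : gt ∈ Set.Icc (0 : ℝ) 1) :
    coreRate p p1 p2 q1 q2 e' g' gt ≤ (1 - p) * (1 + Hb e' + Hb p1) + p * (1 - Hb gt
      + (Hb e' + Hsum gt (mix p q1 q2) - Hb e' * Hsum gt (mix p q1 q2))
      - Hb (mix p q1 q2) + Hb p2 * (1 - Hb g')) := by
  have h1 := Hsum_star_le he' hgt (Icc_half_subset (mix_mem hp hq1 hq2))
  have h2 := Hsum_sub_Hb_le (Icc_half_subset hp2) hg'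
  have := mul_le_mul_of_nonneg_left (add_le_add h1 h2) hp.1
  unfold coreRate
  linarith

/-- In a direction favouring user 2, the core levels are dominated by independent bits or by
repetition. -/
theorem core_le (hp : p ∈ Set.Icc (0 : ℝ) 1)
    (hp1 : p1 ∈ Set.Icc (0 : ℝ) (1 / 2)) (hp2 : p2 ∈ Set.Icc (0 : ℝ) (1 / 2))
    (hq1 : q1 ∈ Set.Icc (0 : ℝ) (1 / 2)) (hq2 : q2 ∈ Set.Icc (0 : ℝ) (1 / 2))
    (he' : e' ∈ Set.Icc (0 : ℝ) 1) (hg' : g' ∈ Set.Icc (0 : ℝ) 1)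
    (het : et ∈ Set.Icc (0 : ℝ) 1) (hgt : gt ∈ Set.Icc (0 : ℝ) 1)
    {l₁ l₂ : ℝ} (h₁ : 0 ≤ l₁) (h : l₁ ≤ l₂) :
    (l₁ * coreRate p p1 p2 q1 q2 e' g' gt + l₂ * coreRate p q1 q2 p1 p2 g' e' et
      ≤ l₁ * coreRate p p1 p2 q1 q2 (1 / 2) (1 / 2) gt
        + l₂ * coreRate p q1 q2 p1 p2 (1 / 2) (1 / 2) et) ∨
    ∃ t ∈ Set.Icc (0 : ℝ) (1 / 2),
      l₁ * coreRate p p1 p2 q1 q2 e' g' gt + l₂ * coreRate p q1 q2 p1 p2 g' e' et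
      ≤ l₁ * (1 - p * Hb gt) + l₂ * (3 - p * Hb et)
        + (l₁ * ((1 - p) * Hb t) - l₂ * (p * Hb ((1 - p) * t))) := by
  have h₂ : 0 ≤ l₂ := h₁.trans h
  obtain ⟨hp0, hpl⟩ := id hp
  have hr : 0 ≤ 1 - p := sub_nonneg.2 hpl
  have c1 := mul_le_mul_of_nonneg_left
    (coreRate_le (p1 := p1) hp hp2 hq1 hq2 he' hg' hgt) h₁
  have c2 := mul_le_mul_of_nonneg_left
    (coreRate_le (p1 := q1) hp hq2 hp1 hp2 hg' he' het) h₂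
  have m1 := mix_Hb_le hp (Icc_half_subset hp1) (Icc_half_subset hp2)
  have m2 := mix_Hb_le hp (Icc_half_subset hq1) (Icc_half_subset hq2)
  have n1 := Hb_scale_le hp hp1 hp2
  have n2 := Hb_scale_le hp hq1 hq2
  have n2' := Hb_scale_nonneg hp hq1
  have n1' := Hb_scale_nonneg hp hp1
  have hL1 := Hb_le_one (mix p p1 p2)
  have hL2 := Hb_le_one (mix p q1 q2)
  have hH1 : Hsum et (mix p p1 p2) ≤ 1 := Hsum_le_one _ _
  have hH2 : Hsum gt (mix p q1 q2) ≤ 1 := Hsum_le_one _ _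
  have a1 := Hb_le_one p1
  have a2 := Hb_le_one q1
  have e0 := Hb_nonneg he'.1 he'.2
  have e1 := Hb_le_one e'
  have g0 := Hb_nonneg hg'.1 hg'.2
  have g1 := Hb_le_one g'
  have base : ∀ p1 p2 q1 q2 gt, coreRate p p1 p2 q1 q2 (1 / 2) (1 / 2) gt
      = (1 - p) * (2 + Hb p1) + p * (2 - Hb gt - Hb (mix p q1 q2)) := by
    intro p1 p2 q1 q2 gt
    unfold coreRate
    rw [show star (1 / 2) gt = 1 / 2 by unfold star; ring]
    simp only [Hsum_half, Hsum_half', Hb_half]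
    ring
  rw [base, base]
  generalize coreRate p p1 p2 q1 q2 e' g' gt = R1 at *
  generalize coreRate p q1 q2 p1 p2 g' e' et = R2 at *
  clear base
  have z1 : Hb ((1 - p) * 0) = 0 := by simp
  have pn1 := mul_le_mul_of_nonneg_left n1 hp0
  have pn2 := mul_le_mul_of_nonneg_left n2 hp0
  have pH1 := mul_le_mul_of_nonneg_left hH1 hp0
  have pH2 := mul_le_mul_of_nonneg_left hH2 hp0
  have rL1 := mul_le_mul_of_nonneg_left hL1 hr
  have rL2 := mul_le_mul_of_nonneg_left hL2 hr
  have pL1 := mul_le_mul_of_nonneg_left hL1 hp0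
  have pL2 := mul_le_mul_of_nonneg_left hL2 hp0
  have ra1 := mul_le_mul_of_nonneg_left a1 hr
  have ra2 := mul_le_mul_of_nonneg_left a2 hr
  have pL1' := mul_nonneg hp0 (n1'.trans n1)
  have pL2' := mul_nonneg hp0 (n2'.trans n2)
  have ez : Hb 0 = 0 := Hb_zero
  generalize Hb e' = e at *
  generalize Hb g' = g at *
  obtain ⟨N1, hN1⟩ : ∃ N, N = Hb ((1 - p) * p1) := ⟨_, rfl⟩
  obtain ⟨N2, hN2⟩ : ∃ N, N = Hb ((1 - p) * q1) := ⟨_, rfl⟩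
  rw [← hN1] at n1 n1' pn1
  rw [← hN2] at n2 n2' pn2
  generalize Hb (mix p p1 p2) = L1 at *
  generalize Hb (mix p q1 q2) = L2 at *
  generalize Hsum et (mix p p1 p2) = H1 at *
  generalize Hsum gt (mix p q1 q2) = H2 at *
  generalize Hb gt = X2 at *
  generalize Hb et = X1 at *
  -- `B` and `C` are the slopes of the weighted upper bound in `e` and `g`; there is no mixed term,
  -- so their signs decide where it is largest.
  obtain ⟨B, hB⟩ : ∃ B, B = l₁ * ((1 - p) + p * (1 - H2)) - l₂ * (p * Hb q2) := ⟨_, rfl⟩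
  obtain ⟨C, hC⟩ : ∃ C, C = l₂ * ((1 - p) + p * (1 - H1)) - l₁ * (p * Hb p2) := ⟨_, rfl⟩
  have hR : l₁ * R1 + l₂ * R2
      ≤ l₁ * ((1 - p) * (1 + Hb p1) + p * (1 - X2 + H2 - L2 + Hb p2))
        + l₂ * ((1 - p) * (1 + Hb q1) + p * (1 - X1 + H1 - L1 + Hb q2)) + B * e + C * g := by
    subst hB hC
    linarith
  rcases le_total 0 B with hB0 | hB0 <;> rcases le_total 0 C with hC0 | hC0
  -- At `e = g = 1` the upper bound is exact and equals the rates with parameters `1 / 2`.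
  · left
    have := mul_le_mul_of_nonneg_left e1 hB0
    have := mul_le_mul_of_nonneg_left g1 hC0
    subst hB hC
    linarith
  -- The corner `e = 1`, `g = 0` is matched by repetition with parameter `q1`; in the next case `e =
  -- 0`, `g = 1` is matched with `p1`, and in the last one `e = g = 0` with parameter zero.
  · right
    refine ⟨q1, hq1, ?_⟩
    have := mul_le_mul_of_nonneg_left e1 hB0
    have := mul_nonpos_of_nonpos_of_nonneg hC0 g0
    have := weighted_le h₁ h (d₁ := 1 + (1 - p) * Hb p1 + p * Hb p2 - p * L2 - (1 - p) * Hb q1)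
      (d₂ := -2 + (1 - p) * Hb q1 + p * (H1 - L1 + N2)) (by linarith) (by linarith)
    rw [← hN2]
    subst hB
    linarith
  · right
    refine ⟨p1, hp1, ?_⟩
    have := mul_nonpos_of_nonpos_of_nonneg hB0 e0
    have := mul_le_mul_of_nonneg_left g1 hC0
    have := weighted_le h₁ h (d₁ := p * (H2 - L2))
      (d₂ := -1 + (1 - p) * Hb q1 + p * (Hb q2 - L1 + N1)) (by linarith) (by linarith)
    rw [← hN1]
    subst hC
    linarith
  · right
    refine ⟨0, ⟨le_rfl, by norm_num⟩, ?_⟩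
    have := mul_nonpos_of_nonpos_of_nonneg hB0 e0
    have := mul_nonpos_of_nonpos_of_nonneg hC0 g0
    have := weighted_le h₁ h (d₁ := (1 - p) * Hb p1 + p * (H2 - L2 + Hb p2))
      (d₂ := -2 + (1 - p) * Hb q1 + p * (H1 - L1 + Hb q2)) (by linarith) (by linarith)
    rw [z1, ez]
    linarith

/-- In a direction favouring user 2, core levels and `k` slots are dominated by independent bits
or by repetition. -/
theorem core_add_slots_le (hp : p ∈ Set.Icc (0 : ℝ) 1)
    (hp1 : p1 ∈ Set.Icc (0 : ℝ) (1 / 2)) (hp2 : p2 ∈ Set.Icc (0 : ℝ) (1 / 2))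
    (hq1 : q1 ∈ Set.Icc (0 : ℝ) (1 / 2)) (hq2 : q2 ∈ Set.Icc (0 : ℝ) (1 / 2))
    (he' : e' ∈ Set.Icc (0 : ℝ) 1) (hg' : g' ∈ Set.Icc (0 : ℝ) 1)
    (het : et ∈ Set.Icc (0 : ℝ) 1) (hgt : gt ∈ Set.Icc (0 : ℝ) 1)
    {l₁ l₂ : ℝ} (h₁ : 0 ≤ l₁) (h : l₁ ≤ l₂) (k : ℕ) :
    (l₁ * coreRate p p1 p2 q1 q2 e' g' gt + l₂ * coreRate p q1 q2 p1 p2 g' e' et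
      ≤ l₁ * coreRate p p1 p2 q1 q2 (1 / 2) (1 / 2) gt
        + l₂ * coreRate p q1 q2 p1 p2 (1 / 2) (1 / 2) et) ∨
    ∃ t ∈ Set.Icc (0 : ℝ) (1 / 2),
      l₁ * (coreRate p p1 p2 q1 q2 e' g' gt + k * noisyRate p (p1, p2) (q1, q2))
        + l₂ * (coreRate p q1 q2 p1 p2 g' e' et + k * noisyRate p (q1, q2) (p1, p2))
      ≤ l₁ * (1 - p * Hb gt + (k + 1) * ((1 - p) * Hb t))
        + l₂ * (2 - p * Hb et + (k + 1) * (1 - p * Hb ((1 - p) * t))) := by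
  refine (core_le hp hp1 hp2 hq1 hq2 he' hg' het hgt h₁ h).imp_right ?_
  rintro ⟨t, ht, hct⟩
  obtain ⟨t', ht', hst⟩ := slot_le hp hp1 hp2 hq1 hq2 h₁ h
  have hs := mul_le_mul_of_nonneg_left hst (Nat.cast_nonneg (α := ℝ) k)
  obtain ⟨f, hf⟩ : ∃ f : ℝ → ℝ, f = fun t => l₁ * ((1 - p) * Hb t) - l₂ * (p * Hb ((1 - p) * t)) :=
    ⟨_, rfl⟩
  have hft : ∀ t, l₁ * ((1 - p) * Hb t) - l₂ * (p * Hb ((1 - p) * t)) = f t := fun t => by rw [hf]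
  rw [hft] at hct hs
  -- Core and slots suggest different parameters, but the repetition scheme uses one. Both enter
  -- through the same function `f`, so whichever parameter has the larger value serves all `k + 1`
  -- levels.
  rcases le_total (f t) (f t') with hle | hle
  · refine ⟨t', ht', ?_⟩
    have e := hft t'
    have ek : (k : ℝ) * (l₁ * ((1 - p) * Hb t') - l₂ * (p * Hb ((1 - p) * t'))) = k * f t' := by
      rw [e]
    linarith
  · refine ⟨t, ht, ?_⟩
    have e := hft t
    have ek : (k : ℝ) * (l₁ * ((1 - p) * Hb t) - l₂ * (p * Hb ((1 - p) * t))) = k * f t := by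
      rw [e]
    have := mul_le_mul_of_nonneg_left hle (Nat.cast_nonneg (α := ℝ) k)
    linarith

end

namespace ChainDom

variable {p p1 p2 q1 q2 e' g' et gt : ℝ} {n a b : ℕ}

/-- Domination of core levels and `k` slots. -/
theorem core (hp : p ∈ Set.Icc (0 : ℝ) 1)
    (hp1 : p1 ∈ Set.Icc (0 : ℝ) (1 / 2)) (hp2 : p2 ∈ Set.Icc (0 : ℝ) (1 / 2))
    (hq1 : q1 ∈ Set.Icc (0 : ℝ) (1 / 2)) (hq2 : q2 ∈ Set.Icc (0 : ℝ) (1 / 2))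
    (he' : e' ∈ Set.Icc (0 : ℝ) 1) (hg' : g' ∈ Set.Icc (0 : ℝ) 1)
    (het : et ∈ Set.Icc (0 : ℝ) 1) (hgt : gt ∈ Set.Icc (0 : ℝ) 1) {c₁ c₂ : ℝ} (k : ℕ)
    (hbase : ChainDom p n a b
      (c₁ + (coreRate p p1 p2 q1 q2 (1 / 2) (1 / 2) gt + k * noisyRate p (p1, p2) (q1, q2)),
       c₂ + (coreRate p q1 q2 p1 p2 (1 / 2) (1 / 2) et + k * noisyRate p (q1, q2) (p1, p2))))
    (hdup₁ : ∀ t ∈ Set.Icc (0 : ℝ) (1 / 2), ChainDom p n a b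
      (c₁ + (1 - p * Hb gt + (k + 1) * ((1 - p) * Hb t)),
       c₂ + (2 - p * Hb et + (k + 1) * (1 - p * Hb ((1 - p) * t)))))
    (hdup₂ : ∀ t ∈ Set.Icc (0 : ℝ) (1 / 2), ChainDom p n a b
      (c₂ + (1 - p * Hb et + (k + 1) * ((1 - p) * Hb t)),
       c₁ + (2 - p * Hb gt + (k + 1) * (1 - p * Hb ((1 - p) * t))))) :
    ChainDom p n a b
      (c₁ + (coreRate p p1 p2 q1 q2 e' g' gt + k * noisyRate p (p1, p2) (q1, q2)),
       c₂ + (coreRate p q1 q2 p1 p2 g' e' et + k * noisyRate p (q1, q2) (p1, p2))) := by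
  refine of_forall fun l₁ l₂ h₁ h₂ => ?_
  rcases le_total l₁ l₂ with h | h
  · rcases core_add_slots_le hp hp1 hp2 hq1 hq2 he' hg' het hgt h₁ h k with hle | ⟨t, ht, hle⟩
    · exact ⟨_, hbase, by dsimp only; linarith⟩
    · exact ⟨_, hdup₁ t ht, by dsimp only; linarith⟩
  · rcases core_add_slots_le hp hq1 hq2 hp1 hp2 hg' he' hgt het h₂ h k with hle | ⟨t, ht, hle⟩
    · exact ⟨_, hbase, by dsimp only; linarith⟩
    · exact ⟨_, (hdup₂ t ht).swap, by dsimp only; linarith⟩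

/-- Domination of two core levels without slots. -/
theorem core_two (hp : p ∈ Set.Icc (0 : ℝ) 1)
    (hq1 : q1 ∈ Set.Icc (0 : ℝ) (1 / 2)) (hq2 : q2 ∈ Set.Icc (0 : ℝ) (1 / 2))
    (he' : e' ∈ Set.Icc (0 : ℝ) 1) (hgt : gt ∈ Set.Icc (0 : ℝ) 1) {c₁ c₂ : ℝ}
    (hbase : ChainDom p n a b
      (c₁ + ((1 - p) * 2 + p * (2 - Hb gt - Hb (mix p q1 q2))),
       c₂ + (2 * (1 - p) * Hb q1 + p * (Hsum q2 et - Hb et))))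
    (hdup₁ : ChainDom p n a b (c₁ + (1 - p * Hb gt), c₂ + (2 - p * Hb et)))
    (hdup₂ : ChainDom p n a b (c₂ + (1 - p * Hb et), c₁ + (2 - p * Hb gt))) :
    ChainDom p n a b
      (c₁ + ((1 - p) * (1 + Hb e') + p * (1 - Hb gt + Hsum (star e' gt) (mix p q1 q2)
          - Hb (mix p q1 q2))),
       c₂ + (2 * (1 - p) * Hb q1 + p * (Hsum q2 et - Hb et + Hsum q2 e' - Hb e'))) := by
  refine of_forall fun l₁ l₂ h₁ h₂ => ?_
  obtain ⟨hp0, hpl⟩ := id hp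
  have hr : 0 ≤ 1 - p := sub_nonneg.2 hpl
  have s1 := mul_le_mul_of_nonneg_left (mul_le_mul_of_nonneg_left
    (Hsum_star_le he' hgt (Icc_half_subset (mix_mem hp hq1 hq2))) hp0) h₁
  have s2 := mul_le_mul_of_nonneg_left (mul_le_mul_of_nonneg_left
    (Hsum_sub_Hb_le (Icc_half_subset hq2) he') hp0) h₂
  have m2 := mix_Hb_le hp (Icc_half_subset hq1) (Icc_half_subset hq2)
  have L2 := Hb_le_one (mix p q1 q2)
  have H2 := mul_le_mul_of_nonneg_left (Hsum_le_one gt (mix p q1 q2)) hp0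
  have H1 := mul_le_mul_of_nonneg_left (Hsum_le_one q2 et) hp0
  have rL2 := mul_le_mul_of_nonneg_left L2 hr
  have ra2 := mul_le_mul_of_nonneg_left (Hb_le_one q1) hr
  have hL2 := mul_nonneg hp0 (Hb_nonneg (Icc_half_subset (mix_mem hp hq1 hq2)).1
    (Icc_half_subset (mix_mem hp hq1 hq2)).2)
  have e0 := Hb_nonneg he'.1 he'.2
  have e1 := Hb_le_one e'
  -- Again the bound is affine in `Hb e'`, now with a single slope: a nonnegative slope leads to
  -- fair bits, a negative one to repetition by the user with the smaller weight.
  obtain ⟨B, hB⟩ : ∃ B, B = l₁ * ((1 - p) + p * (1 - Hsum gt (mix p q1 q2))) - l₂ * (p * Hb q2) :=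
    ⟨_, rfl⟩
  have hR : l₁ * ((1 - p) * (1 + Hb e') + p * (1 - Hb gt + Hsum (star e' gt) (mix p q1 q2)
        - Hb (mix p q1 q2)))
      + l₂ * (2 * (1 - p) * Hb q1 + p * (Hsum q2 et - Hb et + Hsum q2 e' - Hb e'))
      ≤ l₁ * ((1 - p) + p * (1 - Hb gt + Hsum gt (mix p q1 q2) - Hb (mix p q1 q2)))
        + l₂ * (2 * (1 - p) * Hb q1 + p * (Hsum q2 et - Hb et + Hb q2)) + B * Hb e' := by
    subst hB
    linarith
  rcases le_total 0 B with hB0 | hB0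
  · refine ⟨_, hbase, ?_⟩
    have := mul_le_mul_of_nonneg_left e1 hB0
    subst hB
    dsimp only
    linarith
  · have hBe := mul_nonpos_of_nonpos_of_nonneg hB0 e0
    rcases le_total l₁ l₂ with h | h
    · refine ⟨_, hdup₁, ?_⟩
      have := weighted_le h₁ h (d₁ := p * (Hsum gt (mix p q1 q2) - Hb (mix p q1 q2)))
        (d₂ := 2 * (1 - p) * Hb q1 + p * (Hsum q2 et + Hb q2) - 2) (by linarith) (by linarith)
      dsimp only
      linarith
    · refine ⟨_, hdup₂.swap, ?_⟩
      have := weighted_le h₂ h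
        (d₁ := 2 * (1 - p) * Hb q1 + p * (Hsum q2 et + Hb q2) - 1)
        (d₂ := p * (Hsum gt (mix p q1 q2) - Hb (mix p q1 q2)) - 1) (by linarith) (by linarith)
      dsimp only
      linarith

end ChainDom

end BurstyIC

namespace BurstyIC

open LevelUser

/-! ### Rate pairs of particular chains -/

/-- Parameters of a uniform bit. -/
noncomputable def fair : ℝ × ℝ := (1 / 2, 1 / 2)

theorem mix_one (p x : ℝ) : mix p x 1 = p + x * (1 - p) := by unfold mix; ring

theorem mix_zero (p x : ℝ) : mix p x 0 = (1 - p) * x := by unfold mix; ring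

theorem mix_half (p : ℝ) : mix p (1 / 2) (1 / 2) = 1 / 2 := by unfold mix; ring

theorem cleanRate_fair (p : ℝ) : cleanRate p fair = 1 := by
  simp only [cleanRate, fair, Hb_half]; ring

theorem noisyRate_fair_right (p : ℝ) (x : ℝ × ℝ) : noisyRate p x fair = (1 - p) * Hb x.1 := by
  simp only [noisyRate, fair, mix_half, Hsum_half', Hb_half]; ring

theorem noisyRate_fair_left (p : ℝ) (y : ℝ × ℝ) :
    noisyRate p fair y = 1 - p * Hb (mix p y.1 y.2) := by
  simp only [noisyRate, fair, Hsum_half, Hb_half]; ring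

theorem noisyRate_zero_left (p x : ℝ) (y : ℝ × ℝ) : noisyRate p (x, 0) y = (1 - p) * Hb x := by
  simp only [noisyRate, Hsum_zero]; ring

theorem noisyRate_zero_right (p : ℝ) (x : ℝ × ℝ) : noisyRate p x (0, 0) = cleanRate p x := by
  simp only [noisyRate, cleanRate, mix_zero, mul_zero, Hsum_zero', Hb_zero, sub_zero]

theorem unitPair_fair : UnitPair fair := by
  unfold UnitPair fair; norm_num

theorem unitPair_zero : UnitPair (0, 0) := by
  unfold UnitPair; norm_num

theorem unitPair_half {x y : ℝ} (hx : x ∈ Set.Icc (0 : ℝ) (1 / 2))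
    (hy : y ∈ Set.Icc (0 : ℝ) (1 / 2)) : UnitPair (x, y) :=
  ⟨Icc_half_subset hx, Icc_half_subset hy⟩

theorem unitPair_half_zero {x : ℝ} (hx : x ∈ Set.Icc (0 : ℝ) (1 / 2)) : UnitPair (x, 0) :=
  ⟨Icc_half_subset hx, le_rfl, zero_le_one⟩

theorem half_Icc_subset {x : ℝ} (h : x ∈ Set.Icc (1 / 2 : ℝ) 1) : x ∈ Set.Icc (0 : ℝ) 1 :=
  ⟨le_trans (by norm_num) h.1, h.2⟩

theorem unitPair_half_one {x : ℝ} (hx : x ∈ Set.Icc (1 / 2 : ℝ) 1) : UnitPair (x, 1) :=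
  ⟨half_Icc_subset hx, zero_le_one, le_rfl⟩

/-- Level parameters from a list, continued by constant bits. -/
def levels (l : List (ℝ × ℝ)) (i : ℕ) : ℝ × ℝ := l.getD i (0, 0)

theorem unitPair_levels {l : List (ℝ × ℝ)} (h : ∀ x ∈ l, UnitPair x) (i : ℕ) :
    UnitPair (levels l i) := by
  unfold levels
  rw [List.getD_eq_getElem?_getD]
  rcases hi : l[i]? with _ | x
  · exact unitPair_zero
  · exact h x (List.mem_of_getElem? hi)

namespace ChainDom

variable {p x1 x2 xt1 xt2 xh e1 y1 y2 yt1 yt2 yh g1 : ℝ}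

theorem of_eq {n a b : ℕ} {τ τ' : ℝ × ℝ} (h : ChainDom p n a b τ) (h₁ : τ'.1 = τ.1)
    (h₂ : τ'.2 = τ.2) : ChainDom p n a b τ' :=
  h.of_le h₁.le h₂.le

theorem weak_one : ChainDom p 1 0 1 (1, 1) := by
  have hL := unitPair_levels (l := [fair]) (by simp [unitPair_fair])
  refine (indep_weak (p := p) (m := 0) hL hL).of_eq ?_ ?_ <;>
    simp [levels, cleanRate_fair]

theorem weak_two : ChainDom p 2 0 1 (2 - p, 2 - p) := by
  have hL := unitPair_levels (l := [fair, fair]) (by simp [unitPair_fair])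
  refine (indep_weak (p := p) (m := 1) hL hL).of_eq ?_ ?_ <;>
    simp only [levels, Finset.sum_range_one, List.getD_cons_zero, List.getD_cons_succ,
      cleanRate_fair, noisyRate_fair_right] <;> simp only [fair, Hb_half] <;> ring

theorem weak_three (hx1 : x1 ∈ Set.Icc (0 : ℝ) (1 / 2)) (hx2 : x2 ∈ Set.Icc (0 : ℝ) (1 / 2))
    (hy1 : y1 ∈ Set.Icc (0 : ℝ) (1 / 2)) (hy2 : y2 ∈ Set.Icc (0 : ℝ) (1 / 2)) :
    ChainDom p 3 0 1 (1 + (1 - p) * (1 + Hb x1) + p * (1 - Hb (mix p y1 y2)),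
      1 + (1 - p) * (1 + Hb y1) + p * (1 - Hb (mix p x1 x2))) := by
  have hL := unitPair_levels (l := [fair, (x1, x2), fair])
    (by simp [unitPair_fair, unitPair_half hx1 hx2])
  have hL' := unitPair_levels (l := [fair, (y1, y2), fair])
    (by simp [unitPair_fair, unitPair_half hy1 hy2])
  refine (indep_weak (p := p) (m := 2) hL hL').of_eq ?_ ?_ <;>
    simp only [levels, Finset.sum_range_succ, Finset.sum_range_zero, List.getD_cons_zero,
      List.getD_cons_succ, cleanRate_fair, noisyRate_fair_right, noisyRate_fair_left, zero_add] <;>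
    ring

theorem weak_five (hx1 : x1 ∈ Set.Icc (0 : ℝ) (1 / 2)) (hx2 : x2 ∈ Set.Icc (0 : ℝ) (1 / 2))
    (hxh : xh ∈ Set.Icc (0 : ℝ) (1 / 2)) (he1 : e1 ∈ Set.Icc (1 / 2 : ℝ) 1)
    (hy1 : y1 ∈ Set.Icc (0 : ℝ) (1 / 2)) (hy2 : y2 ∈ Set.Icc (0 : ℝ) (1 / 2))
    (hyh : yh ∈ Set.Icc (0 : ℝ) (1 / 2)) (hg1 : g1 ∈ Set.Icc (1 / 2 : ℝ) 1) :
    ChainDom p 5 0 1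
      (1 + (1 - p) * (1 + Hb x1 + Hb e1 + Hb xh)
        + p * (Hsum x2 (p + g1 * (1 - p)) - Hb (p + g1 * (1 - p)) + 1 - Hb ((1 - p) * yh)),
       1 + (1 - p) * (1 + Hb y1 + Hb g1 + Hb yh)
        + p * (Hsum y2 (p + e1 * (1 - p)) - Hb (p + e1 * (1 - p)) + 1 - Hb ((1 - p) * xh))) := by
  have hL := unitPair_levels (l := [fair, (e1, 1), (x1, x2), (xh, 0), fair])
    (by simp [unitPair_fair, unitPair_half hx1 hx2, unitPair_half_one he1, unitPair_half_zero hxh])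
  have hL' := unitPair_levels (l := [fair, (g1, 1), (y1, y2), (yh, 0), fair])
    (by simp [unitPair_fair, unitPair_half hy1 hy2, unitPair_half_one hg1, unitPair_half_zero hyh])
  refine (indep_weak (p := p) (m := 4) hL hL').of_eq ?_ ?_ <;>
    simp only [levels, Finset.sum_range_succ, Finset.sum_range_zero, List.getD_cons_zero,
      List.getD_cons_succ, cleanRate_fair, noisyRate_fair_right, noisyRate_fair_left,
      noisyRate_zero_left, mix_zero, zero_add] <;>
    simp only [noisyRate, mix_one] <;>
    ring

theorem strong_two : ChainDom p 2 1 0 (1, 1) := by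
  have hL := unitPair_levels (l := [fair]) (by simp [unitPair_fair])
  refine (indep_strong (p := p) (m := 1) hL hL).of_eq ?_ ?_ <;>
    simp [levels, noisyRate_zero_right, cleanRate_fair]

/-- The lowest level never reaches its own receiver, so repeating bit 1 there is free. In the row of
the copy the other user sends the constant 1 under interference, which explains `c = 1`. The two
assignments of roles are averaged. -/
theorem strong_three (he1 : e1 ∈ Set.Icc (1 / 2 : ℝ) 1) (hg1 : g1 ∈ Set.Icc (1 / 2 : ℝ) 1) :
    ChainDom p 3 1 0
      (1 + 1 / 2 * ((1 - p) * (1 + Hb e1) + p * (1 - Hb (p + g1 * (1 - p)))),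
       1 + 1 / 2 * ((1 - p) * (1 + Hb g1) + p * (1 - Hb (p + e1 * (1 - p))))) := by
  have key : ∀ g1 ∈ Set.Icc (1 / 2 : ℝ) 1, ChainDom p 3 1 0
      (2 - p * Hb (p + g1 * (1 - p)), 1 + (1 - p) * Hb g1) := by
    intro g1 hg1
    have hL := unitPair_levels (l := [fair, fair]) (by simp [unitPair_fair])
    have hL' := unitPair_levels (l := [fair, (g1, 1)])
      (by simp [unitPair_fair, unitPair_half_one hg1])
    refine (dup_strong (p := p) (m := 2) (k := 0) (k' := 2) (c := 1) hL hL' (by omega) (by omega)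
      (by omega) (fun _ x hx => ?_) (by omega)).of_eq ?_ ?_
    · rcases zmod_two_cases x with rfl | rfl
      · simp [levels, bern] at hx
      · rfl
    · simp only [levels, Finset.sum_range_succ, Finset.sum_range_zero, List.getD_cons_zero,
        List.getD_cons_succ, List.getD_nil, noisyRate_fair_left, noisyRate_zero_right,
        cleanRate_fair, mix_one, zero_add]
      norm_num
      ring
    · simp [levels, Finset.sum_range_succ, cleanRate_fair]
  refine ((key g1 hg1).average (key e1 he1).swap).of_eq ?_ ?_ <;> dsimp only <;> ring

theorem strong_four (hx1 : x1 ∈ Set.Icc (0 : ℝ) (1 / 2)) (hx2 : x2 ∈ Set.Icc (0 : ℝ) (1 / 2))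
    (hy1 : y1 ∈ Set.Icc (0 : ℝ) (1 / 2)) (hy2 : y2 ∈ Set.Icc (0 : ℝ) (1 / 2)) :
    ChainDom p 4 1 0 (1 + (1 - p) * (1 + Hb x1) + p * (1 - Hb (mix p y1 y2)),
      1 + (1 - p) * (1 + Hb y1) + p * (1 - Hb (mix p x1 x2))) := by
  have hL := unitPair_levels (l := [fair, (x1, x2), fair])
    (by simp [unitPair_fair, unitPair_half hx1 hx2])
  have hL' := unitPair_levels (l := [fair, (y1, y2), fair])
    (by simp [unitPair_fair, unitPair_half hy1 hy2])
  refine (indep_strong (p := p) (m := 3) hL hL').of_eq ?_ ?_ <;>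
    simp only [levels, Finset.sum_range_succ, Finset.sum_range_zero, List.getD_cons_zero,
      List.getD_cons_succ, List.getD_nil, cleanRate_fair, noisyRate_fair_right,
      noisyRate_fair_left, noisyRate_zero_right, zero_add] <;>
    ring

/-- As on three levels, a free repetition on the unseen lowest level: bit 3 is repeated on level 4
and cleared from level 2 of the other user, whose level 3 is constantly 1 under interference.
Averaging the two roles gives the halves. -/
theorem strong_five (hx1 : x1 ∈ Set.Icc (0 : ℝ) (1 / 2)) (hx2 : x2 ∈ Set.Icc (0 : ℝ) (1 / 2))
    (he1 : e1 ∈ Set.Icc (1 / 2 : ℝ) 1)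
    (hy1 : y1 ∈ Set.Icc (0 : ℝ) (1 / 2)) (hy2 : y2 ∈ Set.Icc (0 : ℝ) (1 / 2))
    (hg1 : g1 ∈ Set.Icc (1 / 2 : ℝ) 1) :
    ChainDom p 5 1 0
      (5 / 2 - p * Hb (mix p y1 y2) + (1 - p) * Hb x1
        + 1 / 2 * ((1 - p) * Hb e1 - p * Hb (p + g1 * (1 - p))),
       5 / 2 - p * Hb (mix p x1 x2) + (1 - p) * Hb y1
        + 1 / 2 * ((1 - p) * Hb g1 - p * Hb (p + e1 * (1 - p)))) := by
  have key : ∀ x1 ∈ Set.Icc (0 : ℝ) (1 / 2), ∀ x2 ∈ Set.Icc (0 : ℝ) (1 / 2),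
      ∀ y1 ∈ Set.Icc (0 : ℝ) (1 / 2), ∀ y2 ∈ Set.Icc (0 : ℝ) (1 / 2),
      ∀ g1 ∈ Set.Icc (1 / 2 : ℝ) 1, ChainDom p 5 1 0
      (3 - p * Hb (mix p y1 y2) + (1 - p) * Hb x1 - p * Hb (p + g1 * (1 - p)),
       2 - p * Hb (mix p x1 x2) + (1 - p) * Hb y1 + (1 - p) * Hb g1) := by
    intro x1 hx1 x2 hx2 y1 hy1 y2 hy2 g1 hg1
    have hL := unitPair_levels (l := [fair, (x1, x2), fair, fair])
      (by simp [unitPair_fair, unitPair_half hx1 hx2])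
    have hL' := unitPair_levels (l := [fair, (y1, y2), fair, (g1, 1)])
      (by simp [unitPair_fair, unitPair_half hy1 hy2, unitPair_half_one hg1])
    refine (dup_strong (p := p) (m := 4) (k := 2) (k' := 4) (c := 1) hL hL' (by omega) (by omega)
      (by omega) (fun _ x hx => ?_) (by omega)).of_eq ?_ ?_
    · rcases zmod_two_cases x with rfl | rfl
      · simp [levels, bern] at hx
      · rfl
    · simp only [levels, Finset.sum_range_succ, Finset.sum_range_zero, List.getD_cons_zero,
        List.getD_cons_succ, List.getD_nil, noisyRate_fair_left, noisyRate_fair_right,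
        noisyRate_zero_right, cleanRate_fair, mix_one, zero_add]
      norm_num
      ring
    · simp only [levels, Finset.sum_range_succ, Finset.sum_range_zero, List.getD_cons_zero,
        List.getD_cons_succ, List.getD_nil, noisyRate_fair_left, noisyRate_fair_right,
        noisyRate_zero_right, cleanRate_fair, zero_add]
      norm_num
      ring
  refine ((key x1 hx1 x2 hx2 y1 hy1 y2 hy2 g1 hg1).average
    (key y1 hy1 y2 hy2 x1 hx1 x2 hx2 e1 he1).swap).of_eq ?_ ?_ <;> dsimp only <;> ring

end ChainDom

/-! #### Four levels -/

/-- First user of the scheme on four levels: level 2 carries the sum of bits 1 and 2. -/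
def mixedUser₁ (L : ℕ → ℝ × ℝ) : LevelUser where
  prob := pairProb L
  enc _ z i := if i = 2 then z 1 + z 2 else z i
  obs s i := if s then (if i = 0 then Obs.clean else if i = 1 then Obs.noisy 1
    else if i = 2 then Obs.unused else Obs.noisy 2) else Obs.clean
  read s i y := if s then (if i = 1 then y 2 else y i) else if i = 2 then y 1 + y 2 else y i

/-- Second user of the scheme on four levels: level 3 carries the sum of bits 2 and 3. -/
def mixedUser₂ (L : ℕ → ℝ × ℝ) : LevelUser where
  prob := pairProb L
  enc _ z i := if i = 3 then z 2 + z 3 else z i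
  obs s i := if s then (if i = 0 then Obs.clean else if i = 1 then Obs.unused
    else if i = 2 then Obs.noisy 1 else Obs.noisy 2) else Obs.clean
  read _ i y := if i = 3 then y 2 + y 3 else y i

theorem mixed_cancel (a b c d : ZMod 2) : a + b + (a + c + (b + d)) = c + d := by
  revert a b c d; decide

/-- Under interference bit 2 vanishes, so level 2 is a second copy of bit 1. It is read there,
against interfering bit 1 rather than the fair bit 0. Without interference the sum of rows 1 and 2
recovers bit 2. -/
theorem mixedUser₁_valid {L L' : ℕ → ℝ × ℝ} (hL : ∀ i, UnitPair (L i)) (h2 : (L 2).2 = 0) :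
    Valid 4 0 1 (mixedUser₁ L) (mixedUser₂ L') := by
  refine ⟨fun s i _ => pairProb_mem hL s i, ?_⟩
  intro s s' z z' y hz _ hy i hi
  have y0 := hy 0 (by omega)
  have y1 := hy 1 (by omega)
  have y2 := hy 2 (by omega)
  have y3 := hy 3 (by omega)
  cases s
  · interval_cases i <;>
      simp [levelOut, mixedUser₁, ObsValid, y0, y1, y2, y3, ← add_assoc, CharTwo.add_self_eq_zero]
  · have hz2 : z 2 = 0 := by
      have := hz 2 (by omega)
      rcases zmod_two_cases (z 2) with h | h
      · exact h
      · simp [mixedUser₁, pairProb, h2, h, bern] at this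
    interval_cases i <;>
      simp [levelOut, mixedUser₁, mixedUser₂, ObsValid, y0, y2, y3, hz2]

/-- Rows 2 and 3 share both the own bit 2 and the interfering bit 1; their sum removes both and
leaves own bit 3 against interfering bit 2. -/
theorem mixedUser₂_valid {L L' : ℕ → ℝ × ℝ} (hL : ∀ i, UnitPair (L i)) :
    Valid 4 0 1 (mixedUser₂ L) (mixedUser₁ L') := by
  refine ⟨fun s i _ => pairProb_mem hL s i, ?_⟩
  intro s s' z z' y hz _ hy i hi
  have y0 := hy 0 (by omega)
  have y1 := hy 1 (by omega)
  have y2 := hy 2 (by omega)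
  have y3 := hy 3 (by omega)
  cases s
  · interval_cases i <;>
      simp [levelOut, mixedUser₂, ObsValid, y0, y1, y2, y3, ← add_assoc, CharTwo.add_self_eq_zero]
  · interval_cases i <;>
      simp [levelOut, mixedUser₁, mixedUser₂, ObsValid, y0, y2, y3, mixed_cancel]

namespace ChainDom

variable {p x1 x2 xt1 xt2 xh e1 y1 y2 yt1 yt2 yh g1 : ℝ}

/-- The mixed scheme gives one user the plain and hat parameters and the other the tilde parameters
and the bias under interference. Averaging it with its mirror image restores the symmetry. -/
theorem weak_four (hx1 : x1 ∈ Set.Icc (0 : ℝ) (1 / 2)) (hx2 : x2 ∈ Set.Icc (0 : ℝ) (1 / 2))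
    (hxt1 : xt1 ∈ Set.Icc (0 : ℝ) (1 / 2)) (hxt2 : xt2 ∈ Set.Icc (0 : ℝ) (1 / 2))
    (hxh : xh ∈ Set.Icc (0 : ℝ) (1 / 2)) (he1 : e1 ∈ Set.Icc (1 / 2 : ℝ) 1)
    (hy1 : y1 ∈ Set.Icc (0 : ℝ) (1 / 2)) (hy2 : y2 ∈ Set.Icc (0 : ℝ) (1 / 2))
    (hyt1 : yt1 ∈ Set.Icc (0 : ℝ) (1 / 2)) (hyt2 : yt2 ∈ Set.Icc (0 : ℝ) (1 / 2))
    (hyh : yh ∈ Set.Icc (0 : ℝ) (1 / 2)) (hg1 : g1 ∈ Set.Icc (1 / 2 : ℝ) 1) :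
    ChainDom p 4 0 1
      (1 + (1 - p) * (1 / 2 * (Hb x1 + Hb e1 + Hb xh + Hb xt1) + 1)
        + p * (1 / 2 * (Hsum x2 (p + g1 * (1 - p)) - Hb (p + g1 * (1 - p)) + 1 - Hb ((1 - p) * yh)
          + Hsum xt2 (mix p y1 y2) - Hb (mix p y1 y2) + 1 - Hb (mix p yt1 yt2))),
       1 + (1 - p) * (1 / 2 * (Hb y1 + Hb g1 + Hb yh + Hb yt1) + 1)
        + p * (1 / 2 * (Hsum y2 (p + e1 * (1 - p)) - Hb (p + e1 * (1 - p)) + 1 - Hb ((1 - p) * xh)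
          + Hsum yt2 (mix p x1 x2) - Hb (mix p x1 x2) + 1 - Hb (mix p xt1 xt2)))) := by
  have key : ∀ x1 ∈ Set.Icc (0 : ℝ) (1 / 2), ∀ x2 ∈ Set.Icc (0 : ℝ) (1 / 2),
      ∀ xh ∈ Set.Icc (0 : ℝ) (1 / 2), ∀ yt1 ∈ Set.Icc (0 : ℝ) (1 / 2),
      ∀ yt2 ∈ Set.Icc (0 : ℝ) (1 / 2), ∀ g1 ∈ Set.Icc (1 / 2 : ℝ) 1, ChainDom p 4 0 1
      (1 + (1 - p) * (Hb x1 + Hb xh + 1) + p * (Hsum x2 (p + g1 * (1 - p)) - Hb (p + g1 * (1 - p))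
          + 1 - Hb (mix p yt1 yt2)),
       1 + (1 - p) * (Hb g1 + Hb yt1 + 1) + p * (Hsum yt2 (mix p x1 x2) - Hb (mix p x1 x2)
          + 1 - Hb ((1 - p) * xh))) := by
    intro x1 hx1 x2 hx2 xh hxh yt1 hyt1 yt2 hyt2 g1 hg1
    have hL := unitPair_levels (l := [fair, (x1, x2), (xh, 0), fair])
      (by simp [unitPair_fair, unitPair_half hx1 hx2, unitPair_half_zero hxh])
    have hL' := unitPair_levels (l := [fair, (g1, 1), (yt1, yt2), fair])
      (by simp [unitPair_fair, unitPair_half hyt1 hyt2, unitPair_half_one hg1])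
    refine (of_users (p := p) (mixedUser₁_valid (L' := levels [fair, (g1, 1), (yt1, yt2), fair])
      hL rfl) (mixedUser₂_valid hL')).of_eq ?_ ?_
    · unfold colRate bitRate gain
      simp only [Finset.sum_range_succ, Finset.sum_range_zero, mixedUser₁, mixedUser₂]
      norm_num [obsGain, pairProb, levels]
      simp only [fair, Hb_half, Hsum_half, mix_one]
      ring
    · unfold colRate bitRate gain
      simp only [Finset.sum_range_succ, Finset.sum_range_zero, mixedUser₁, mixedUser₂]
      norm_num [obsGain, pairProb, levels]
      simp only [fair, Hb_half, Hsum_half, mix_zero]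
      ring
  refine ((key x1 hx1 x2 hx2 xh hxh yt1 hyt1 yt2 hyt2 g1 hg1).average
    (key y1 hy1 y2 hy2 yh hyh xt1 hxt1 xt2 hxt2 e1 he1).swap).of_eq ?_ ?_ <;> dsimp only <;> ring

end ChainDom

end BurstyIC

namespace BurstyIC

open LevelUser

/-! #### Long chains -/

/-- Level parameters of a long chain with weak interference. -/
noncomputable def weakLevels (s : ℕ) (η P φ : ℝ × ℝ) (i : ℕ) : ℝ × ℝ :=
  if i = 1 then η else if 3 ≤ i ∧ i < s + 3 then P else if i = s + 4 then φ else fair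

/-- Level parameters of a long chain with strong interference. -/
noncomputable def strongLevels (s : ℕ) (P η : ℝ × ℝ) (i : ℕ) : ℝ × ℝ :=
  if 1 ≤ i ∧ i < s + 1 then P else if i = s + 2 then η else if i < s + 4 then fair else (0, 0)

theorem unitPair_weakLevels {s : ℕ} {η P φ : ℝ × ℝ} (hη : UnitPair η) (hP : UnitPair P)
    (hφ : UnitPair φ) (i : ℕ) : UnitPair (weakLevels s η P φ i) := by
  unfold weakLevels
  split_ifs <;> first | assumption | exact unitPair_fair

theorem unitPair_strongLevels {s : ℕ} {η P : ℝ × ℝ} (hη : UnitPair η) (hP : UnitPair P)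
    (i : ℕ) : UnitPair (strongLevels s P η i) := by
  unfold strongLevels
  split_ifs <;> first | assumption | exact unitPair_fair | exact unitPair_zero

section

variable {s : ℕ} {η P φ : ℝ × ℝ}

theorem weakLevels_zero : weakLevels s η P φ 0 = fair := by
  simp [weakLevels]

theorem weakLevels_one : weakLevels s η P φ 1 = η := by
  unfold weakLevels; split_ifs <;> first | rfl | omega

theorem weakLevels_two : weakLevels s η P φ 2 = fair := by
  unfold weakLevels; split_ifs <;> first | rfl | omega

theorem weakLevels_slot {i : ℕ} (h : 3 ≤ i) (h' : i < s + 3) : weakLevels s η P φ i = P := by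
  unfold weakLevels; split_ifs <;> first | rfl | omega

theorem weakLevels_add_three : weakLevels s η P φ (s + 3) = fair := by
  unfold weakLevels; split_ifs <;> first | rfl | omega

theorem weakLevels_add_four : weakLevels s η P φ (s + 4) = φ := by
  unfold weakLevels; split_ifs <;> first | rfl | omega

theorem weakLevels_add_five : weakLevels s η P φ (s + 5) = fair := by
  unfold weakLevels; split_ifs <;> first | rfl | omega

theorem weakLevels_fair {i : ℕ} (h : 2 ≤ i) (h' : i < s + 4) :
    weakLevels s η fair φ i = fair := by
  unfold weakLevels; split_ifs <;> first | rfl | omega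

theorem strongLevels_zero : strongLevels s P η 0 = fair := by
  simp [strongLevels]

theorem strongLevels_slot {i : ℕ} (h : 1 ≤ i) (h' : i < s + 1) : strongLevels s P η i = P := by
  unfold strongLevels; split_ifs <;> first | rfl | omega

theorem strongLevels_add_one : strongLevels s P η (s + 1) = fair := by
  unfold strongLevels; split_ifs <;> first | rfl | omega

theorem strongLevels_add_two : strongLevels s P η (s + 2) = η := by
  unfold strongLevels; split_ifs <;> first | rfl | omega

theorem strongLevels_add_three : strongLevels s P η (s + 3) = fair := by
  unfold strongLevels; split_ifs <;> first | rfl | omega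

theorem strongLevels_add_four : strongLevels s P η (s + 4) = (0, 0) := by
  unfold strongLevels; split_ifs <;> first | rfl | omega

theorem strongLevels_fair {i : ℕ} (h' : i < s + 2) : strongLevels s fair η i = fair := by
  unfold strongLevels; split_ifs <;> first | rfl | omega

end

/-- A sum whose terms are constant after the first `a`. -/
theorem sum_range_add_const {f : ℕ → ℝ} {c : ℝ} (a s : ℕ)
    (h : ∀ i, a ≤ i → i < a + s → f i = c) :
    ∑ i ∈ Finset.range (a + s), f i = (∑ i ∈ Finset.range a, f i) + s * c := by
  rw [Finset.sum_range_add, Finset.sum_congr rfl fun i hi => h (a + i) (by omega)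
    (by have := Finset.mem_range.1 hi; omega)]
  simp

namespace ChainDom

variable {p x1 x2 xh e1 y1 y2 yh g1 : ℝ}

/-- Of the `k + 1` equal levels the first meets a fair bit, and the fair level after the last meets
one of them; only `k` pairs collide. Those two levels together with level 2 make up the core at
parameters `1 / 2`. -/
theorem weak_indep_sum (k : ℕ) (x1 x2 xh e1 y1 y2 yh g1 : ℝ) :
    cleanRate p (weakLevels (k + 1) (e1, 1) (x1, x2) (xh, 0) 0) + ∑ i ∈ Finset.range (k + 6),
      noisyRate p (weakLevels (k + 1) (e1, 1) (x1, x2) (xh, 0) (i + 1))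
        (weakLevels (k + 1) (g1, 1) (y1, y2) (yh, 0) i)
    = 1 + (1 - p) * (1 + Hb e1 + Hb xh) + p * (1 - Hb ((1 - p) * yh))
      + (coreRate p x1 x2 y1 y2 (1 / 2) (1 / 2) (p + g1 * (1 - p))
        + k * noisyRate p (x1, x2) (y1, y2)) := by
  rw [show k + 6 = 3 + k + 1 + 1 + 1 by omega, Finset.sum_range_succ, Finset.sum_range_succ,
    Finset.sum_range_succ, sum_range_add_const 3 k (c := noisyRate p (x1, x2) (y1, y2))
      fun i h1 h2 => by rw [weakLevels_slot (by omega) (by omega),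
        weakLevels_slot (by omega) (by omega)]]
  simp only [Finset.sum_range_succ, Finset.sum_range_zero]
  rw [show 3 + k + 1 + 1 + 1 = k + 1 + 5 by omega, show 3 + k + 1 + 1 = k + 1 + 4 by omega,
    show 3 + k + 1 = k + 1 + 3 by omega, weakLevels_add_five, weakLevels_add_four,
    weakLevels_add_four, weakLevels_add_three, weakLevels_add_three,
    weakLevels_slot (i := 3 + k) (by omega) (by omega), zero_add, weakLevels_zero,
    weakLevels_zero, weakLevels_one, weakLevels_one, one_add_one_eq_two, weakLevels_two,
    weakLevels_two, weakLevels_slot (i := 2 + 1) (by omega) (by omega)]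
  simp only [cleanRate_fair, noisyRate_fair_right, noisyRate_fair_left, mix_one, mix_zero]
  unfold coreRate
  rw [show star (1 / 2) (p + g1 * (1 - p)) = 1 / 2 by unfold star; ring]
  simp only [Hsum_half, Hsum_half', Hb_half]
  ring

theorem weak_indep (k : ℕ) (hx1 : x1 ∈ Set.Icc (0 : ℝ) (1 / 2))
    (hx2 : x2 ∈ Set.Icc (0 : ℝ) (1 / 2))
    (hxh : xh ∈ Set.Icc (0 : ℝ) (1 / 2)) (he1 : e1 ∈ Set.Icc (1 / 2 : ℝ) 1)
    (hy1 : y1 ∈ Set.Icc (0 : ℝ) (1 / 2)) (hy2 : y2 ∈ Set.Icc (0 : ℝ) (1 / 2))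
    (hyh : yh ∈ Set.Icc (0 : ℝ) (1 / 2)) (hg1 : g1 ∈ Set.Icc (1 / 2 : ℝ) 1) :
    ChainDom p (k + 7) 0 1
      (1 + (1 - p) * (1 + Hb e1 + Hb xh) + p * (1 - Hb ((1 - p) * yh))
        + (coreRate p x1 x2 y1 y2 (1 / 2) (1 / 2) (p + g1 * (1 - p))
          + k * noisyRate p (x1, x2) (y1, y2)),
       1 + (1 - p) * (1 + Hb g1 + Hb yh) + p * (1 - Hb ((1 - p) * xh))
        + (coreRate p y1 y2 x1 x2 (1 / 2) (1 / 2) (p + e1 * (1 - p))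
          + k * noisyRate p (y1, y2) (x1, x2))) :=
  (indep_weak (p := p) (m := k + 6)
    (unitPair_weakLevels (s := k + 1) (unitPair_half_one he1) (unitPair_half hx1 hx2)
      (unitPair_half_zero hxh))
    (unitPair_weakLevels (s := k + 1) (unitPair_half_one hg1) (unitPair_half hy1 hy2)
      (unitPair_half_zero hyh))).of_eq
    (weak_indep_sum k ..).symm (weak_indep_sum k ..).symm

/-- User 1 sends bit 2 again on level `s + 3`. The copy reaches user 2 in row `s + 4`, where its own
bit is zero under interference, and frees its level 3. In between, fair bits of user 2 face bits of
user 1 that are random only in the interference-free state. -/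
theorem weak_dup (s : ℕ) (hxh : xh ∈ Set.Icc (0 : ℝ) (1 / 2)) (he1 : e1 ∈ Set.Icc (1 / 2 : ℝ) 1)
    (hyh : yh ∈ Set.Icc (0 : ℝ) (1 / 2)) (hg1 : g1 ∈ Set.Icc (1 / 2 : ℝ) 1)
    {t : ℝ} (ht : t ∈ Set.Icc (0 : ℝ) (1 / 2)) :
    ChainDom p (s + 6) 0 1
      (1 + (1 - p) * (1 + Hb e1 + Hb xh) + p * (1 - Hb ((1 - p) * yh))
        + (1 - p * Hb (p + g1 * (1 - p)) + s * ((1 - p) * Hb t)),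
       1 + (1 - p) * (1 + Hb g1 + Hb yh) + p * (1 - Hb ((1 - p) * xh))
        + (2 - p * Hb (p + e1 * (1 - p)) + s * (1 - p * Hb ((1 - p) * t)))) := by
  refine (dup_weak (p := p) (m := s + 5) (k := 2) (k' := s + 2)
    (unitPair_weakLevels (s := s) (unitPair_half_one he1) (unitPair_half_zero ht)
      (unitPair_half_zero hxh))
    (unitPair_weakLevels (s := s) (unitPair_half_one hg1) unitPair_fair
      (unitPair_half_zero hyh)) (by omega) (by omega) (by omega)
      (by rw [weakLevels_add_four])).of_eq ?_ ?_
  · dsimp only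
    rw [show s + 5 = 2 + s + 1 + 1 + 1 by omega, Finset.sum_range_succ, Finset.sum_range_succ,
      Finset.sum_range_succ, sum_range_add_const 2 s (c := (1 - p) * Hb t)
        fun i h1 h2 => by rw [if_neg (by omega), weakLevels_slot (by omega) (by omega),
          weakLevels_fair (by omega) (by omega), noisyRate_fair_right]]
    simp only [Finset.sum_range_succ, Finset.sum_range_zero]
    rw [if_neg (by omega), if_neg (by omega), if_pos (by omega), if_neg (by omega),
      if_neg (by omega)]
    rw [show 2 + s + 1 + 1 + 1 = s + 5 by omega, show 2 + s + 1 + 1 = s + 4 by omega,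
      show 2 + s + 1 = s + 3 by omega, weakLevels_add_five, weakLevels_add_four,
      weakLevels_add_four, weakLevels_add_three, zero_add, weakLevels_zero,
      weakLevels_zero, weakLevels_one, weakLevels_one, one_add_one_eq_two, weakLevels_two]
    simp only [cleanRate_fair, noisyRate_fair_right, noisyRate_fair_left, mix_one, mix_zero]
    ring
  · dsimp only
    rw [show s + 5 = 3 + s + 1 + 1 by omega, Finset.sum_range_succ, Finset.sum_range_succ,
      sum_range_add_const 3 s (c := 1 - p * Hb ((1 - p) * t))
        fun i h1 h2 => by rw [if_neg (show ¬ i = 2 by omega),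
          if_neg (show ¬ i = s + 2 + 1 by omega), weakLevels_fair (i := i + 1) (by omega) (by omega),
          weakLevels_slot (i := i) (by omega) (by omega), noisyRate_fair_left, mix_zero]]
    simp only [Finset.sum_range_succ, Finset.sum_range_zero]
    rw [if_neg (show ¬ 0 = 2 by omega), if_neg (show ¬ 0 = s + 2 + 1 by omega),
      if_neg (show ¬ 1 = 2 by omega), if_neg (show ¬ 1 = s + 2 + 1 by omega), if_pos trivial,
      if_neg (show ¬ 3 + s = 2 by omega), if_pos (show 3 + s = s + 2 + 1 by omega),
      if_neg (show ¬ 3 + s + 1 = 2 by omega), if_neg (show ¬ 3 + s + 1 = s + 2 + 1 by omega)]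
    rw [show 3 + s + 1 + 1 = s + 5 by omega,
      show 3 + s + 1 = s + 4 by omega, weakLevels_add_five, weakLevels_add_four,
      weakLevels_add_four, zero_add, weakLevels_zero,
      weakLevels_zero, weakLevels_one, weakLevels_one, one_add_one_eq_two, weakLevels_two,
      weakLevels_fair (i := 2 + 1) (by omega) (by omega)]
    simp only [cleanRate_fair, noisyRate_fair_right, noisyRate_fair_left, mix_one, mix_zero]
    ring

theorem strong_indep_sum (k : ℕ) (x1 x2 e1 y1 y2 g1 : ℝ) :
    ∑ i ∈ Finset.range (k + 5),
      noisyRate p (strongLevels (k + 1) (x1, x2) (e1, 1) i)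
        (strongLevels (k + 1) (y1, y2) (g1, 1) (i + 1))
    = 1 + (1 - p) * Hb e1
      + (coreRate p x1 x2 y1 y2 (1 / 2) (1 / 2) (p + g1 * (1 - p))
        + k * noisyRate p (x1, x2) (y1, y2)) := by
  rw [show k + 5 = 1 + k + 1 + 1 + 1 + 1 by omega, Finset.sum_range_succ, Finset.sum_range_succ,
    Finset.sum_range_succ, Finset.sum_range_succ,
    sum_range_add_const 1 k (c := noisyRate p (x1, x2) (y1, y2))
      fun i h1 h2 => by rw [strongLevels_slot (by omega) (by omega),
        strongLevels_slot (by omega) (by omega)]]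
  simp only [Finset.sum_range_succ, Finset.sum_range_zero]
  rw [show 1 + k + 1 + 1 + 1 + 1 = k + 1 + 4 by omega, show 1 + k + 1 + 1 + 1 = k + 1 + 3 by omega,
    show 1 + k + 1 + 1 = k + 1 + 2 by omega, show 1 + k + 1 = k + 1 + 1 by omega,
    strongLevels_add_four, strongLevels_add_three, strongLevels_add_three, strongLevels_add_two,
    strongLevels_add_two, strongLevels_add_one, strongLevels_add_one,
    strongLevels_slot (i := 1 + k) (by omega) (by omega), zero_add, strongLevels_zero,
    strongLevels_slot (i := 1) (by omega) (by omega)]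
  simp only [cleanRate_fair, noisyRate_fair_right, noisyRate_fair_left, noisyRate_zero_right,
    mix_one]
  unfold coreRate
  rw [show star (1 / 2) (p + g1 * (1 - p)) = 1 / 2 by unfold star; ring]
  simp only [Hsum_half, Hsum_half', Hb_half]
  ring

theorem strong_indep (k : ℕ) (hx1 : x1 ∈ Set.Icc (0 : ℝ) (1 / 2))
    (hx2 : x2 ∈ Set.Icc (0 : ℝ) (1 / 2)) (he1 : e1 ∈ Set.Icc (1 / 2 : ℝ) 1)
    (hy1 : y1 ∈ Set.Icc (0 : ℝ) (1 / 2)) (hy2 : y2 ∈ Set.Icc (0 : ℝ) (1 / 2))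
    (hg1 : g1 ∈ Set.Icc (1 / 2 : ℝ) 1) :
    ChainDom p (k + 6) 1 0
      (1 + (1 - p) * Hb e1
        + (coreRate p x1 x2 y1 y2 (1 / 2) (1 / 2) (p + g1 * (1 - p))
          + k * noisyRate p (x1, x2) (y1, y2)),
       1 + (1 - p) * Hb g1
        + (coreRate p y1 y2 x1 x2 (1 / 2) (1 / 2) (p + e1 * (1 - p))
          + k * noisyRate p (y1, y2) (x1, x2))) :=
  (indep_strong (p := p) (m := k + 5)
    (unitPair_strongLevels (s := k + 1) (unitPair_half_one he1) (unitPair_half hx1 hx2))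
    (unitPair_strongLevels (s := k + 1) (unitPair_half_one hg1) (unitPair_half hy1 hy2))).of_eq
    (strong_indep_sum k ..).symm (strong_indep_sum k ..).symm

/-- The top row contains no own signal, so a copy of bit `s + 1` on level 0 of user 1 is seen in the
clear by user 2 and frees its level `s`. The price is level 0 of user 1. -/
theorem strong_dup (s : ℕ) (he1 : e1 ∈ Set.Icc (1 / 2 : ℝ) 1) (hg1 : g1 ∈ Set.Icc (1 / 2 : ℝ) 1)
    {t : ℝ} (ht : t ∈ Set.Icc (0 : ℝ) (1 / 2)) :
    ChainDom p (s + 5) 1 0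
      (1 + (1 - p) * Hb e1 + (1 - p * Hb (p + g1 * (1 - p)) + s * ((1 - p) * Hb t)),
       1 + (1 - p) * Hb g1
        + (2 - p * Hb (p + e1 * (1 - p)) + s * (1 - p * Hb ((1 - p) * t)))) := by
  refine (dup_strong (p := p) (m := s + 4) (k := s) (k' := 0) (c := 0)
    (unitPair_strongLevels (s := s) (unitPair_half_one he1) (unitPair_half_zero ht))
    (unitPair_strongLevels (s := s) (unitPair_half_one hg1) unitPair_fair)
    (by omega) (by omega) (by omega) (by omega) (fun _ => rfl)).of_eq ?_ ?_
  · dsimp only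
    rw [show s + 4 = 1 + s + 1 + 1 + 1 by omega, Finset.sum_range_succ, Finset.sum_range_succ,
      Finset.sum_range_succ, sum_range_add_const 1 s (c := (1 - p) * Hb t)
        fun i h1 h2 => by rw [if_neg (by omega), strongLevels_slot (by omega) (by omega),
          strongLevels_fair (by omega), noisyRate_fair_right]]
    simp only [Finset.sum_range_succ, Finset.sum_range_zero]
    rw [if_pos trivial, if_neg (show ¬ 1 + s = 0 by omega), if_neg (show ¬ 1 + s + 1 = 0 by omega),
      if_neg (show ¬ 1 + s + 1 + 1 = 0 by omega)]
    rw [show 1 + s + 1 + 1 + 1 = s + 4 by omega, show 1 + s + 1 + 1 = s + 3 by omega,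
      show 1 + s + 1 = s + 2 by omega, show 1 + s = s + 1 by omega,
      strongLevels_add_four, strongLevels_add_three, strongLevels_add_three,
      strongLevels_add_two, strongLevels_add_two, strongLevels_add_one]
    simp only [cleanRate_fair, noisyRate_fair_right, noisyRate_fair_left, noisyRate_zero_right,
      mix_one]
    ring
  · dsimp only
    rw [show s + 4 = 0 + s + 1 + 1 + 1 + 1 by omega, Finset.sum_range_succ, Finset.sum_range_succ,
      Finset.sum_range_succ, Finset.sum_range_succ,
      sum_range_add_const 0 s (c := 1 - p * Hb ((1 - p) * t))
        fun i h1 h2 => by rw [if_neg (show ¬ i = s by omega),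
          if_neg (show ¬ i + 1 = 0 by omega), strongLevels_fair (by omega),
          strongLevels_slot (i := i + 1) (by omega) (by omega), noisyRate_fair_left, mix_zero]]
    simp only [Finset.sum_range_zero, zero_add]
    rw [if_pos trivial, if_neg (show ¬ s + 1 = s by omega), if_neg (show ¬ s + 1 + 1 = 0 by omega),
      if_neg (show ¬ s + 1 + 1 = s by omega), if_neg (show ¬ s + 1 + 1 + 1 = 0 by omega),
      if_neg (show ¬ s + 1 + 1 + 1 = s by omega), if_neg (show ¬ s + 1 + 1 + 1 + 1 = 0 by omega)]
    rw [strongLevels_fair (i := s) (by omega)]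
    simp only [add_assoc, one_add_one_eq_two, Nat.reduceAdd]
    rw [strongLevels_add_four, strongLevels_add_three, strongLevels_add_three,
      strongLevels_add_two, strongLevels_add_two, strongLevels_add_one]
    simp only [cleanRate_fair, noisyRate_fair_right, noisyRate_fair_left, noisyRate_zero_right,
      mix_one]
    ring

theorem interference_mem {g : ℝ} (hp : p ∈ Set.Icc (0 : ℝ) 1) (hg : g ∈ Set.Icc (1 / 2 : ℝ) 1) :
    p + g * (1 - p) ∈ Set.Icc (0 : ℝ) 1 := by
  obtain ⟨h1, h2⟩ := hp
  obtain ⟨h3, h4⟩ := hg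
  constructor <;> nlinarith

/-- The parameters `e'`, `g'` need no scheme of their own: in each direction one of `weak_indep` and
`weak_dup` is at least as good. -/
theorem weak_long (hp : p ∈ Set.Icc (0 : ℝ) 1) (k : ℕ) {e' g' : ℝ}
    (hx1 : x1 ∈ Set.Icc (0 : ℝ) (1 / 2)) (hx2 : x2 ∈ Set.Icc (0 : ℝ) (1 / 2))
    (hxh : xh ∈ Set.Icc (0 : ℝ) (1 / 2)) (he1 : e1 ∈ Set.Icc (1 / 2 : ℝ) 1)
    (he' : e' ∈ Set.Icc (1 / 2 : ℝ) 1)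
    (hy1 : y1 ∈ Set.Icc (0 : ℝ) (1 / 2)) (hy2 : y2 ∈ Set.Icc (0 : ℝ) (1 / 2))
    (hyh : yh ∈ Set.Icc (0 : ℝ) (1 / 2)) (hg1 : g1 ∈ Set.Icc (1 / 2 : ℝ) 1)
    (hg' : g' ∈ Set.Icc (1 / 2 : ℝ) 1) :
    ChainDom p (k + 7) 0 1
      (1 + (1 - p) * (1 + Hb e1 + Hb xh) + p * (1 - Hb ((1 - p) * yh))
        + (coreRate p x1 x2 y1 y2 e' g' (p + g1 * (1 - p))
          + k * noisyRate p (x1, x2) (y1, y2)),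
       1 + (1 - p) * (1 + Hb g1 + Hb yh) + p * (1 - Hb ((1 - p) * xh))
        + (coreRate p y1 y2 x1 x2 g' e' (p + e1 * (1 - p))
          + k * noisyRate p (y1, y2) (x1, x2))) := by
  refine core hp hx1 hx2 hy1 hy2 (half_Icc_subset he') (half_Icc_subset hg')
    (interference_mem hp he1) (interference_mem hp hg1) k
    (weak_indep k hx1 hx2 hxh he1 hy1 hy2 hyh hg1) (fun t ht => ?_) (fun t ht => ?_)
  · simpa only [Nat.cast_add, Nat.cast_one] using weak_dup (p := p) (k + 1) hxh he1 hyh hg1 ht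
  · simpa only [Nat.cast_add, Nat.cast_one] using weak_dup (p := p) (k + 1) hyh hg1 hxh he1 ht

theorem strong_long (hp : p ∈ Set.Icc (0 : ℝ) 1) (k : ℕ) {e' g' : ℝ}
    (hx1 : x1 ∈ Set.Icc (0 : ℝ) (1 / 2)) (hx2 : x2 ∈ Set.Icc (0 : ℝ) (1 / 2))
    (he1 : e1 ∈ Set.Icc (1 / 2 : ℝ) 1) (he' : e' ∈ Set.Icc (1 / 2 : ℝ) 1)
    (hy1 : y1 ∈ Set.Icc (0 : ℝ) (1 / 2)) (hy2 : y2 ∈ Set.Icc (0 : ℝ) (1 / 2))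
    (hg1 : g1 ∈ Set.Icc (1 / 2 : ℝ) 1) (hg' : g' ∈ Set.Icc (1 / 2 : ℝ) 1) :
    ChainDom p (k + 6) 1 0
      (1 + (1 - p) * Hb e1
        + (coreRate p x1 x2 y1 y2 e' g' (p + g1 * (1 - p))
          + k * noisyRate p (x1, x2) (y1, y2)),
       1 + (1 - p) * Hb g1
        + (coreRate p y1 y2 x1 x2 g' e' (p + e1 * (1 - p))
          + k * noisyRate p (y1, y2) (x1, x2))) := by
  refine core hp hx1 hx2 hy1 hy2 (half_Icc_subset he') (half_Icc_subset hg')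
    (interference_mem hp he1) (interference_mem hp hg1) k
    (strong_indep k hx1 hx2 he1 hy1 hy2 hg1) (fun t ht => ?_) (fun t ht => ?_)
  · simpa only [Nat.cast_add, Nat.cast_one] using strong_dup (p := p) (k + 1) he1 hg1 ht
  · simpa only [Nat.cast_add, Nat.cast_one] using strong_dup (p := p) (k + 1) hg1 he1 ht

/-- Six levels with weak interference. -/
theorem weak_six (hp : p ∈ Set.Icc (0 : ℝ) 1) {e' g' : ℝ}
    (hx1 : x1 ∈ Set.Icc (0 : ℝ) (1 / 2)) (hx2 : x2 ∈ Set.Icc (0 : ℝ) (1 / 2))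
    (hxh : xh ∈ Set.Icc (0 : ℝ) (1 / 2)) (he1 : e1 ∈ Set.Icc (1 / 2 : ℝ) 1)
    (he' : e' ∈ Set.Icc (1 / 2 : ℝ) 1)
    (hy1 : y1 ∈ Set.Icc (0 : ℝ) (1 / 2)) (hy2 : y2 ∈ Set.Icc (0 : ℝ) (1 / 2))
    (hyh : yh ∈ Set.Icc (0 : ℝ) (1 / 2)) (hg1 : g1 ∈ Set.Icc (1 / 2 : ℝ) 1)
    (hg' : g' ∈ Set.Icc (1 / 2 : ℝ) 1) :
    ChainDom p 6 0 1
      (1 + (1 - p) * (1 + Hb e1 + Hb xh) + p * (1 - Hb ((1 - p) * yh))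
        + 1 / 2 * (((1 - p) * (1 + Hb e') + p * (1 - Hb (p + g1 * (1 - p))
            + Hsum (star e' (p + g1 * (1 - p))) (mix p y1 y2) - Hb (mix p y1 y2)))
          + (2 * (1 - p) * Hb x1 + p * (Hsum x2 (p + g1 * (1 - p)) - Hb (p + g1 * (1 - p))
            + Hsum x2 g' - Hb g'))),
       1 + (1 - p) * (1 + Hb g1 + Hb yh) + p * (1 - Hb ((1 - p) * xh))
        + 1 / 2 * (((1 - p) * (1 + Hb g') + p * (1 - Hb (p + e1 * (1 - p))
            + Hsum (star g' (p + e1 * (1 - p))) (mix p x1 x2) - Hb (mix p x1 x2)))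
          + (2 * (1 - p) * Hb y1 + p * (Hsum y2 (p + e1 * (1 - p)) - Hb (p + e1 * (1 - p))
            + Hsum y2 e' - Hb e')))) := by
  have key : ∀ xh ∈ Set.Icc (0 : ℝ) (1 / 2), ∀ e1 ∈ Set.Icc (1 / 2 : ℝ) 1,
      ∀ e' ∈ Set.Icc (1 / 2 : ℝ) 1, ∀ y1 ∈ Set.Icc (0 : ℝ) (1 / 2),
      ∀ y2 ∈ Set.Icc (0 : ℝ) (1 / 2), ∀ yh ∈ Set.Icc (0 : ℝ) (1 / 2),
      ∀ g1 ∈ Set.Icc (1 / 2 : ℝ) 1, ChainDom p 6 0 1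
      (1 + (1 - p) * (1 + Hb e1 + Hb xh) + p * (1 - Hb ((1 - p) * yh))
        + ((1 - p) * (1 + Hb e') + p * (1 - Hb (p + g1 * (1 - p))
            + Hsum (star e' (p + g1 * (1 - p))) (mix p y1 y2) - Hb (mix p y1 y2))),
       1 + (1 - p) * (1 + Hb g1 + Hb yh) + p * (1 - Hb ((1 - p) * xh))
        + (2 * (1 - p) * Hb y1 + p * (Hsum y2 (p + e1 * (1 - p)) - Hb (p + e1 * (1 - p))
            + Hsum y2 e' - Hb e'))) := by
    intro xh hxh e1 he1 e' he' y1 hy1 y2 hy2 yh hyh g1 hg1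
    -- The two repetition schemes are the long ones with no slots, so the parameter `t` is
    -- immaterial and is set to zero.
    refine core_two hp hy1 hy2 (half_Icc_subset he') (interference_mem hp hg1) ?_
      ((weak_dup (p := p) 0 hxh he1 hyh hg1 ⟨le_rfl, one_half_pos.le⟩).of_eq ?_ ?_)
      ((weak_dup (p := p) 0 hyh hg1 hxh he1 ⟨le_rfl, one_half_pos.le⟩).of_eq ?_ ?_)
    · have hL := unitPair_levels (l := [fair, (e1, 1), fair, fair, (xh, 0), fair])
        (by simp [unitPair_fair, unitPair_half_one he1, unitPair_half_zero hxh])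
      have hL' := unitPair_levels (l := [fair, (g1, 1), (y1, y2), (y1, y2), (yh, 0), fair])
        (by simp [unitPair_fair, unitPair_half hy1 hy2, unitPair_half_one hg1,
          unitPair_half_zero hyh])
      refine (indep_weak (p := p) (m := 5) hL hL').of_eq ?_ ?_ <;>
        simp only [levels, Finset.sum_range_succ, Finset.sum_range_zero, List.getD_cons_zero,
          List.getD_cons_succ, cleanRate_fair, noisyRate_fair_right, noisyRate_fair_left,
          noisyRate_zero_left, mix_zero, mix_one, zero_add] <;>
        try simp only [noisyRate, mix_one]
      all_goals ring
    all_goals simp only [Nat.cast_zero, zero_mul, add_zero]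
  refine ((key xh hxh e1 he1 e' he' y1 hy1 y2 hy2 yh hyh g1 hg1).average
    (key yh hyh g1 hg1 g' hg' x1 hx1 x2 hx2 xh hxh e1 he1).swap).of_eq ?_ ?_ <;>
    dsimp only <;> ring

end ChainDom

end BurstyIC

namespace BurstyIC

open LevelUser

/-! ### Membership in the capacity region -/

section

variable {p x1 x2 xt1 xt2 xh e1 e' y1 y2 yt1 yt2 yh g1 g' : ℝ} {nd nc T : ℕ}

/-- With `D = nd - nc`, the weights in `hR₁` and `hR₂` are the numbers `r` and `D - r` of long and
short chains, written in terms of the channel parameters. -/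
theorem mem_capacityRegion_weak (hp : p ∈ Set.Icc (0 : ℝ) 1) (hT : 0 < T) (h : nc < nd) (n : ℕ)
    (h₁ : (n : ℝ) * (nd - nc) ≤ nd) (h₂ : (nd : ℝ) ≤ (n + 1) * (nd - nc)) {τ τ' R : ℝ × ℝ}
    (hτ : ChainDom p (n + 1) 0 1 τ) (hτ' : ChainDom p n 0 1 τ')
    (t₁ : 0 ≤ τ.1) (t₂ : 0 ≤ τ.2) (t₁' : 0 ≤ τ'.1) (t₂' : 0 ≤ τ'.2)
    (hR₁ : R.1 = (nd - n * (nd - nc)) * τ.1 + ((n + 1) * (nd - nc) - nd) * τ'.1)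
    (hR₂ : R.2 = (nd - n * (nd - nc)) * τ.2 + ((n + 1) * (nd - nc) - nd) * τ'.2) :
    R ∈ capacityRegion nd nc T p := by
  obtain ⟨D, rfl⟩ := Nat.exists_eq_add_of_lt h
  push_cast at h₁ h₂ hR₁ hR₂
  rw [show (nc : ℝ) + D + 1 - nc = D + 1 by ring] at h₁ h₂ hR₁ hR₂
  obtain ⟨r, hr⟩ := Nat.exists_eq_add_of_le
    (show n * (D + 1) ≤ nc + D + 1 by exact_mod_cast h₁)
  have hr' : (nc : ℝ) + D + 1 = n * (D + 1) + r := by exact_mod_cast hr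
  have hrD : r ≤ D + 1 := by
    have : (r : ℝ) ≤ D + 1 := by linarith
    exact_mod_cast this
  have hrD' : (0 : ℝ) ≤ D + 1 - r := by linarith
  rw [hr', show (n : ℝ) * (D + 1) + r - n * (D + 1) = r by ring,
    show ((n : ℝ) + 1) * (D + 1) - (n * (D + 1) + r) = D + 1 - r by ring] at hR₁ hR₂
  have hm : max (nc + D + 1) nc = nc + D + 1 := max_eq_left (by omega)
  refine mem_capacityRegion_of_chainDom hp hT (D := D + 1) (n := n) (r := r) (a := 0) (b := 1)
    (by omega) hrD (by omega) (by omega) (by omega) hτ hτ' ?_ ?_ ?_ ?_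
  · rw [hR₁]
    exact add_nonneg (mul_nonneg (Nat.cast_nonneg _) t₁) (mul_nonneg hrD' t₁')
  · rw [hR₂]
    exact add_nonneg (mul_nonneg (Nat.cast_nonneg _) t₂) (mul_nonneg hrD' t₂')
  · rw [hR₁]; push_cast; ring
  · rw [hR₂]; push_cast; ring

theorem mem_capacityRegion_strong (hp : p ∈ Set.Icc (0 : ℝ) 1) (hT : 0 < T) (h : nd < nc) (n : ℕ)
    (h₁ : (n : ℝ) * (nc - nd) ≤ nc) (h₂ : (nc : ℝ) ≤ (n + 1) * (nc - nd)) {τ τ' R : ℝ × ℝ}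
    (hτ : ChainDom p (n + 1) 1 0 τ) (hτ' : ChainDom p n 1 0 τ')
    (t₁ : 0 ≤ τ.1) (t₂ : 0 ≤ τ.2) (t₁' : 0 ≤ τ'.1) (t₂' : 0 ≤ τ'.2)
    (hR₁ : R.1 = (nc - n * (nc - nd)) * τ.1 + ((n + 1) * (nc - nd) - nc) * τ'.1)
    (hR₂ : R.2 = (nc - n * (nc - nd)) * τ.2 + ((n + 1) * (nc - nd) - nc) * τ'.2) :
    R ∈ capacityRegion nd nc T p := by
  obtain ⟨D, rfl⟩ := Nat.exists_eq_add_of_lt h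
  push_cast at h₁ h₂ hR₁ hR₂
  rw [show (nd : ℝ) + D + 1 - nd = D + 1 by ring] at h₁ h₂ hR₁ hR₂
  obtain ⟨r, hr⟩ := Nat.exists_eq_add_of_le
    (show n * (D + 1) ≤ nd + D + 1 by exact_mod_cast h₁)
  have hr' : (nd : ℝ) + D + 1 = n * (D + 1) + r := by exact_mod_cast hr
  have hrD : r ≤ D + 1 := by
    have : (r : ℝ) ≤ D + 1 := by linarith
    exact_mod_cast this
  have hrD' : (0 : ℝ) ≤ D + 1 - r := by linarith
  rw [hr', show (n : ℝ) * (D + 1) + r - n * (D + 1) = r by ring,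
    show ((n : ℝ) + 1) * (D + 1) - (n * (D + 1) + r) = D + 1 - r by ring] at hR₁ hR₂
  have hm : max nd (nd + D + 1) = nd + D + 1 := max_eq_right (by omega)
  refine mem_capacityRegion_of_chainDom hp hT (D := D + 1) (n := n) (r := r) (a := 1) (b := 0)
    (by omega) hrD (by omega) (by omega) (by omega) hτ hτ' ?_ ?_ ?_ ?_
  · rw [hR₁]
    exact add_nonneg (mul_nonneg (Nat.cast_nonneg _) t₁) (mul_nonneg hrD' t₁')
  · rw [hR₂]
    exact add_nonneg (mul_nonneg (Nat.cast_nonneg _) t₂) (mul_nonneg hrD' t₂')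
  · rw [hR₁]; push_cast; ring
  · rw [hR₂]; push_cast; ring

/-! ### Nonnegativity of the chain rates -/

theorem off_nonneg (hp : p ∈ Set.Icc (0 : ℝ) 1) {x : ℝ} (hx : x ∈ Set.Icc (0 : ℝ) 1) :
    0 ≤ (1 - p) * Hb x :=
  mul_nonneg (sub_nonneg.2 hp.2) (Hb_nonneg hx.1 hx.2)

theorem on_fair_nonneg (hp : p ∈ Set.Icc (0 : ℝ) 1) (y : ℝ) : 0 ≤ p * (1 - Hb y) :=
  mul_nonneg hp.1 (sub_nonneg.2 (Hb_le_one y))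

theorem on_nonneg (hp : p ∈ Set.Icc (0 : ℝ) 1) {x y : ℝ} (hx : x ∈ Set.Icc (0 : ℝ) 1)
    (hy : y ∈ Set.Icc (0 : ℝ) 1) : 0 ≤ p * (Hsum x y - Hb y) :=
  mul_nonneg hp.1 (sub_nonneg.2 (Hb_le_Hsum hx hy))

theorem noisyRate_nonneg (hp : p ∈ Set.Icc (0 : ℝ) 1) (hx1 : x1 ∈ Set.Icc (0 : ℝ) (1 / 2))
    (hx2 : x2 ∈ Set.Icc (0 : ℝ) (1 / 2)) (hy1 : y1 ∈ Set.Icc (0 : ℝ) (1 / 2))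
    (hy2 : y2 ∈ Set.Icc (0 : ℝ) (1 / 2)) : 0 ≤ noisyRate p (x1, x2) (y1, y2) :=
  add_nonneg (off_nonneg hp (Icc_half_subset hx1))
    (on_nonneg hp (Icc_half_subset hx2) (Icc_half_subset (mix_mem hp hy1 hy2)))

theorem coreRate_nonneg (hp : p ∈ Set.Icc (0 : ℝ) 1) (hx1 : x1 ∈ Set.Icc (0 : ℝ) (1 / 2))
    (hx2 : x2 ∈ Set.Icc (0 : ℝ) (1 / 2)) (hy1 : y1 ∈ Set.Icc (0 : ℝ) (1 / 2))
    (hy2 : y2 ∈ Set.Icc (0 : ℝ) (1 / 2)) (he' : e' ∈ Set.Icc (0 : ℝ) 1)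
    (hg' : g' ∈ Set.Icc (0 : ℝ) 1) {gt : ℝ} (hgt : gt ∈ Set.Icc (0 : ℝ) 1) :
    0 ≤ coreRate p x1 x2 y1 y2 e' g' gt := by
  have h1 := off_nonneg hp he'
  have h2 := off_nonneg hp (Icc_half_subset hx1)
  have h3 := on_fair_nonneg hp gt
  have h4 := on_nonneg hp (x := star e' gt) (star_mem he' hgt) (Icc_half_subset (mix_mem hp hy1 hy2))
  have h5 := on_nonneg hp (Icc_half_subset hx2) hg'
  unfold coreRate
  linarith [hp.2]

theorem weak_three_nonneg (hp : p ∈ Set.Icc (0 : ℝ) 1) (hx1 : x1 ∈ Set.Icc (0 : ℝ) (1 / 2))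
    (y : ℝ) : 0 ≤ 1 + (1 - p) * (1 + Hb x1) + p * (1 - Hb y) := by
  linarith [off_nonneg hp (Icc_half_subset hx1), on_fair_nonneg hp y, hp.2]

theorem weak_four_nonneg (hp : p ∈ Set.Icc (0 : ℝ) 1)
    (hx1 : x1 ∈ Set.Icc (0 : ℝ) (1 / 2)) (hx2 : x2 ∈ Set.Icc (0 : ℝ) (1 / 2))
    (hxt1 : xt1 ∈ Set.Icc (0 : ℝ) (1 / 2)) (hxt2 : xt2 ∈ Set.Icc (0 : ℝ) (1 / 2))
    (hxh : xh ∈ Set.Icc (0 : ℝ) (1 / 2)) (he1 : e1 ∈ Set.Icc (1 / 2 : ℝ) 1)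
    (hy1 : y1 ∈ Set.Icc (0 : ℝ) (1 / 2)) (hy2 : y2 ∈ Set.Icc (0 : ℝ) (1 / 2))
    (yh y : ℝ) (hg1 : g1 ∈ Set.Icc (1 / 2 : ℝ) 1) :
    0 ≤ 1 + (1 - p) * (1 / 2 * (Hb x1 + Hb e1 + Hb xh + Hb xt1) + 1)
        + p * (1 / 2 * (Hsum x2 (p + g1 * (1 - p)) - Hb (p + g1 * (1 - p)) + 1 - Hb ((1 - p) * yh)
          + Hsum xt2 (mix p y1 y2) - Hb (mix p y1 y2) + 1 - Hb y)) := by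
  have h1 := off_nonneg hp (Icc_half_subset hx1)
  have h2 := off_nonneg hp (Icc_half_subset hxh)
  have h3 := off_nonneg hp (Icc_half_subset hxt1)
  have h4 := off_nonneg hp (half_Icc_subset he1)
  have h5 := on_nonneg hp (Icc_half_subset hx2) (ChainDom.interference_mem hp hg1)
  have h6 := on_nonneg hp (Icc_half_subset hxt2) (Icc_half_subset (mix_mem hp hy1 hy2))
  have h7 := on_fair_nonneg hp ((1 - p) * yh)
  have h8 := on_fair_nonneg hp y
  linarith [hp.2]

theorem weak_five_nonneg (hp : p ∈ Set.Icc (0 : ℝ) 1)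
    (hx1 : x1 ∈ Set.Icc (0 : ℝ) (1 / 2)) (hx2 : x2 ∈ Set.Icc (0 : ℝ) (1 / 2))
    (hxh : xh ∈ Set.Icc (0 : ℝ) (1 / 2)) (he1 : e1 ∈ Set.Icc (1 / 2 : ℝ) 1)
    (yh : ℝ) (hg1 : g1 ∈ Set.Icc (1 / 2 : ℝ) 1) :
    0 ≤ 1 + (1 - p) * (1 + Hb x1 + Hb e1 + Hb xh)
        + p * (Hsum x2 (p + g1 * (1 - p)) - Hb (p + g1 * (1 - p)) + 1 - Hb ((1 - p) * yh)) := by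
  have h1 := off_nonneg hp (Icc_half_subset hx1)
  have h2 := off_nonneg hp (Icc_half_subset hxh)
  have h4 := off_nonneg hp (half_Icc_subset he1)
  have h5 := on_nonneg hp (Icc_half_subset hx2) (ChainDom.interference_mem hp hg1)
  have h7 := on_fair_nonneg hp ((1 - p) * yh)
  linarith [hp.2]

theorem weak_six_nonneg (hp : p ∈ Set.Icc (0 : ℝ) 1)
    (hx1 : x1 ∈ Set.Icc (0 : ℝ) (1 / 2)) (hx2 : x2 ∈ Set.Icc (0 : ℝ) (1 / 2))
    (hxh : xh ∈ Set.Icc (0 : ℝ) (1 / 2)) (he1 : e1 ∈ Set.Icc (1 / 2 : ℝ) 1)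
    (he' : e' ∈ Set.Icc (1 / 2 : ℝ) 1)
    (hy1 : y1 ∈ Set.Icc (0 : ℝ) (1 / 2)) (hy2 : y2 ∈ Set.Icc (0 : ℝ) (1 / 2))
    (yh : ℝ) (hg1 : g1 ∈ Set.Icc (1 / 2 : ℝ) 1) (hg' : g' ∈ Set.Icc (1 / 2 : ℝ) 1) :
    0 ≤ 1 + (1 - p) * (1 + Hb e1 + Hb xh) + p * (1 - Hb ((1 - p) * yh))
        + 1 / 2 * (((1 - p) * (1 + Hb e') + p * (1 - Hb (p + g1 * (1 - p))
            + Hsum (star e' (p + g1 * (1 - p))) (mix p y1 y2) - Hb (mix p y1 y2)))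
          + (2 * (1 - p) * Hb x1 + p * (Hsum x2 (p + g1 * (1 - p)) - Hb (p + g1 * (1 - p))
            + Hsum x2 g' - Hb g'))) := by
  have h1 := off_nonneg hp (Icc_half_subset hx1)
  have h2 := off_nonneg hp (Icc_half_subset hxh)
  have h3 := off_nonneg hp (half_Icc_subset he1)
  have h4 := off_nonneg hp (half_Icc_subset he')
  have h5 := on_nonneg hp (Icc_half_subset hx2) (ChainDom.interference_mem hp hg1)
  have h6 := on_nonneg hp (x := star e' (p + g1 * (1 - p)))
    (star_mem (half_Icc_subset he') (ChainDom.interference_mem hp hg1))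
    (Icc_half_subset (mix_mem hp hy1 hy2))
  have h7 := on_fair_nonneg hp ((1 - p) * yh)
  have h8 := on_fair_nonneg hp (p + g1 * (1 - p))
  have h9 := on_nonneg hp (Icc_half_subset hx2) (half_Icc_subset hg')
  linarith [hp.2]

theorem weak_long_nonneg (hp : p ∈ Set.Icc (0 : ℝ) 1) (k : ℕ)
    (hx1 : x1 ∈ Set.Icc (0 : ℝ) (1 / 2)) (hx2 : x2 ∈ Set.Icc (0 : ℝ) (1 / 2))
    (hxh : xh ∈ Set.Icc (0 : ℝ) (1 / 2)) (he1 : e1 ∈ Set.Icc (1 / 2 : ℝ) 1)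
    (he' : e' ∈ Set.Icc (1 / 2 : ℝ) 1)
    (hy1 : y1 ∈ Set.Icc (0 : ℝ) (1 / 2)) (hy2 : y2 ∈ Set.Icc (0 : ℝ) (1 / 2))
    (yh : ℝ) (hg1 : g1 ∈ Set.Icc (1 / 2 : ℝ) 1) (hg' : g' ∈ Set.Icc (1 / 2 : ℝ) 1) :
    0 ≤ 1 + (1 - p) * (1 + Hb e1 + Hb xh) + p * (1 - Hb ((1 - p) * yh))
        + (coreRate p x1 x2 y1 y2 e' g' (p + g1 * (1 - p))
          + k * noisyRate p (x1, x2) (y1, y2)) := by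
  have h1 := coreRate_nonneg hp hx1 hx2 hy1 hy2 (half_Icc_subset he') (half_Icc_subset hg')
    (ChainDom.interference_mem hp hg1)
  have h2 := mul_nonneg (Nat.cast_nonneg (α := ℝ) k) (noisyRate_nonneg hp hx1 hx2 hy1 hy2)
  have h3 := off_nonneg hp (half_Icc_subset he1)
  have h4 := off_nonneg hp (Icc_half_subset hxh)
  have h7 := on_fair_nonneg hp ((1 - p) * yh)
  linarith [hp.2]

theorem strong_three_nonneg (hp : p ∈ Set.Icc (0 : ℝ) 1) (he1 : e1 ∈ Set.Icc (1 / 2 : ℝ) 1)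
    (y : ℝ) : 0 ≤ 1 / 2 * ((1 - p) * (1 + Hb e1) + p * (1 - Hb y)) := by
  linarith [off_nonneg hp (half_Icc_subset he1), on_fair_nonneg hp y, hp.2]

theorem strong_five_nonneg (hp : p ∈ Set.Icc (0 : ℝ) 1) (hx1 : x1 ∈ Set.Icc (0 : ℝ) (1 / 2))
    (he1 : e1 ∈ Set.Icc (1 / 2 : ℝ) 1) (y y' : ℝ) :
    0 ≤ 5 / 2 - p * Hb y + (1 - p) * Hb x1 + 1 / 2 * ((1 - p) * Hb e1 - p * Hb y') := by
  linarith [off_nonneg hp (half_Icc_subset he1), off_nonneg hp (Icc_half_subset hx1),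
    on_fair_nonneg hp y, on_fair_nonneg hp y', hp.2]

theorem strong_long_nonneg (hp : p ∈ Set.Icc (0 : ℝ) 1) (k : ℕ)
    (hx1 : x1 ∈ Set.Icc (0 : ℝ) (1 / 2)) (hx2 : x2 ∈ Set.Icc (0 : ℝ) (1 / 2))
    (he1 : e1 ∈ Set.Icc (1 / 2 : ℝ) 1) (he' : e' ∈ Set.Icc (1 / 2 : ℝ) 1)
    (hy1 : y1 ∈ Set.Icc (0 : ℝ) (1 / 2)) (hy2 : y2 ∈ Set.Icc (0 : ℝ) (1 / 2))
    (hg1 : g1 ∈ Set.Icc (1 / 2 : ℝ) 1) (hg' : g' ∈ Set.Icc (1 / 2 : ℝ) 1) :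
    0 ≤ 1 + (1 - p) * Hb e1 + (coreRate p x1 x2 y1 y2 e' g' (p + g1 * (1 - p))
          + k * noisyRate p (x1, x2) (y1, y2)) := by
  have h1 := coreRate_nonneg hp hx1 hx2 hy1 hy2 (half_Icc_subset he') (half_Icc_subset hg')
    (ChainDom.interference_mem hp hg1)
  have h2 := mul_nonneg (Nat.cast_nonneg (α := ℝ) k) (noisyRate_nonneg hp hx1 hx2 hy1 hy2)
  have h3 := off_nonneg hp (half_Icc_subset he1)
  linarith

/-- Very weak interference. -/
theorem very_weak_mem (hp : p ∈ Set.Icc (0 : ℝ) 1) (hT : 0 < T) (hnd : 0 < nd)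
    (h : 2 * (nc : ℝ) ≤ nd) :
    ((nd : ℝ) - p * nc, (nd : ℝ) - p * nc) ∈ capacityRegion nd nc T p := by
  have h' : 2 * nc ≤ nd := by exact_mod_cast h
  have h2 : (0 : ℝ) ≤ 2 - p := by linarith [hp.2]
  refine mem_capacityRegion_weak hp hT (by omega) 1
    (by push_cast; linarith [Nat.cast_nonneg (α := ℝ) nc]) (by push_cast; linarith)
    ChainDom.weak_two ChainDom.weak_one h2 h2 zero_le_one zero_le_one
    ?_ ?_ <;> push_cast <;> ring

theorem rateWI_mem (hp : p ∈ Set.Icc (0 : ℝ) 1) (hT : 0 < T) (hnd : 0 < nd)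
    (h₁ : (nd : ℝ) ≤ 2 * nc) (h₂ : 3 * (nc : ℝ) ≤ 2 * nd)
    (hx1 : x1 ∈ Set.Icc (0 : ℝ) (1 / 2)) (hx2 : x2 ∈ Set.Icc (0 : ℝ) (1 / 2))
    (hy1 : y1 ∈ Set.Icc (0 : ℝ) (1 / 2)) (hy2 : y2 ∈ Set.Icc (0 : ℝ) (1 / 2)) :
    (rateWI nd nc p x1 y1 y2, rateWI nd nc p y1 x1 x2) ∈ capacityRegion nd nc T p := by
  have h' : 3 * nc ≤ 2 * nd := by exact_mod_cast h₂
  have h2 : (0 : ℝ) ≤ 2 - p := by linarith [hp.2]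
  refine mem_capacityRegion_weak hp hT (by omega) 2 (by push_cast; linarith)
    (by push_cast; linarith) (ChainDom.weak_three hx1 hx2 hy1 hy2) ChainDom.weak_two
    (weak_three_nonneg hp hx1 _) (weak_three_nonneg hp hy1 _) h2 h2 ?_ ?_ <;>
  · unfold rateWI
    push_cast
    ring

/-- Chains of three and four levels. The short ones use the tilde parameters, which also occur in
the four-level pair with weight one half; together they give the coefficient $(4n_d-5n_c)/2$. -/
theorem rateMI1_mem (hp : p ∈ Set.Icc (0 : ℝ) 1) (hT : 0 < T) (hnd : 0 < nd)
    (h₁ : 2 * (nd : ℝ) ≤ 3 * nc) (h₂ : 4 * (nc : ℝ) ≤ 3 * nd)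
    (hx1 : x1 ∈ Set.Icc (0 : ℝ) (1 / 2)) (hx2 : x2 ∈ Set.Icc (0 : ℝ) (1 / 2))
    (hxt1 : xt1 ∈ Set.Icc (0 : ℝ) (1 / 2)) (hxt2 : xt2 ∈ Set.Icc (0 : ℝ) (1 / 2))
    (hxh : xh ∈ Set.Icc (0 : ℝ) (1 / 2)) (he1 : e1 ∈ Set.Icc (1 / 2 : ℝ) 1)
    (hy1 : y1 ∈ Set.Icc (0 : ℝ) (1 / 2)) (hy2 : y2 ∈ Set.Icc (0 : ℝ) (1 / 2))
    (hyt1 : yt1 ∈ Set.Icc (0 : ℝ) (1 / 2)) (hyt2 : yt2 ∈ Set.Icc (0 : ℝ) (1 / 2))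
    (hyh : yh ∈ Set.Icc (0 : ℝ) (1 / 2)) (hg1 : g1 ∈ Set.Icc (1 / 2 : ℝ) 1) :
    (rateMI1 nd nc p x1 x2 xt1 xt2 xh e1 y1 y2 yt1 yt2 yh g1,
      rateMI1 nd nc p y1 y2 yt1 yt2 yh g1 x1 x2 xt1 xt2 xh e1) ∈ capacityRegion nd nc T p := by
  have h' : 4 * nc ≤ 3 * nd := by exact_mod_cast h₂
  refine mem_capacityRegion_weak hp hT (by omega) 3 (by push_cast; linarith)
    (by push_cast; linarith)
    (ChainDom.weak_four hx1 hx2 hxt1 hxt2 hxh he1 hy1 hy2 hyt1 hyt2 hyh hg1)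
    (ChainDom.weak_three hxt1 hxt2 hyt1 hyt2)
    (weak_four_nonneg hp hx1 hx2 hxt1 hxt2 hxh he1 hy1 hy2 _ _ hg1)
    (weak_four_nonneg hp hy1 hy2 hyt1 hyt2 hyh hg1 hx1 hx2 _ _ he1)
    (weak_three_nonneg hp hxt1 _) (weak_three_nonneg hp hyt1 _) ?_ ?_ <;>
  · unfold rateMI1
    push_cast
    ring

theorem rateMI2_mem (hp : p ∈ Set.Icc (0 : ℝ) 1) (hT : 0 < T) (hnd : 0 < nd)
    (h₁ : 3 * (nd : ℝ) ≤ 4 * nc) (h₂ : 5 * (nc : ℝ) ≤ 4 * nd)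
    (hx1 : x1 ∈ Set.Icc (0 : ℝ) (1 / 2)) (hx2 : x2 ∈ Set.Icc (0 : ℝ) (1 / 2))
    (hxt1 : xt1 ∈ Set.Icc (0 : ℝ) (1 / 2)) (hxt2 : xt2 ∈ Set.Icc (0 : ℝ) (1 / 2))
    (hxh : xh ∈ Set.Icc (0 : ℝ) (1 / 2)) (he1 : e1 ∈ Set.Icc (1 / 2 : ℝ) 1)
    (hy1 : y1 ∈ Set.Icc (0 : ℝ) (1 / 2)) (hy2 : y2 ∈ Set.Icc (0 : ℝ) (1 / 2))
    (hyt1 : yt1 ∈ Set.Icc (0 : ℝ) (1 / 2)) (hyt2 : yt2 ∈ Set.Icc (0 : ℝ) (1 / 2))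
    (hyh : yh ∈ Set.Icc (0 : ℝ) (1 / 2)) (hg1 : g1 ∈ Set.Icc (1 / 2 : ℝ) 1) :
    (rateMI2 nd nc p x1 x2 xt1 xt2 xh e1 y1 y2 yt1 yt2 yh g1,
      rateMI2 nd nc p y1 y2 yt1 yt2 yh g1 x1 x2 xt1 xt2 xh e1) ∈ capacityRegion nd nc T p := by
  have h' : 5 * nc ≤ 4 * nd := by exact_mod_cast h₂
  refine mem_capacityRegion_weak hp hT (by omega) 4 (by push_cast; linarith)
    (by push_cast; linarith) (ChainDom.weak_five hx1 hx2 hxh he1 hy1 hy2 hyh hg1)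
    (ChainDom.weak_four hx1 hx2 hxt1 hxt2 hxh he1 hy1 hy2 hyt1 hyt2 hyh hg1)
    (weak_five_nonneg hp hx1 hx2 hxh he1 _ hg1) (weak_five_nonneg hp hy1 hy2 hyh hg1 _ he1)
    (weak_four_nonneg hp hx1 hx2 hxt1 hxt2 hxh he1 hy1 hy2 _ _ hg1)
    (weak_four_nonneg hp hy1 hy2 hyt1 hyt2 hyh hg1 hx1 hx2 _ _ he1) ?_ ?_ <;>
  · unfold rateMI2
    push_cast
    ring

theorem rateMI3_mem (hp : p ∈ Set.Icc (0 : ℝ) 1) (hT : 0 < T) (hnd : 0 < nd)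
    (h₁ : 4 * (nd : ℝ) ≤ 5 * nc) (h₂ : 7 * (nc : ℝ) ≤ 6 * nd)
    (hx1 : x1 ∈ Set.Icc (0 : ℝ) (1 / 2)) (hx2 : x2 ∈ Set.Icc (0 : ℝ) (1 / 2))
    (hxh : xh ∈ Set.Icc (0 : ℝ) (1 / 2)) (he1 : e1 ∈ Set.Icc (1 / 2 : ℝ) 1)
    (he' : e' ∈ Set.Icc (1 / 2 : ℝ) 1)
    (hy1 : y1 ∈ Set.Icc (0 : ℝ) (1 / 2)) (hy2 : y2 ∈ Set.Icc (0 : ℝ) (1 / 2))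
    (hyh : yh ∈ Set.Icc (0 : ℝ) (1 / 2)) (hg1 : g1 ∈ Set.Icc (1 / 2 : ℝ) 1)
    (hg' : g' ∈ Set.Icc (1 / 2 : ℝ) 1) :
    (rateMI3 nd nc p x1 x2 xh e1 e' y1 y2 yh g1 g',
      rateMI3 nd nc p y1 y2 yh g1 g' x1 x2 xh e1 e') ∈ capacityRegion nd nc T p := by
  have h' : 7 * nc ≤ 6 * nd := by exact_mod_cast h₂
  have n1 := weak_six_nonneg hp hx1 hx2 hxh he1 he' hy1 hy2 yh hg1 hg'
  have n2 := weak_six_nonneg hp hy1 hy2 hyh hg1 hg' hx1 hx2 xh he1 he'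
  have hsix := ChainDom.weak_six hp hx1 hx2 hxh he1 he' hy1 hy2 hyh hg1 hg'
  -- The range covers two pairs of lengths, five with six and six with seven levels. The six-level
  -- rates are the midpoint of the neighbouring ones, so one formula serves both.
  rcases le_total (nd : ℝ) (6 * (nd - nc)) with h | h
  · refine mem_capacityRegion_weak hp hT (by omega) 5 (by push_cast; linarith)
      (by push_cast; linarith) hsix (ChainDom.weak_five hx1 hx2 hxh he1 hy1 hy2 hyh hg1)
      n1 n2 (weak_five_nonneg hp hx1 hx2 hxh he1 _ hg1)
      (weak_five_nonneg hp hy1 hy2 hyh hg1 _ he1) ?_ ?_ <;>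
    · unfold rateMI3 star
      push_cast
      ring
  · refine mem_capacityRegion_weak hp hT (by omega) 6 (by push_cast; linarith)
      (by push_cast; linarith) (ChainDom.weak_long hp 0 hx1 hx2 hxh he1 he' hy1 hy2 hyh hg1 hg')
      hsix (weak_long_nonneg hp 0 hx1 hx2 hxh he1 he' hy1 hy2 _ hg1 hg')
      (weak_long_nonneg hp 0 hy1 hy2 hyh hg1 hg' hx1 hx2 _ he1 he') n1 n2 ?_ ?_ <;>
    · unfold rateMI3 coreRate star
      push_cast
      ring

/-- Equal signal and interference levels. -/
theorem mem_capacityRegion_equal (hp : p ∈ Set.Icc (0 : ℝ) 1) (hT : 0 < T) (hnd : 0 < nd)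
    (hx1 : x1 ∈ Set.Icc (0 : ℝ) (1 / 2)) (hx2 : x2 ∈ Set.Icc (0 : ℝ) (1 / 2))
    (hy1 : y1 ∈ Set.Icc (0 : ℝ) (1 / 2)) (hy2 : y2 ∈ Set.Icc (0 : ℝ) (1 / 2)) {R : ℝ × ℝ}
    (hR₁ : R.1 = nd * noisyRate p (x1, x2) (y1, y2))
    (hR₂ : R.2 = nd * noisyRate p (y1, y2) (x1, x2)) : R ∈ capacityRegion nd nd T p := by
  have h (m : ℕ) := ChainDom.indep_equal (p := p) (m := m) (L := fun _ => (x1, x2))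
    (L' := fun _ => (y1, y2)) (fun _ => unitPair_half hx1 hx2) (fun _ => unitPair_half hy1 hy2)
  have n1 := noisyRate_nonneg hp hx1 hx2 hy1 hy2
  have n2 := noisyRate_nonneg hp hy1 hy2 hx1 hx2
  -- Each level is a chain of length one. With `r = 0` the pair for two levels has weight zero.
  refine mem_capacityRegion_of_chainDom hp hT (D := nd) (n := 1) (r := 0) (a := 0) (b := 0) hnd
    (by omega) (by simp) (by simp) (by simp) (h 2) (h 1) ?_ ?_ ?_ ?_
  · rw [hR₁]; positivity
  · rw [hR₂]; positivity
  · rw [hR₁]; simp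
  · rw [hR₂]; simp

theorem rateMI4_mem (hp : p ∈ Set.Icc (0 : ℝ) 1) (hT : 0 < T) (hnd : 0 < nd)
    (h₁ : 6 * (nd : ℝ) ≤ 7 * nc) (h₂ : (nc : ℝ) ≤ nd)
    (hx1 : x1 ∈ Set.Icc (0 : ℝ) (1 / 2)) (hx2 : x2 ∈ Set.Icc (0 : ℝ) (1 / 2))
    (hxh : xh ∈ Set.Icc (0 : ℝ) (1 / 2)) (he1 : e1 ∈ Set.Icc (1 / 2 : ℝ) 1)
    (he' : e' ∈ Set.Icc (1 / 2 : ℝ) 1)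
    (hy1 : y1 ∈ Set.Icc (0 : ℝ) (1 / 2)) (hy2 : y2 ∈ Set.Icc (0 : ℝ) (1 / 2))
    (hyh : yh ∈ Set.Icc (0 : ℝ) (1 / 2)) (hg1 : g1 ∈ Set.Icc (1 / 2 : ℝ) 1)
    (hg' : g' ∈ Set.Icc (1 / 2 : ℝ) 1) :
    (rateMI4 nd nc p x1 x2 xh e1 e' y1 y2 yh g1 g',
      rateMI4 nd nc p y1 y2 yh g1 g' x1 x2 xh e1 e') ∈ capacityRegion nd nc T p := by
  have hle : nc ≤ nd := by exact_mod_cast h₂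
  rcases hle.eq_or_lt with rfl | hlt
  -- All terms with a factor `nd - nc` vanish, and only the colliding levels are left.
  · refine mem_capacityRegion_equal hp hT hnd hx1 hx2 hy1 hy2 ?_ ?_ <;>
    · unfold rateMI4 noisyRate
      ring
  have hD : (0 : ℝ) < nd - nc := sub_pos.2 (by exact_mod_cast hlt)
  have hD' : ((nd - nc : ℕ) : ℝ) = nd - nc := Nat.cast_sub hle
  -- Seven is the shortest length covered by `weak_long`; `k` counts the additional levels.
  have hlow : 7 ≤ nd / (nd - nc) := by
    rw [Nat.le_div_iff_mul_le (by omega)]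
    have : 6 * nd ≤ 7 * nc := by exact_mod_cast h₁
    omega
  obtain ⟨k, hk⟩ := Nat.exists_eq_add_of_le' hlow
  have hk1 : ((k + 7 : ℕ) : ℝ) * (nd - nc) ≤ nd := by
    rw [← hk, ← hD']
    exact_mod_cast Nat.div_mul_le_self nd (nd - nc)
  have hk2 : (nd : ℝ) ≤ (((k + 7 : ℕ) : ℝ) + 1) * (nd - nc) := by
    rw [← hk, ← hD']
    have := (Nat.lt_mul_div_succ nd (show 0 < nd - nc by omega)).le
    rw [mul_comm] at this
    exact_mod_cast this
  refine mem_capacityRegion_weak hp hT hlt (k + 7) hk1 hk2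
    (ChainDom.weak_long hp (k + 1) hx1 hx2 hxh he1 he' hy1 hy2 hyh hg1 hg')
    (ChainDom.weak_long hp k hx1 hx2 hxh he1 he' hy1 hy2 hyh hg1 hg')
    (weak_long_nonneg hp _ hx1 hx2 hxh he1 he' hy1 hy2 _ hg1 hg')
    (weak_long_nonneg hp _ hy1 hy2 hyh hg1 hg' hx1 hx2 _ he1 he')
    (weak_long_nonneg hp _ hx1 hx2 hxh he1 he' hy1 hy2 _ hg1 hg')
    (weak_long_nonneg hp _ hy1 hy2 hyh hg1 hg' hx1 hx2 _ he1 he') ?_ ?_ <;>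
  · unfold rateMI4 coreRate noisyRate star
    push_cast
    ring

theorem rateSI1_mem (hp : p ∈ Set.Icc (0 : ℝ) 1) (hT : 0 < T) (hnd : 0 < nd)
    (h₁ : (nd : ℝ) ≤ nc) (h₂ : 5 * (nc : ℝ) ≤ 6 * nd)
    (hx1 : x1 ∈ Set.Icc (0 : ℝ) (1 / 2)) (hx2 : x2 ∈ Set.Icc (0 : ℝ) (1 / 2))
    (he1 : e1 ∈ Set.Icc (1 / 2 : ℝ) 1) (he' : e' ∈ Set.Icc (1 / 2 : ℝ) 1)
    (hy1 : y1 ∈ Set.Icc (0 : ℝ) (1 / 2)) (hy2 : y2 ∈ Set.Icc (0 : ℝ) (1 / 2))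
    (hg1 : g1 ∈ Set.Icc (1 / 2 : ℝ) 1) (hg' : g' ∈ Set.Icc (1 / 2 : ℝ) 1) :
    (rateSI1 nd nc p x1 x2 e1 e' y1 y2 g1 g',
      rateSI1 nd nc p y1 y2 g1 g' x1 x2 e1 e') ∈ capacityRegion nd nc T p := by
  have hle : nd ≤ nc := by exact_mod_cast h₁
  rcases hle.eq_or_lt with rfl | hlt
  · refine mem_capacityRegion_equal hp hT hnd hx1 hx2 hy1 hy2 ?_ ?_ <;>
    · unfold rateSI1 noisyRate
      ring
  have hD : (0 : ℝ) < nc - nd := sub_pos.2 (by exact_mod_cast hlt)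
  have hD' : ((nc - nd : ℕ) : ℝ) = nc - nd := Nat.cast_sub hle
  -- Six is the shortest length covered by `strong_long`.
  have hlow : 6 ≤ nc / (nc - nd) := by
    rw [Nat.le_div_iff_mul_le (by omega)]
    have : 5 * nc ≤ 6 * nd := by exact_mod_cast h₂
    omega
  obtain ⟨k, hk⟩ := Nat.exists_eq_add_of_le' hlow
  have hk1 : ((k + 6 : ℕ) : ℝ) * (nc - nd) ≤ nc := by
    rw [← hk, ← hD']
    exact_mod_cast Nat.div_mul_le_self nc (nc - nd)
  have hk2 : (nc : ℝ) ≤ (((k + 6 : ℕ) : ℝ) + 1) * (nc - nd) := by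
    rw [← hk, ← hD']
    have := (Nat.lt_mul_div_succ nc (show 0 < nc - nd by omega)).le
    rw [mul_comm] at this
    exact_mod_cast this
  refine mem_capacityRegion_strong hp hT hlt (k + 6) hk1 hk2
    (ChainDom.strong_long hp (k + 1) hx1 hx2 he1 he' hy1 hy2 hg1 hg')
    (ChainDom.strong_long hp k hx1 hx2 he1 he' hy1 hy2 hg1 hg')
    (strong_long_nonneg hp _ hx1 hx2 he1 he' hy1 hy2 hg1 hg')
    (strong_long_nonneg hp _ hy1 hy2 hg1 hg' hx1 hx2 he1 he')
    (strong_long_nonneg hp _ hx1 hx2 he1 he' hy1 hy2 hg1 hg')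
    (strong_long_nonneg hp _ hy1 hy2 hg1 hg' hx1 hx2 he1 he') ?_ ?_ <;>
  · unfold rateSI1 coreRate noisyRate star
    push_cast
    ring

theorem coreRate_half (p x1 x2 y1 y2 gt : ℝ) : coreRate p x1 x2 y1 y2 (1 / 2) (1 / 2) gt
    = (1 - p) * (2 + Hb x1) + p * (2 - Hb gt - Hb (mix p y1 y2)) := by
  unfold coreRate
  rw [show star (1 / 2) gt = 1 / 2 by unfold star; ring]
  simp only [Hsum_half, Hsum_half', Hb_half]
  ring

theorem rateSI2_mem (hp : p ∈ Set.Icc (0 : ℝ) 1) (hT : 0 < T) (hnd : 0 < nd)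
    (h₁ : 6 * (nd : ℝ) ≤ 5 * nc) (h₂ : 3 * (nc : ℝ) ≤ 4 * nd)
    (hx1 : x1 ∈ Set.Icc (0 : ℝ) (1 / 2)) (hx2 : x2 ∈ Set.Icc (0 : ℝ) (1 / 2))
    (he1 : e1 ∈ Set.Icc (1 / 2 : ℝ) 1)
    (hy1 : y1 ∈ Set.Icc (0 : ℝ) (1 / 2)) (hy2 : y2 ∈ Set.Icc (0 : ℝ) (1 / 2))
    (hg1 : g1 ∈ Set.Icc (1 / 2 : ℝ) 1) :
    (rateSI2 nd nc p x1 e1 y1 y2 g1, rateSI2 nd nc p y1 g1 x1 x2 e1)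
      ∈ capacityRegion nd nc T p := by
  have h' : 6 * nd ≤ 5 * nc := by exact_mod_cast h₁
  have hfive := ChainDom.strong_five (p := p) hx1 hx2 he1 hy1 hy2 hg1
  have n1 := strong_five_nonneg hp hx1 he1 (mix p y1 y2) (p + g1 * (1 - p))
  have n2 := strong_five_nonneg hp hy1 hg1 (mix p x1 x2) (p + e1 * (1 - p))
  have hhalf : (1 / 2 : ℝ) ∈ Set.Icc (1 / 2 : ℝ) 1 := ⟨le_rfl, by norm_num⟩
  -- Again one formula covers two pairs of lengths, four with five and five with six levels; at six
  -- levels independent bits suffice.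
  rcases le_total (nc : ℝ) (5 * (nc - nd)) with h | h
  · refine mem_capacityRegion_strong hp hT (by omega) 4 (by push_cast; linarith)
      (by push_cast; linarith) hfive (ChainDom.strong_four hx1 hx2 hy1 hy2) n1 n2
      (weak_three_nonneg hp hx1 _) (weak_three_nonneg hp hy1 _) ?_ ?_ <;>
    · unfold rateSI2
      push_cast
      ring
  · refine mem_capacityRegion_strong hp hT (by omega) 5 (by push_cast; linarith)
      (by push_cast; linarith) (ChainDom.strong_indep 0 hx1 hx2 he1 hy1 hy2 hg1) hfive
      (strong_long_nonneg hp 0 hx1 hx2 he1 hhalf hy1 hy2 hg1 hhalf)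
      (strong_long_nonneg hp 0 hy1 hy2 hg1 hhalf hx1 hx2 he1 hhalf) n1 n2 ?_ ?_ <;>
    · unfold rateSI2
      dsimp only
      rw [coreRate_half]
      push_cast
      ring

theorem rateSI3_mem (hp : p ∈ Set.Icc (0 : ℝ) 1) (hT : 0 < T) (hnd : 0 < nd)
    (h₁ : 4 * (nd : ℝ) ≤ 3 * nc) (h₂ : 2 * (nc : ℝ) ≤ 3 * nd)
    (hx1 : x1 ∈ Set.Icc (0 : ℝ) (1 / 2)) (hx2 : x2 ∈ Set.Icc (0 : ℝ) (1 / 2))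
    (he1 : e1 ∈ Set.Icc (1 / 2 : ℝ) 1)
    (hy1 : y1 ∈ Set.Icc (0 : ℝ) (1 / 2)) (hy2 : y2 ∈ Set.Icc (0 : ℝ) (1 / 2))
    (hg1 : g1 ∈ Set.Icc (1 / 2 : ℝ) 1) :
    (rateSI3 nd nc p x1 e1 y1 y2 g1, rateSI3 nd nc p y1 g1 x1 x2 e1)
      ∈ capacityRegion nd nc T p := by
  have h' : 4 * nd ≤ 3 * nc := by exact_mod_cast h₁
  refine mem_capacityRegion_strong hp hT (by omega) 3 (by push_cast; linarith)
    (by push_cast; linarith) (ChainDom.strong_four hx1 hx2 hy1 hy2)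
    -- The claimed formula credits a three-level chain with half a bit less per user than the scheme
    -- delivers, so the pair is lowered accordingly.
    ((ChainDom.strong_three he1 hg1).of_le
      (τ' := (1 / 2 + 1 / 2 * ((1 - p) * (1 + Hb e1) + p * (1 - Hb (p + g1 * (1 - p)))),
        1 / 2 + 1 / 2 * ((1 - p) * (1 + Hb g1) + p * (1 - Hb (p + e1 * (1 - p))))))
      (by dsimp only; linarith) (by dsimp only; linarith))
    (weak_three_nonneg hp hx1 _) (weak_three_nonneg hp hy1 _)
    (add_nonneg one_half_pos.le (strong_three_nonneg hp he1 _))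
    (add_nonneg one_half_pos.le (strong_three_nonneg hp hg1 _)) ?_ ?_ <;>
  · unfold rateSI3
    push_cast
    ring

theorem rateSI4_mem (hp : p ∈ Set.Icc (0 : ℝ) 1) (hT : 0 < T) (hnd : 0 < nd)
    (h₁ : 3 * (nd : ℝ) ≤ 2 * nc) (h₂ : (nc : ℝ) ≤ 2 * nd)
    (he1 : e1 ∈ Set.Icc (1 / 2 : ℝ) 1) (hg1 : g1 ∈ Set.Icc (1 / 2 : ℝ) 1) :
    (rateSI4 nd nc p e1 g1, rateSI4 nd nc p g1 e1) ∈ capacityRegion nd nc T p := by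
  have h' : 3 * nd ≤ 2 * nc := by exact_mod_cast h₁
  refine mem_capacityRegion_strong hp hT (by omega) 2 (by push_cast; linarith)
    (by push_cast; linarith) (ChainDom.strong_three he1 hg1) ChainDom.strong_two
    (add_nonneg zero_le_one (strong_three_nonneg hp he1 _))
    (add_nonneg zero_le_one (strong_three_nonneg hp hg1 _)) zero_le_one zero_le_one ?_ ?_ <;>
  · unfold rateSI4
    push_cast
    ring

end

end BurstyIC

theorem mainTheorem11 (nd nc T : ℕ) (hnd : 0 < nd) (hT : 0 < T)
    (p : ℝ) (hp : p ∈ Set.Icc (0 : ℝ) 1) (α : ℝ) (hα : α = (nc : ℝ) / (nd : ℝ)) :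
    -- very weak interference
    (α ≤ 1 / 2 →
      ∃ R ∈ BurstyIC.capacityRegion nd nc T p, R.1 + R.2 = 2 * ((nd : ℝ) - p * nc)) ∧
    -- weak interference
    (1 / 2 < α → α ≤ 2 / 3 →
      ∀ p1 ∈ Set.Icc (0 : ℝ) (1 / 2), ∀ p2 ∈ Set.Icc (0 : ℝ) (1 / 2),
      ∀ q1 ∈ Set.Icc (0 : ℝ) (1 / 2), ∀ q2 ∈ Set.Icc (0 : ℝ) (1 / 2),
        (BurstyIC.rateWI nd nc p p1 q1 q2, BurstyIC.rateWI nd nc p q1 p1 p2)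
          ∈ BurstyIC.capacityRegion nd nc T p) ∧
    -- moderate interference
    (2 / 3 ≤ α → α ≤ 3 / 4 →
      ∀ p1 ∈ Set.Icc (0 : ℝ) (1 / 2), ∀ p2 ∈ Set.Icc (0 : ℝ) (1 / 2),
      ∀ pt1 ∈ Set.Icc (0 : ℝ) (1 / 2), ∀ pt2 ∈ Set.Icc (0 : ℝ) (1 / 2),
      ∀ ph1 ∈ Set.Icc (0 : ℝ) (1 / 2),
      ∀ q1 ∈ Set.Icc (0 : ℝ) (1 / 2), ∀ q2 ∈ Set.Icc (0 : ℝ) (1 / 2),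
      ∀ qt1 ∈ Set.Icc (0 : ℝ) (1 / 2), ∀ qt2 ∈ Set.Icc (0 : ℝ) (1 / 2),
      ∀ qh1 ∈ Set.Icc (0 : ℝ) (1 / 2),
      ∀ η1 ∈ Set.Icc (1 / 2 : ℝ) 1, ∀ γ1 ∈ Set.Icc (1 / 2 : ℝ) 1,
        (BurstyIC.rateMI1 nd nc p p1 p2 pt1 pt2 ph1 η1 q1 q2 qt1 qt2 qh1 γ1,
          BurstyIC.rateMI1 nd nc p q1 q2 qt1 qt2 qh1 γ1 p1 p2 pt1 pt2 ph1 η1)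
          ∈ BurstyIC.capacityRegion nd nc T p) ∧
    (3 / 4 ≤ α → α ≤ 4 / 5 →
      ∀ p1 ∈ Set.Icc (0 : ℝ) (1 / 2), ∀ p2 ∈ Set.Icc (0 : ℝ) (1 / 2),
      ∀ pt1 ∈ Set.Icc (0 : ℝ) (1 / 2), ∀ pt2 ∈ Set.Icc (0 : ℝ) (1 / 2),
      ∀ ph1 ∈ Set.Icc (0 : ℝ) (1 / 2),
      ∀ q1 ∈ Set.Icc (0 : ℝ) (1 / 2), ∀ q2 ∈ Set.Icc (0 : ℝ) (1 / 2),
      ∀ qt1 ∈ Set.Icc (0 : ℝ) (1 / 2), ∀ qt2 ∈ Set.Icc (0 : ℝ) (1 / 2),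
      ∀ qh1 ∈ Set.Icc (0 : ℝ) (1 / 2),
      ∀ η1 ∈ Set.Icc (1 / 2 : ℝ) 1, ∀ γ1 ∈ Set.Icc (1 / 2 : ℝ) 1,
        (BurstyIC.rateMI2 nd nc p p1 p2 pt1 pt2 ph1 η1 q1 q2 qt1 qt2 qh1 γ1,
          BurstyIC.rateMI2 nd nc p q1 q2 qt1 qt2 qh1 γ1 p1 p2 pt1 pt2 ph1 η1)
          ∈ BurstyIC.capacityRegion nd nc T p) ∧
    (4 / 5 ≤ α → α ≤ 6 / 7 →
      ∀ p1 ∈ Set.Icc (0 : ℝ) (1 / 2), ∀ p2 ∈ Set.Icc (0 : ℝ) (1 / 2),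
      ∀ ph1 ∈ Set.Icc (0 : ℝ) (1 / 2),
      ∀ q1 ∈ Set.Icc (0 : ℝ) (1 / 2), ∀ q2 ∈ Set.Icc (0 : ℝ) (1 / 2),
      ∀ qh1 ∈ Set.Icc (0 : ℝ) (1 / 2),
      ∀ η1 ∈ Set.Icc (1 / 2 : ℝ) 1, ∀ η' ∈ Set.Icc (1 / 2 : ℝ) 1,
      ∀ γ1 ∈ Set.Icc (1 / 2 : ℝ) 1, ∀ γ' ∈ Set.Icc (1 / 2 : ℝ) 1,
        (BurstyIC.rateMI3 nd nc p p1 p2 ph1 η1 η' q1 q2 qh1 γ1 γ',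
          BurstyIC.rateMI3 nd nc p q1 q2 qh1 γ1 γ' p1 p2 ph1 η1 η')
          ∈ BurstyIC.capacityRegion nd nc T p) ∧
    (6 / 7 ≤ α → α ≤ 1 →
      ∀ p1 ∈ Set.Icc (0 : ℝ) (1 / 2), ∀ p2 ∈ Set.Icc (0 : ℝ) (1 / 2),
      ∀ ph1 ∈ Set.Icc (0 : ℝ) (1 / 2),
      ∀ q1 ∈ Set.Icc (0 : ℝ) (1 / 2), ∀ q2 ∈ Set.Icc (0 : ℝ) (1 / 2),
      ∀ qh1 ∈ Set.Icc (0 : ℝ) (1 / 2),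
      ∀ η1 ∈ Set.Icc (1 / 2 : ℝ) 1, ∀ η' ∈ Set.Icc (1 / 2 : ℝ) 1,
      ∀ γ1 ∈ Set.Icc (1 / 2 : ℝ) 1, ∀ γ' ∈ Set.Icc (1 / 2 : ℝ) 1,
        (BurstyIC.rateMI4 nd nc p p1 p2 ph1 η1 η' q1 q2 qh1 γ1 γ',
          BurstyIC.rateMI4 nd nc p q1 q2 qh1 γ1 γ' p1 p2 ph1 η1 η')
          ∈ BurstyIC.capacityRegion nd nc T p) ∧
    -- strong interference
    (1 ≤ α → α ≤ 6 / 5 →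
      ∀ p1 ∈ Set.Icc (0 : ℝ) (1 / 2), ∀ p2 ∈ Set.Icc (0 : ℝ) (1 / 2),
      ∀ q1 ∈ Set.Icc (0 : ℝ) (1 / 2), ∀ q2 ∈ Set.Icc (0 : ℝ) (1 / 2),
      ∀ η1 ∈ Set.Icc (1 / 2 : ℝ) 1, ∀ η' ∈ Set.Icc (1 / 2 : ℝ) 1,
      ∀ γ1 ∈ Set.Icc (1 / 2 : ℝ) 1, ∀ γ' ∈ Set.Icc (1 / 2 : ℝ) 1,
        (BurstyIC.rateSI1 nd nc p p1 p2 η1 η' q1 q2 γ1 γ',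
          BurstyIC.rateSI1 nd nc p q1 q2 γ1 γ' p1 p2 η1 η')
          ∈ BurstyIC.capacityRegion nd nc T p) ∧
    (6 / 5 ≤ α → α ≤ 4 / 3 →
      ∀ p1 ∈ Set.Icc (0 : ℝ) (1 / 2), ∀ p2 ∈ Set.Icc (0 : ℝ) (1 / 2),
      ∀ q1 ∈ Set.Icc (0 : ℝ) (1 / 2), ∀ q2 ∈ Set.Icc (0 : ℝ) (1 / 2),
      ∀ η1 ∈ Set.Icc (1 / 2 : ℝ) 1, ∀ γ1 ∈ Set.Icc (1 / 2 : ℝ) 1,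
        (BurstyIC.rateSI2 nd nc p p1 η1 q1 q2 γ1, BurstyIC.rateSI2 nd nc p q1 γ1 p1 p2 η1)
          ∈ BurstyIC.capacityRegion nd nc T p) ∧
    (4 / 3 ≤ α → α ≤ 3 / 2 →
      ∀ p1 ∈ Set.Icc (0 : ℝ) (1 / 2), ∀ p2 ∈ Set.Icc (0 : ℝ) (1 / 2),
      ∀ q1 ∈ Set.Icc (0 : ℝ) (1 / 2), ∀ q2 ∈ Set.Icc (0 : ℝ) (1 / 2),
      ∀ η1 ∈ Set.Icc (1 / 2 : ℝ) 1, ∀ γ1 ∈ Set.Icc (1 / 2 : ℝ) 1,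
        (BurstyIC.rateSI3 nd nc p p1 η1 q1 q2 γ1, BurstyIC.rateSI3 nd nc p q1 γ1 p1 p2 η1)
          ∈ BurstyIC.capacityRegion nd nc T p) ∧
    (3 / 2 ≤ α → α ≤ 2 →
      ∀ η1 ∈ Set.Icc (1 / 2 : ℝ) 1, ∀ γ1 ∈ Set.Icc (1 / 2 : ℝ) 1,
        (BurstyIC.rateSI4 nd nc p η1 γ1, BurstyIC.rateSI4 nd nc p γ1 η1)
          ∈ BurstyIC.capacityRegion nd nc T p) := by

  have hnd' : (0 : ℝ) < nd := Nat.cast_pos.2 hnd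
  subst hα
  -- Clearing the denominator turns the ranges of `α` into linear inequalities between `nc` and
  -- `nd`.
  simp only [div_le_iff₀ hnd', lt_div_iff₀ hnd', le_div_iff₀ hnd']
  refine ⟨fun h => ⟨_, BurstyIC.very_weak_mem hp hT hnd (by linarith), by ring⟩,
    fun h h' p1 hp1 p2 hp2 q1 hq1 q2 hq2 =>
      BurstyIC.rateWI_mem hp hT hnd (by linarith) (by linarith) hp1 hp2 hq1 hq2,
    fun h h' p1 hp1 p2 hp2 pt1 hpt1 pt2 hpt2 ph1 hph1 q1 hq1 q2 hq2 qt1 hqt1 qt2 hqt2 qh1 hqh1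
        η1 hη1 γ1 hγ1 =>
      BurstyIC.rateMI1_mem hp hT hnd (by linarith) (by linarith) hp1 hp2 hpt1 hpt2 hph1 hη1
        hq1 hq2 hqt1 hqt2 hqh1 hγ1,
    fun h h' p1 hp1 p2 hp2 pt1 hpt1 pt2 hpt2 ph1 hph1 q1 hq1 q2 hq2 qt1 hqt1 qt2 hqt2 qh1 hqh1
        η1 hη1 γ1 hγ1 =>
      BurstyIC.rateMI2_mem hp hT hnd (by linarith) (by linarith) hp1 hp2 hpt1 hpt2 hph1 hη1
        hq1 hq2 hqt1 hqt2 hqh1 hγ1,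
    fun h h' p1 hp1 p2 hp2 ph1 hph1 q1 hq1 q2 hq2 qh1 hqh1 η1 hη1 η' hη' γ1 hγ1 γ' hγ' =>
      BurstyIC.rateMI3_mem hp hT hnd (by linarith) (by linarith) hp1 hp2 hph1 hη1 hη'
        hq1 hq2 hqh1 hγ1 hγ',
    fun h h' p1 hp1 p2 hp2 ph1 hph1 q1 hq1 q2 hq2 qh1 hqh1 η1 hη1 η' hη' γ1 hγ1 γ' hγ' =>
      BurstyIC.rateMI4_mem hp hT hnd (by linarith) (by linarith) hp1 hp2 hph1 hη1 hη'
        hq1 hq2 hqh1 hγ1 hγ',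
    fun h h' p1 hp1 p2 hp2 q1 hq1 q2 hq2 η1 hη1 η' hη' γ1 hγ1 γ' hγ' =>
      BurstyIC.rateSI1_mem hp hT hnd (by linarith) (by linarith) hp1 hp2 hη1 hη'
        hq1 hq2 hγ1 hγ',
    fun h h' p1 hp1 p2 hp2 q1 hq1 q2 hq2 η1 hη1 γ1 hγ1 =>
      BurstyIC.rateSI2_mem hp hT hnd (by linarith) (by linarith) hp1 hp2 hη1 hq1 hq2 hγ1,
    fun h h' p1 hp1 p2 hp2 q1 hq1 q2 hq2 η1 hη1 γ1 hγ1 =>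
      BurstyIC.rateSI3_mem hp hT hnd (by linarith) (by linarith) hp1 hp2 hη1 hq1 hq2 hγ1,
    fun h h' η1 hη1 γ1 hγ1 =>
      BurstyIC.rateSI4_mem hp hT hnd (by linarith) (by linarith) hη1 hγ1⟩
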